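/- Let $n\ge 1$ be an integer and let $q\in[0,n)$ be real with $n+q>2$. Let $B_1\subset\mathbb{R}^n$ be the open unit ball centred at the origin. Then there exists a function $v\in C(\overline{B_1})$, $v\not\equiv 0$ in $B_1$, that is convex and non-negative in $B_1$ and solves $$\det D^2 v = v^q\chi_{\{v>0\}}\quad\text{in } B_1$$ in the sense of Aleksandrov (that is, $|\partial v(A)|=\int_{A\cap\{v>0\}} v^q\,dx$ for every Borel set $A\subset B_1$, where $\partial v(A)=\bigcup_{x\in A}\partial v(x)$, $\partial v(x)$ is the subdifferential of $v$ at $x$, and $|\cdot|$ is Lebesgue measure), with the following two properties. Put $K=\{x\in B_1: v(x)=0\}$, $\Gamma=B_1\cap\partial K$, $\Gamma_{sc}=\{x\in B_1: x \text{ is an exposed point of } K\}$ and $\Gamma_{nsc}=\Gamma\setminus\Gamma_{sc}$. Then 1. $|K|>0$; 2. $\Gamma_{nsc}$ contains a non-empty convex set $E$ of dimension $$\dim E=\left\lceil\frac{n+q}{2}\right\rceil-1,$$ where $\lceil t\rceil$ is the smallest integer $\ge t$ and $\dim E$ is the dimension of the affine span of $E$. In particular, $\dim E$ is the largest integer strictly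 less than $\frac{n+q}{2}$, so that the bound $\dim E<\frac{n+q}{2}$ for convex subsets $E$ of $\Gamma_{nsc}$ is sharp also when $|K|>0$. -/

import Mathlib

open Set Metric MeasureTheory

namespace MAObstacle

/-- The subdifferential `∂v(x)` of `v : Ω → ℝ` at `x`: the slopes of the affine functions that touch
`v` from below at `x`, throughout `Ω`. -/
def subdifferential {n : ℕ} (Ω : Set (EuclideanSpace ℝ (Fin n)))
    (v : EuclideanSpace ℝ (Fin n) → ℝ) (x : EuclideanSpace ℝ (Fin n)) :
    Set (EuclideanSpace ℝ (Fin n)) :=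
  {p | ∀ z ∈ Ω, v x + inner ℝ p (z - x) ≤ v z}

/-- The Monge-Ampère measure of `v` on `Ω`, evaluated at `A ⊆ Ω`: the Lebesgue measure
of the image `∂v(A) = ⋃ x ∈ A, ∂v(x)`. -/
noncomputable def mongeAmpere {n : ℕ} (Ω : Set (EuclideanSpace ℝ (Fin n)))
    (v : EuclideanSpace ℝ (Fin n) → ℝ) (A : Set (EuclideanSpace ℝ (Fin n))) : ENNReal :=
  volume (⋃ x ∈ A, subdifferential Ω v x)

/-- `v` is a convex nonnegative solution in `Ω`, continuous up to the boundary, of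
`det D²v = v ^ q χ_{v > 0}` in the sense of Aleksandrov: the Monge-Ampère measure of `v` has
density `v ^ q χ_{v > 0}` with respect to Lebesgue measure on `Ω`. -/
structure IsSolution {n : ℕ} (q : ℝ) (Ω : Set (EuclideanSpace ℝ (Fin n)))
    (v : EuclideanSpace ℝ (Fin n) → ℝ) : Prop where
  continuousOn : ContinuousOn v (closure Ω)
  convexOn : ConvexOn ℝ Ω v
  nonneg : ∀ x ∈ Ω, 0 ≤ v x
  det_eq : ∀ A : Set (EuclideanSpace ℝ (Fin n)), MeasurableSet A → A ⊆ Ω →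
    mongeAmpere Ω v A = ∫⁻ x in A, {y | 0 < v y}.indicator (fun y => ENNReal.ofReal (v y ^ q)) x

/-- The coincidence set `K = {x ∈ Ω : v(x) = 0}`. -/
def coincidenceSet {n : ℕ} (Ω : Set (EuclideanSpace ℝ (Fin n)))
    (v : EuclideanSpace ℝ (Fin n) → ℝ) : Set (EuclideanSpace ℝ (Fin n)) :=
  {x ∈ Ω | v x = 0}

/-- The free boundary `Γ = Ω ∩ ∂K`. -/
def freeBoundary {n : ℕ} (Ω : Set (EuclideanSpace ℝ (Fin n)))
    (v : EuclideanSpace ℝ (Fin n) → ℝ) : Set (EuclideanSpace ℝ (Fin n)) :=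
  Ω ∩ frontier (coincidenceSet Ω v)

/-- The strictly convex part `Γ_sc` of the free boundary: the points of `Ω` that are exposed points
of `K`. -/
def strictlyConvexPart {n : ℕ} (Ω : Set (EuclideanSpace ℝ (Fin n)))
    (v : EuclideanSpace ℝ (Fin n) → ℝ) : Set (EuclideanSpace ℝ (Fin n)) :=
  {x ∈ Ω | x ∈ (coincidenceSet Ω v).exposedPoints ℝ}

/-- The non-strictly convex part `Γ_nsc = Γ \ Γ_sc` of the free boundary. -/
def nonStrictlyConvexPart {n : ℕ} (Ω : Set (EuclideanSpace ℝ (Fin n)))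
    (v : EuclideanSpace ℝ (Fin n) → ℝ) : Set (EuclideanSpace ℝ (Fin n)) :=
  freeBoundary Ω v \ strictlyConvexPart Ω v

/-- The dimension of a (nonempty) convex set: the dimension of its affine span. -/
noncomputable def convexDim {n : ℕ} (E : Set (EuclideanSpace ℝ (Fin n))) : ℕ :=
  Module.finrank ℝ (vectorSpan ℝ E)

end MAObstacle

/-! The solution `v` is held up by a strict subsolution and held down by convexity. Let d =
⌈(n+q)/2⌉ - 1, let S be a set of d coordinates, fix j outside S, and let b be the squared length of
the component of x outside S. The subsolution is u = A k₊^p with k = (1 + ε|x_S|²) b^γ - 5 x_j,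
where p = 1 + τ, γ = (1 + τ)/2 and τ > 0 is small. It vanishes on the disc where all coordinates
outside S are zero.

Let v solve the Dirichlet problem with boundary values u. A chord of the ball in a direction e_i, i
∈ S, through a point of the disc ends at zeros of u, so convexity and v ≥ 0 give v = 0 on the disc.
The same chords give v = 0 where x_j > 1/2, because 5 x_j then exceeds the other term of k, which is
at most 2; hence |K| > 0. Comparison gives v ≥ u > 0 at x - s e_j for x in the disc and s > 0, so
the disc lies in ∂K. None of its points is exposed, since each is the midpoint of a segment in the
disc.

The dimension enters through det D²u. The Hessian of k is of order b^γ along S (thanks to the factor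
1 + ε|x_S|²) and b^(γ-1) in the n - d other directions; the power p adds a rank-one term along ∇k,
which replaces one factor by one of order 1/k. As k ≤ 7 b^(1/2), the inequality det D²u > u^q
reduces to the sign of the exponent (2d - n - q + τ(2n - 1 - q))/2 of b, which is nonpositive for
small τ because 2d < n + q. Constants are absorbed by a large A because q < n. See
`exists_barrier_minorant`, `barrier_exponent_bound`, `exists_barrier_strict_subsolution`.

Existence (`exists_dirichlet_solution`) comes from Perron's method on lattices, Arzelà-Ascoli, and
passage to the limit in the Aleksandrov measure (`IsGridLimit`). Comparison
(`le_solution_of_local_quadratic`) is an area argument for gradient images at a maximum of u - v. -/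

open scoped Topology ENNReal
open Filter

namespace MAObstacle

variable {n : ℕ}

/-! ### Slope sets and their dependence on the value at the contact point -/

/-- Slopes of the affine functions which take the value `s` at `x` and lie below `h` on `Y \ {x}`. -/
def slopeSet (Y : Set (EuclideanSpace ℝ (Fin n))) (h : EuclideanSpace ℝ (Fin n) → ℝ)
    (x : EuclideanSpace ℝ (Fin n)) (s : ℝ) : Set (EuclideanSpace ℝ (Fin n)) :=
  {p | ∀ y ∈ Y, y ≠ x → s + inner ℝ p (y - x) ≤ h y}

theorem subdifferential_eq_slopeSet (Y : Set (EuclideanSpace ℝ (Fin n)))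
    (h : EuclideanSpace ℝ (Fin n) → ℝ) (x : EuclideanSpace ℝ (Fin n)) :
    subdifferential Y h x = slopeSet Y h x (h x) := by
  ext p
  refine ⟨fun hp y hy _ => hp y hy, fun hp y hy => ?_⟩
  by_cases hyx : y = x
  · subst hyx; simp
  · exact hp y hy hyx

theorem slopeSet_congr {Y : Set (EuclideanSpace ℝ (Fin n))} {h g : EuclideanSpace ℝ (Fin n) → ℝ}
    {x : EuclideanSpace ℝ (Fin n)} (hg : ∀ y ∈ Y, y ≠ x → h y = g y) (s : ℝ) :
    slopeSet Y h x s = slopeSet Y g x s := by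
  ext p
  refine ⟨fun hp y hy hyx => ?_, fun hp y hy hyx => ?_⟩
  · rw [← hg y hy hyx]; exact hp y hy hyx
  · rw [hg y hy hyx]; exact hp y hy hyx

theorem slopeSet_anti (Y : Set (EuclideanSpace ℝ (Fin n))) (h : EuclideanSpace ℝ (Fin n) → ℝ)
    (x : EuclideanSpace ℝ (Fin n)) : Antitone (slopeSet Y h x) := by
  intro s t hst p hp y hy hyx
  have := hp y hy hyx
  linarith

theorem isClosed_slopeSet (Y : Set (EuclideanSpace ℝ (Fin n))) (h : EuclideanSpace ℝ (Fin n) → ℝ)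
    (x : EuclideanSpace ℝ (Fin n)) (s : ℝ) : IsClosed (slopeSet Y h x s) := by
  have : slopeSet Y h x s = ⋂ y ∈ Y, ⋂ (_ : y ≠ x), {p | s + inner ℝ p (y - x) ≤ h y} := by
    ext p; simp [slopeSet]
  rw [this]
  refine isClosed_biInter fun y _ => isClosed_iInter fun _ => isClosed_le ?_ continuous_const
  fun_prop

theorem convex_slopeSet (Y : Set (EuclideanSpace ℝ (Fin n))) (h : EuclideanSpace ℝ (Fin n) → ℝ)
    (x : EuclideanSpace ℝ (Fin n)) (s : ℝ) : Convex ℝ (slopeSet Y h x s) := by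
  intro p hp r hr a b ha hb hab y hy hyx
  have h1 := mul_le_mul_of_nonneg_left (hp y hy hyx) ha
  have h2 := mul_le_mul_of_nonneg_left (hr y hy hyx) hb
  have e1 : s = a * s + b * s := by rw [← add_mul, hab, one_mul]
  have e2 : h y = a * h y + b * h y := by rw [← add_mul, hab, one_mul]
  rw [inner_add_left, inner_smul_left, inner_smul_left, e1, e2]
  simp only [conj_trivial]
  linarith

/-- A support slope with values at most `M` on the unit sphere is bounded inside the ball. -/
theorem value_add_norm_mul_le [NeZero n] {x p : EuclideanSpace ℝ (Fin n)} {s M : ℝ}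
    (hp : ∀ z ∈ sphere (0 : EuclideanSpace ℝ (Fin n)) 1, s + inner ℝ p (z - x) ≤ M) :
    s + ‖p‖ * (1 - ‖x‖) ≤ M := by
  have key : ∀ z ∈ sphere (0 : EuclideanSpace ℝ (Fin n)) 1, inner ℝ p z = ‖p‖ →
      s + ‖p‖ * (1 - ‖x‖) ≤ M := by
    intro z hz hpz
    have h1 := hp z hz
    have h2 := real_inner_le_norm p x
    rw [inner_sub_right, hpz] at h1
    linarith
  by_cases h0 : p = 0
  · have hne : (sphere (0 : EuclideanSpace ℝ (Fin n)) 1).Nonempty :=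
      NormedSpace.sphere_nonempty.2 zero_le_one
    obtain ⟨z, hz⟩ := hne
    exact key z hz (by simp [h0])
  · have hp0 : ‖p‖ ≠ 0 := norm_ne_zero_iff.2 h0
    refine key (‖p‖⁻¹ • p) ?_ ?_
    · simp [norm_smul, hp0]
    · rw [inner_smul_right, real_inner_self_eq_norm_sq]
      field_simp

theorem isBounded_slopeSet [NeZero n] {Y : Set (EuclideanSpace ℝ (Fin n))}
    {h : EuclideanSpace ℝ (Fin n) → ℝ} {x : EuclideanSpace ℝ (Fin n)} {s M : ℝ}
    (hY : sphere 0 1 ⊆ Y) (hx : ‖x‖ < 1)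
    (hM : ∀ z ∈ sphere (0 : EuclideanSpace ℝ (Fin n)) 1, h z ≤ M) :
    Bornology.IsBounded (slopeSet Y h x s) := by
  refine isBounded_iff_forall_norm_le.2 ⟨(M - s) / (1 - ‖x‖), fun p hp => ?_⟩
  rw [le_div_iff₀ (by linarith)]
  have := value_add_norm_mul_le (s := s) (M := M) (p := p) fun z hz =>
    (hp z (hY hz) (by rintro rfl; simp at hz; linarith)).trans (hM z hz)
  linarith

theorem volume_slopeSet_lt_top [NeZero n] {Y : Set (EuclideanSpace ℝ (Fin n))}
    {h : EuclideanSpace ℝ (Fin n) → ℝ} {x : EuclideanSpace ℝ (Fin n)} {s M : ℝ}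
    (hY : sphere 0 1 ⊆ Y) (hx : ‖x‖ < 1)
    (hM : ∀ z ∈ sphere (0 : EuclideanSpace ℝ (Fin n)) 1, h z ≤ M) :
    volume (slopeSet Y h x s) < ∞ :=
  (isBounded_slopeSet hY hx hM).measure_lt_top

theorem tendsto_volume_slopeSet_sub [NeZero n] {Y : Set (EuclideanSpace ℝ (Fin n))}
    {h : EuclideanSpace ℝ (Fin n) → ℝ} {x : EuclideanSpace ℝ (Fin n)} (s : ℝ) {M : ℝ}
    (hY : sphere 0 1 ⊆ Y) (hx : ‖x‖ < 1)
    (hM : ∀ z ∈ sphere (0 : EuclideanSpace ℝ (Fin n)) 1, h z ≤ M) :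
    Tendsto (fun k : ℕ => volume (slopeSet Y h x (s - 1 / ((k : ℝ) + 1)))) atTop
      (𝓝 (volume (slopeSet Y h x s))) := by
  have hlim : Tendsto (fun k : ℕ => s - 1 / ((k : ℝ) + 1)) atTop (𝓝 s) := by
    simpa using tendsto_const_nhds.sub (tendsto_one_div_add_atTop_nhds_zero_nat (𝕜 := ℝ))
  have hInter : slopeSet Y h x s = ⋂ k : ℕ, slopeSet Y h x (s - 1 / ((k : ℝ) + 1)) := by
    refine Subset.antisymm (subset_iInter fun k => slopeSet_anti Y h x ?_) fun p hp y hy hyx => ?_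
    · have : (0 : ℝ) ≤ 1 / ((k : ℝ) + 1) := by positivity
      linarith
    · exact le_of_tendsto' (hlim.add_const _) fun k => mem_iInter.1 hp k y hy hyx
  rw [hInter]
  refine tendsto_measure_iInter_atTop (fun k => (isClosed_slopeSet _ _ _ _).nullMeasurableSet)
    (fun k l hkl => slopeSet_anti Y h x ?_)
    ⟨0, (volume_slopeSet_lt_top hY hx hM).ne⟩
  have := Nat.one_div_le_one_div (α := ℝ) hkl
  linarith

/-- Tilting an interior slope by ε/2 in the direction of y - x keeps it admissible and gains (ε/2)‖y
- x‖ ≥ εr/2 at y. The gain is uniform in y, so the original slope tolerates a slightly larger value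
at x. -/
theorem interior_slopeSet_subset {Y : Set (EuclideanSpace ℝ (Fin n))}
    {h : EuclideanSpace ℝ (Fin n) → ℝ} {x : EuclideanSpace ℝ (Fin n)} {s : ℝ}
    {r : ℝ} (hr : 0 < r) (hYr : ∀ y ∈ Y, y ≠ x → r ≤ ‖y - x‖) :
    interior (slopeSet Y h x s) ⊆ ⋃ k : ℕ, slopeSet Y h x (s + 1 / ((k : ℝ) + 1)) := by
  intro p hp
  obtain ⟨ε, hε, hball⟩ := Metric.mem_nhds_iff.1 (mem_interior_iff_mem_nhds.1 hp)
  obtain ⟨k, hk⟩ := exists_nat_one_div_lt (show (0 : ℝ) < ε / 2 * r by positivity)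
  refine mem_iUnion.2 ⟨k, fun y hy hyx => ?_⟩
  have hn := hYr y hy hyx
  have hn0 : 0 < ‖y - x‖ := hr.trans_le hn
  have hmem : p + (ε / 2 * ‖y - x‖⁻¹) • (y - x) ∈ slopeSet Y h x s := by
    refine hball ?_
    rw [mem_ball, dist_eq_norm, add_sub_cancel_left, norm_smul, Real.norm_of_nonneg (by positivity),
      mul_assoc, inv_mul_cancel₀ hn0.ne']
    linarith
  have h1 := hmem y hy hyx
  rw [inner_add_left, inner_smul_left, real_inner_self_eq_norm_sq] at h1
  simp only [conj_trivial] at h1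
  have h2 : ε / 2 * ‖y - x‖⁻¹ * ‖y - x‖ ^ 2 = ε / 2 * ‖y - x‖ := by field_simp
  have h3 : ε / 2 * r ≤ ε / 2 * ‖y - x‖ := by gcongr
  linarith

/-- Right continuity of the volume in s: the frontier of a convex set is null, and the interior is
exhausted by the slope sets of larger values. This is what allows a node value to be raised. -/
theorem exists_volume_slopeSet_add_gt {Y : Set (EuclideanSpace ℝ (Fin n))}
    {h : EuclideanSpace ℝ (Fin n) → ℝ} {x : EuclideanSpace ℝ (Fin n)} {s : ℝ}
    {r : ℝ} (hr : 0 < r) (hYr : ∀ y ∈ Y, y ≠ x → r ≤ ‖y - x‖) {f : ℝ → ℝ≥0∞}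
    (hf : ContinuousWithinAt f (Ici s) s) (hlt : f s < volume (slopeSet Y h x s)) :
    ∃ t > s, f t < volume (slopeSet Y h x t) := by
  have hlim : Tendsto (fun k : ℕ => s + 1 / ((k : ℝ) + 1)) atTop (𝓝 s) := by
    simpa using tendsto_const_nhds.add (tendsto_one_div_add_atTop_nhds_zero_nat (𝕜 := ℝ))
  have hpos : ∀ k : ℕ, (0 : ℝ) < 1 / ((k : ℝ) + 1) := fun k => by positivity
  have hmono : Monotone fun k : ℕ => slopeSet Y h x (s + 1 / ((k : ℝ) + 1)) := by
    intro k l hkl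
    refine slopeSet_anti Y h x ?_
    have := Nat.one_div_le_one_div (α := ℝ) hkl
    linarith
  have h1 := tendsto_measure_iUnion_atTop (μ := volume) hmono
  have h2 : Tendsto (fun k : ℕ => f (s + 1 / ((k : ℝ) + 1))) atTop (𝓝 (f s)) := by
    refine hf.tendsto.comp (tendsto_nhdsWithin_iff.2 ⟨hlim, Eventually.of_forall fun k => ?_⟩)
    have := hpos k
    simp only [mem_Ici]
    linarith
  have h3 : volume (slopeSet Y h x s) ≤ volume (⋃ k : ℕ, slopeSet Y h x (s + 1 / ((k : ℝ) + 1))) := by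
    have hfr := (convex_slopeSet Y h x s).addHaar_frontier volume
    calc volume (slopeSet Y h x s)
        ≤ volume (interior (slopeSet Y h x s) ∪ frontier (slopeSet Y h x s)) := by
          refine measure_mono ?_
          rw [← closure_eq_interior_union_frontier]
          exact subset_closure
      _ ≤ volume (interior (slopeSet Y h x s)) + volume (frontier (slopeSet Y h x s)) :=
          measure_union_le _ _
      _ = volume (interior (slopeSet Y h x s)) := by rw [hfr, add_zero]
      _ ≤ _ := measure_mono (interior_slopeSet_subset hr hYr)
  obtain ⟨k, hk⟩ := (h2.eventually_lt h1 (hlt.trans_le h3)).exists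
  exact ⟨_, by have := hpos k; linarith, hk⟩

/-! ### Perron's method on a finite set of nodes -/

/-- The discrete subsolutions for the nodes `X`, the boundary values `φ` and the weight `w`. -/
def discreteSubsolutions (X : Set (EuclideanSpace ℝ (Fin n))) (φ : EuclideanSpace ℝ (Fin n) → ℝ)
    (w q : ℝ) : Set (EuclideanSpace ℝ (Fin n) → ℝ) :=
  {h | (∀ z ∈ sphere 0 1, h z = φ z) ∧ ∀ x ∈ X, 0 ≤ h x ∧
    (0 < h x → ENNReal.ofReal (w * h x ^ q) ≤ volume (subdifferential (X ∪ sphere 0 1) h x))}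

/-- The pointwise supremum H of the subsolutions is a subsolution, by continuity of slope volumes
under increasing values. If the slope volume at some node exceeded its target, the value there could
be raised, against maximality. The upper bound thus holds even at nodes where H vanishes. -/
theorem exists_greatest_discreteSubsolution [NeZero n] {X : Set (EuclideanSpace ℝ (Fin n))}
    (hXf : X.Finite) (hX : X ⊆ ball 0 1) {φ : EuclideanSpace ℝ (Fin n) → ℝ} {M w q : ℝ}
    (hM0 : 0 ≤ M) (hM : ∀ z ∈ sphere 0 1, φ z ≤ M) (hw : 0 < w) (hq : 0 ≤ q) :
    ∃ h ∈ discreteSubsolutions X φ w q,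
      (∀ g ∈ discreteSubsolutions X φ w q, ∀ x ∈ X, g x ≤ h x) ∧
      ∀ x ∈ X, h x ≤ M ∧
        volume (subdifferential (X ∪ sphere 0 1) h x) ≤ ENNReal.ofReal (w * h x ^ q) := by
  classical
  set S := discreteSubsolutions X φ w q with hS
  have hYs : sphere (0 : EuclideanSpace ℝ (Fin n)) 1 ⊆ X ∪ sphere 0 1 := subset_union_right
  have hXs : ∀ x ∈ X, x ∉ sphere (0 : EuclideanSpace ℝ (Fin n)) 1 := by
    intro x hx hxs
    have := hX hx
    simp at this hxs
    linarith
  have hXn : ∀ x ∈ X, ‖x‖ < 1 := fun x hx => by simpa using hX hx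
  have hbd : ∀ g ∈ S, ∀ x ∈ X, g x ≤ M := by
    intro g hg x hx
    by_cases h0 : 0 < g x
    · have h1 := (hg.2 x hx).2 h0
      have h2 : 0 < volume (subdifferential (X ∪ sphere 0 1) g x) :=
        lt_of_lt_of_le (ENNReal.ofReal_pos.2 (by positivity)) h1
      obtain ⟨p, hp⟩ := nonempty_of_measure_ne_zero h2.ne'
      have h3 := value_add_norm_mul_le (s := g x) (M := M) (p := p) fun z hz =>
        (hp z (hYs hz)).trans ((hg.1 z hz).trans_le (hM z hz))
      have : 0 ≤ ‖p‖ * (1 - ‖x‖) := mul_nonneg (norm_nonneg _) (by linarith [hXn x hx])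
      linarith
    · linarith
  set H : EuclideanSpace ℝ (Fin n) → ℝ := fun x => if x ∈ X then sSup ((fun g => g x) '' S) else φ x
    with hH
  have hHX : ∀ x ∈ X, H x = sSup ((fun g => g x) '' S) := fun x hx => by simp [hH, hx]
  have hHs : ∀ z ∈ sphere (0 : EuclideanSpace ℝ (Fin n)) 1, H z = φ z := fun z hz => by
    have : z ∉ X := fun hx => hXs z hx hz
    simp [hH, this]
  have h0S : (fun x => if x ∈ X then 0 else φ x) ∈ S := by
    refine ⟨fun z hz => ?_, fun x hx => ?_⟩
    · have : z ∉ X := fun hx => hXs z hx hz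
      simp [this]
    · simp [hx]
  have hbdd : ∀ x ∈ X, BddAbove ((fun g : EuclideanSpace ℝ (Fin n) → ℝ => g x) '' S) := by
    rintro x hx
    refine ⟨M, ?_⟩
    rintro _ ⟨g, hg, rfl⟩
    exact hbd g hg x hx
  have hgH : ∀ g ∈ S, ∀ x ∈ X, g x ≤ H x := fun g hg x hx => by
    rw [hHX x hx]; exact le_csSup (hbdd x hx) ⟨g, hg, rfl⟩
  have hH0 : ∀ x ∈ X, 0 ≤ H x := fun x hx => by
    have := hgH _ h0S x hx
    simpa [hx] using this
  have hHM : ∀ z ∈ sphere (0 : EuclideanSpace ℝ (Fin n)) 1, H z ≤ M := fun z hz =>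
    (hHs z hz).trans_le (hM z hz)
  have hHS : H ∈ S := by
    refine ⟨hHs, fun x hx => ⟨hH0 x hx, fun hpos => ?_⟩⟩
    rw [subdifferential_eq_slopeSet]
    have hlim : Tendsto (fun k : ℕ => H x - 1 / ((k : ℝ) + 1)) atTop (𝓝 (H x)) := by
      simpa using tendsto_const_nhds.sub (tendsto_one_div_add_atTop_nhds_zero_nat (𝕜 := ℝ))
    have h1 : Tendsto (fun k : ℕ => ENNReal.ofReal (w * (H x - 1 / ((k : ℝ) + 1)) ^ q)) atTop
        (𝓝 (ENNReal.ofReal (w * H x ^ q))) :=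
      (ENNReal.continuous_ofReal.tendsto _).comp
        ((hlim.rpow_const (Or.inl hpos.ne')).const_mul w)
    refine le_of_tendsto_of_tendsto h1 (tendsto_volume_slopeSet_sub (H x) hYs (hXn x hx) hHM) ?_
    filter_upwards [hlim.eventually (lt_mem_nhds hpos)] with k hk
    have hne : ((fun g : EuclideanSpace ℝ (Fin n) → ℝ => g x) '' S).Nonempty := ⟨_, _, h0S, rfl⟩
    have hlt : H x - 1 / ((k : ℝ) + 1) < sSup ((fun g => g x) '' S) := by
      rw [← hHX x hx]
      have : (0 : ℝ) < 1 / ((k : ℝ) + 1) := by positivity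
      linarith
    obtain ⟨_, ⟨g, hg, rfl⟩, hglt⟩ := exists_lt_of_lt_csSup hne hlt
    have hg2 := (hg.2 x hx).2 (hk.trans hglt)
    calc ENNReal.ofReal (w * (H x - 1 / ((k : ℝ) + 1)) ^ q)
        ≤ ENNReal.ofReal (w * g x ^ q) := by
          refine ENNReal.ofReal_le_ofReal ?_
          have := Real.rpow_le_rpow hk.le hglt.le hq
          gcongr
      _ ≤ volume (subdifferential (X ∪ sphere 0 1) g x) := hg2
      _ ≤ _ := by
          refine measure_mono fun p hp y hy hyx => ?_
          have h3 := hp y hy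
          have h4 : g y ≤ H y := by
            rcases hy with hy | hy
            · exact hgH g hg y hy
            · rw [hHs y hy, hg.1 y hy]
          simp only at hglt
          linarith
  refine ⟨H, hHS, hgH, fun x hx => ⟨hbd H hHS x hx, ?_⟩⟩
  by_contra! hcon
  rw [subdifferential_eq_slopeSet] at hcon
  obtain ⟨r, hr, hYr⟩ : ∃ r > 0, ∀ y ∈ X ∪ sphere (0 : EuclideanSpace ℝ (Fin n)) 1, y ≠ x →
      r ≤ ‖y - x‖ := by
    have hcl : IsClosed ((X \ {x}) ∪ sphere (0 : EuclideanSpace ℝ (Fin n)) 1) :=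
      (hXf.subset sdiff_subset).isClosed.union isClosed_sphere
    have hxn : x ∈ ((X \ {x}) ∪ sphere (0 : EuclideanSpace ℝ (Fin n)) 1)ᶜ := by
      rintro (h | h)
      · exact h.2 rfl
      · exact hXs x hx h
    obtain ⟨r, hr, hrb⟩ := Metric.isOpen_iff.1 hcl.isOpen_compl x hxn
    refine ⟨r, hr, fun y hy hyx => ?_⟩
    by_contra! hlt
    refine hrb (show y ∈ ball x r by rwa [mem_ball, dist_eq_norm]) ?_
    rcases hy with hy | hy
    · exact Or.inl ⟨hy, hyx⟩
    · exact Or.inr hy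
  have hcont : ContinuousWithinAt (fun s : ℝ => ENNReal.ofReal (w * s ^ q)) (Ici (H x)) (H x) := by
    refine (ENNReal.continuous_ofReal.continuousAt.comp ?_).continuousWithinAt
    exact continuousAt_const.mul (Real.continuousAt_rpow_const _ _ (Or.inr hq))
  obtain ⟨t, ht, hvol⟩ := exists_volume_slopeSet_add_gt hr hYr hcont hcon
  -- Raising the value at x leaves the constraint at x strict enough by the choice of t, and only
  -- enlarges the subdifferentials at the other nodes.
  have hup : Function.update H x t ∈ S := by
    refine ⟨fun z hz => ?_, fun y hy => ?_⟩
    · rw [Function.update_of_ne (by rintro rfl; exact hXs _ hx hz), hHs z hz]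
    · by_cases hyx : y = x
      · subst hyx
        refine ⟨by simp; linarith [hH0 y hx], fun _ => ?_⟩
        rw [subdifferential_eq_slopeSet, slopeSet_congr (g := H)
          (fun z _ hz => Function.update_of_ne hz _ _)]
        simpa using hvol.le
      · rw [Function.update_of_ne hyx]
        refine ⟨hH0 y hy, fun hpos => ((hHS.2 y hy).2 hpos).trans (measure_mono ?_)⟩
        intro p hp z hz
        rw [Function.update_of_ne hyx]
        refine (hp z hz).trans ?_
        by_cases hzx : z = x
        · subst hzx; simpa using ht.le
        · rw [Function.update_of_ne hzx]
  have := hgH _ hup x hx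
  simp at this
  linarith

/-! ### Geometry of the lattice -/

theorem norm_le_card_mul {x : EuclideanSpace ℝ (Fin n)} {c : ℝ} (hx : ∀ i, |x i| ≤ c) :
    ‖x‖ ≤ n * c := by
  by_cases hn : n = 0
  · subst hn; simp [Subsingleton.elim x 0]
  have hn1 : (1 : ℝ) ≤ n := by exact_mod_cast Nat.one_le_iff_ne_zero.2 hn
  have hc : 0 ≤ c := (abs_nonneg _).trans (hx ⟨0, Nat.pos_of_ne_zero hn⟩)
  refine abs_le_of_sq_le_sq' ?_ (by positivity) |>.2
  rw [EuclideanSpace.real_norm_sq_eq]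
  calc ∑ i, x i ^ 2 ≤ ∑ _i : Fin n, c ^ 2 :=
        Finset.sum_le_sum fun i _ => sq_le_sq' (abs_le.1 (hx i)).1 (abs_le.1 (hx i)).2
    _ = n * c ^ 2 := by simp
    _ ≤ (n * c) ^ 2 := by
      rw [mul_pow]
      have : (n : ℝ) ≤ n ^ 2 := by nlinarith
      gcongr

theorem volume_setOf_forall_mem (s : Fin n → Set ℝ) (hs : ∀ i, MeasurableSet (s i)) :
    volume {x : EuclideanSpace ℝ (Fin n) | ∀ i, x i ∈ s i} = ∏ i, volume (s i) := by
  have h := (PiLp.volume_preserving_ofLp (Fin n)).measure_preimage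
    (MeasurableSet.univ_pi hs).nullMeasurableSet
  rw [← volume_pi_pi, ← h]
  congr 1
  ext x
  simp

/-- The nodes: the points of the lattice of width `1 / N` which are at least `n / N` away from the
unit sphere. -/
def gridNodes (n N : ℕ) : Set (EuclideanSpace ℝ (Fin n)) :=
  {x | (∀ i, ∃ a : ℤ, x i = a / N) ∧ ‖x‖ ≤ 1 - n / N}

/-- The half-open cube of width `1 / N` with lower corner `x`. -/
def gridCell (N : ℕ) (x : EuclideanSpace ℝ (Fin n)) : Set (EuclideanSpace ℝ (Fin n)) :=
  {y | ∀ i, y i ∈ Ico (x i) (x i + 1 / N)}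

/-- The lower corner of the cube of width `1 / N` which contains `x`. -/
noncomputable def gridFloor (N : ℕ) (x : EuclideanSpace ℝ (Fin n)) : EuclideanSpace ℝ (Fin n) :=
  WithLp.toLp 2 fun i => (⌊(N : ℝ) * x i⌋ : ℝ) / N

theorem gridNodes_finite (N : ℕ) (hN : 0 < N) : (gridNodes n N).Finite := by
  have hN0 : (0 : ℝ) < N := by exact_mod_cast hN
  refine ((Set.finite_Icc (fun _ : Fin n => -(N : ℤ)) (fun _ => (N : ℤ))).image
    (fun a => (WithLp.toLp 2 fun i => (a i : ℝ) / N : EuclideanSpace ℝ (Fin n)))).subset ?_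
  rintro x ⟨hx, hxn⟩
  choose a ha using hx
  refine ⟨a, ?_, ?_⟩
  · have key : ∀ i, |(a i : ℝ)| ≤ N := by
      intro i
      have h1 := PiLp.norm_apply_le x i
      have h2 : (0 : ℝ) ≤ n / N := by positivity
      rw [ha i, Real.norm_eq_abs, abs_div, abs_of_pos hN0] at h1
      have h3 : |(a i : ℝ)| / N ≤ 1 := by linarith
      rwa [div_le_one hN0] at h3
    refine ⟨fun i => ?_, fun i => ?_⟩
    · have := (abs_le.1 (key i)).1
      exact_mod_cast this
    · have := (abs_le.1 (key i)).2
      exact_mod_cast this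
  · ext i
    simp [ha i]

theorem gridNodes_subset_ball [NeZero n] (N : ℕ) (hN : 0 < N) : gridNodes n N ⊆ ball 0 1 := by
  rintro x ⟨-, hx⟩
  have hN0 : (0 : ℝ) < N := by exact_mod_cast hN
  have hn : (0 : ℝ) < n := by exact_mod_cast Nat.pos_of_ne_zero (NeZero.ne n)
  have : (0 : ℝ) < n / N := by positivity
  rw [mem_ball_zero_iff]
  linarith

theorem measurableSet_gridCell (N : ℕ) (x : EuclideanSpace ℝ (Fin n)) :
    MeasurableSet (gridCell N x) := by
  have : gridCell N x = ⋂ i, (fun y : EuclideanSpace ℝ (Fin n) => y i) ⁻¹' Ico (x i) (x i + 1 / N) := by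
    ext y; simp [gridCell]
  rw [this]
  exact MeasurableSet.iInter fun i =>
    (by fun_prop : Measurable fun y : EuclideanSpace ℝ (Fin n) => y i) measurableSet_Ico

theorem volume_gridCell (N : ℕ) (x : EuclideanSpace ℝ (Fin n)) :
    volume (gridCell N x) = ENNReal.ofReal ((1 / N : ℝ) ^ n) := by
  rw [gridCell, volume_setOf_forall_mem _ fun i => measurableSet_Ico]
  simp only [Real.volume_Ico, add_sub_cancel_left, Finset.prod_const, Finset.card_univ,
    Fintype.card_fin]
  rw [← ENNReal.ofReal_pow (by positivity)]

theorem mem_gridCell_gridFloor {N : ℕ} (hN : 0 < N) (x : EuclideanSpace ℝ (Fin n)) :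
    x ∈ gridCell N (gridFloor N x) := by
  intro i
  have hN0 : (0 : ℝ) < N := by exact_mod_cast hN
  have h1 := Int.floor_le ((N : ℝ) * x i)
  have h2 := Int.lt_floor_add_one ((N : ℝ) * x i)
  simp only [gridFloor, mem_Ico]
  rw [← add_div, div_le_iff₀ hN0, lt_div_iff₀ hN0]
  constructor <;> linarith

theorem gridFloor_eq_of_mem_gridCell {N : ℕ} (hN : 0 < N) {x y : EuclideanSpace ℝ (Fin n)}
    (hx : ∀ i, ∃ a : ℤ, x i = a / N) (hy : y ∈ gridCell N x) : gridFloor N y = x := by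
  have hN0 : (0 : ℝ) < N := by exact_mod_cast hN
  ext i
  obtain ⟨a, ha⟩ := hx i
  have h := hy i
  rw [ha, mem_Ico, ← add_div, div_le_iff₀ hN0, lt_div_iff₀ hN0] at h
  have : ⌊(N : ℝ) * y i⌋ = a := Int.floor_eq_iff.2 ⟨by linarith [h.1], by linarith [h.2]⟩
  simp [gridFloor, this, ha]

theorem norm_sub_le_of_mem_gridCell {N : ℕ} {x y : EuclideanSpace ℝ (Fin n)}
    (hy : y ∈ gridCell N x) : ‖y - x‖ ≤ n / N := by
  have : ‖y - x‖ ≤ n * (1 / N) := by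
    refine norm_le_card_mul fun i => ?_
    have := hy i
    rw [PiLp.sub_apply, abs_of_nonneg (by linarith [this.1])]
    linarith [this.2]
  simpa [div_eq_mul_inv] using this

theorem gridFloor_mem_gridNodes {N : ℕ} (hN : 0 < N) {x : EuclideanSpace ℝ (Fin n)}
    (hx : ‖x‖ ≤ 1 - 2 * (n / N)) : gridFloor N x ∈ gridNodes n N := by
  refine ⟨fun i => ⟨_, rfl⟩, ?_⟩
  have h1 := norm_sub_le_of_mem_gridCell (mem_gridCell_gridFloor hN x)
  have h2 := norm_le_norm_add_norm_sub x (gridFloor N x)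
  linarith

/-! ### Paraboloids as discrete subsolutions -/

theorem affine_add_quadratic (b x y : EuclideanSpace ℝ (Fin n)) (c A : ℝ) :
    c + inner ℝ b y + A * (‖y‖ ^ 2 - 1) =
      (c + inner ℝ b x + A * (‖x‖ ^ 2 - 1)) + inner ℝ (b + (2 * A) • x) (y - x) + A * ‖y - x‖ ^ 2 := by
  rw [inner_add_left, inner_smul_left, inner_sub_right, inner_sub_right,
    real_inner_self_eq_norm_sq, norm_sub_sq_real, real_inner_comm y x]
  simp only [conj_trivial]
  ring

/-- Between two nodes a coordinate difference t is an integer multiple of 1/N, so |t| ≤ N t².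
Towards the sphere, ‖e‖ ≤ nA/N while ‖y - x‖ ≥ n/N, which is the reason for the gap left between
nodes and sphere. -/
theorem inner_le_of_gridNodes {N : ℕ} (hN : 0 < N) {A : ℝ} (hA : 0 ≤ A)
    {e x y : EuclideanSpace ℝ (Fin n)} (he : ∀ i, |e i| ≤ A / N) (hx : x ∈ gridNodes n N)
    (hy : y ∈ gridNodes n N ∪ sphere 0 1) : inner ℝ e (y - x) ≤ A * ‖y - x‖ ^ 2 := by
  have hN0 : (0 : ℝ) < N := by exact_mod_cast hN
  rcases hy with hy | hy
  · rw [EuclideanSpace.real_norm_sq_eq, Finset.mul_sum, PiLp.inner_apply]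
    refine Finset.sum_le_sum fun i _ => ?_
    obtain ⟨a, ha⟩ := hx.1 i
    obtain ⟨b, hb⟩ := hy.1 i
    have hz : |(y - x) i| ≤ N * ((y - x) i) ^ 2 := by
      have : (y - x) i = ((b - a : ℤ) : ℝ) / N := by
        rw [PiLp.sub_apply, ha, hb]; push_cast; ring
      rw [this, abs_div, abs_of_pos hN0, div_pow]
      have h2 : |((b - a : ℤ) : ℝ)| ≤ ((b - a : ℤ) : ℝ) ^ 2 := by
        rw [← sq_abs]
        by_cases h0 : b - a = 0
        · simp [h0]
        · have : (1 : ℝ) ≤ |((b - a : ℤ) : ℝ)| := by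
            exact_mod_cast Int.one_le_abs h0
          nlinarith
      have h3 : (N : ℝ) * (((b - a : ℤ) : ℝ) ^ 2 / N ^ 2) = ((b - a : ℤ) : ℝ) ^ 2 / N := by
        field_simp
      rw [h3]
      gcongr
    calc inner ℝ (e i) ((y - x) i) ≤ |e i| * |(y - x) i| := by
          simpa using real_inner_le_norm (e i) ((y - x) i)
      _ ≤ A / N * (N * ((y - x) i) ^ 2) := by
          gcongr
          exact he i
      _ = A * (y - x) i ^ 2 := by field_simp
  · have h1 := norm_le_card_mul he
    have h2 := real_inner_le_norm e (y - x)
    have h3 : (n : ℝ) / N ≤ ‖y - x‖ := by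
      have h4 := norm_le_norm_add_norm_sub' y x
      have h5 := hx.2
      rw [mem_sphere_zero_iff_norm] at hy
      linarith
    calc inner ℝ e (y - x) ≤ ‖e‖ * ‖y - x‖ := h2
      _ ≤ (n * (A / N)) * ‖y - x‖ := by gcongr
      _ = A * (n / N) * ‖y - x‖ := by ring
      _ ≤ A * ‖y - x‖ * ‖y - x‖ := by gcongr
      _ = _ := by ring

theorem affine_le_of_le_on_sphere [NeZero n] {p x : EuclideanSpace ℝ (Fin n)} {c M : ℝ}
    (h : ∀ z ∈ sphere (0 : EuclideanSpace ℝ (Fin n)) 1, c + inner ℝ p z ≤ M) (hx : ‖x‖ ≤ 1) :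
    c + inner ℝ p x ≤ M := by
  have := value_add_norm_mul_le (s := c + inner ℝ p x) (p := p) (x := x) (M := M) fun z hz => by
    have := h z hz
    rw [inner_sub_right]; linarith
  have h2 : 0 ≤ ‖p‖ * (1 - ‖x‖) := mul_nonneg (norm_nonneg _) (by linarith)
  linarith

-- At a node the paraboloid of strength A has, besides its gradient, a whole cube of side 2A/N of
-- discrete slopes. Its volume (2A/N)^n dominates the target (1/N)^n h^q because values are at most
-- M.
open Classical in
theorem max_barrier_mem_discreteSubsolutions [NeZero n] {φ : EuclideanSpace ℝ (Fin n) → ℝ}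
    {M q A c : ℝ} {N : ℕ} (hN : 0 < N)
    (hM : ∀ z ∈ sphere 0 1, φ z ≤ M) (hq : 0 ≤ q) (hA : 0 ≤ A) (hAM : M ^ q ≤ (2 * A) ^ n)
    {b : EuclideanSpace ℝ (Fin n)} (hb : ∀ z ∈ sphere 0 1, c + inner ℝ b z ≤ φ z) :
    (fun x => if x ∈ gridNodes n N then max (c + inner ℝ b x + A * (‖x‖ ^ 2 - 1)) 0 else φ x) ∈
      discreteSubsolutions (gridNodes n N) φ ((1 / N) ^ n) q := by
  have hXs : ∀ x ∈ sphere (0 : EuclideanSpace ℝ (Fin n)) 1, x ∉ gridNodes n N := by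
    intro x hxs hx
    have := gridNodes_subset_ball N hN hx
    simp at this hxs
    linarith
  refine ⟨fun z hz => by simp [hXs z hz], fun x hx => ⟨by simp [hx], fun hpos => ?_⟩⟩
  have hN0 : (0 : ℝ) < N := by exact_mod_cast hN
  simp only [hx, if_true] at hpos ⊢
  have hpos' : 0 < c + inner ℝ b x + A * (‖x‖ ^ 2 - 1) := by
    rcases lt_max_iff.1 hpos with h | h
    · exact h
    · exact absurd h (lt_irrefl _)
  rw [max_eq_left hpos'.le]
  have hxn : ‖x‖ ≤ 1 := by
    have := gridNodes_subset_ball N hN hx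
    rw [mem_ball_zero_iff] at this
    exact this.le
  have hsub : {p : EuclideanSpace ℝ (Fin n) |
      ∀ i, p i ∈ Icc ((b + (2 * A) • x) i - A / N) ((b + (2 * A) • x) i + A / N)} ⊆
      subdifferential (gridNodes n N ∪ sphere 0 1) (fun x => if x ∈ gridNodes n N then
        max (c + inner ℝ b x + A * (‖x‖ ^ 2 - 1)) 0 else φ x) x := by
    intro p hp y hy
    have he : ∀ i, |(p - (b + (2 * A) • x)) i| ≤ A / N := by
      intro i
      have := hp i
      rw [PiLp.sub_apply]
      exact abs_le.2 ⟨by linarith [this.1], by linarith [this.2]⟩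
    have h1 := inner_le_of_gridNodes hN hA he hx hy
    rw [inner_sub_left] at h1
    have h2 := affine_add_quadratic b x y c A
    have h3 : c + inner ℝ b y + A * (‖y‖ ^ 2 - 1) ≤
        (if y ∈ gridNodes n N then max (c + inner ℝ b y + A * (‖y‖ ^ 2 - 1)) 0 else φ y) := by
      rcases hy with hy | hy
      · simp [hy]
      · have := hb y hy
        rw [if_neg (hXs y hy), mem_sphere_zero_iff_norm.1 hy]
        simpa using this
    simp only [hx, if_true, max_eq_left hpos'.le]
    linarith
  refine le_trans ?_ (measure_mono hsub)
  rw [volume_setOf_forall_mem _ fun i => measurableSet_Icc]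
  simp only [Real.volume_Icc, add_sub_sub_cancel, Finset.prod_const, Finset.card_univ,
    Fintype.card_fin]
  rw [← ENNReal.ofReal_pow (by positivity)]
  refine ENNReal.ofReal_le_ofReal ?_
  have h1 : c + inner ℝ b x + A * (‖x‖ ^ 2 - 1) ≤ M := by
    have h2 := affine_le_of_le_on_sphere (fun z hz => (hb z hz).trans (hM z hz)) hxn
    have h3 : ‖x‖ ^ 2 ≤ 1 := pow_le_one₀ (norm_nonneg _) hxn
    nlinarith
  calc (1 / (N : ℝ)) ^ n * (c + inner ℝ b x + A * (‖x‖ ^ 2 - 1)) ^ q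
      ≤ (1 / (N : ℝ)) ^ n * (2 * A) ^ n := by
        gcongr
        exact (Real.rpow_le_rpow hpos'.le h1 hq).trans hAM
    _ = (A / N + A / N) ^ n := by rw [← mul_pow]; ring

/-! ### Convex envelopes and the discrete Dirichlet problem -/

/-- The supremum at `x` of the affine functions below `h` on `Y`. -/
noncomputable def affineEnvelope (Y : Set (EuclideanSpace ℝ (Fin n)))
    (h : EuclideanSpace ℝ (Fin n) → ℝ) (x : EuclideanSpace ℝ (Fin n)) : ℝ :=
  sSup {t | ∃ (p : EuclideanSpace ℝ (Fin n)) (c : ℝ),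
    (∀ y ∈ Y, c + inner ℝ p y ≤ h y) ∧ t = c + inner ℝ p x}

section Envelope

variable {Y : Set (EuclideanSpace ℝ (Fin n))} {h : EuclideanSpace ℝ (Fin n) → ℝ} {M : ℝ}
  {x : EuclideanSpace ℝ (Fin n)}

theorem affine_le_affineEnvelope [NeZero n] (hY : sphere 0 1 ⊆ Y) (hM : ∀ z ∈ sphere 0 1, h z ≤ M)
    (hx : ‖x‖ ≤ 1) {p : EuclideanSpace ℝ (Fin n)} {c : ℝ} (hp : ∀ y ∈ Y, c + inner ℝ p y ≤ h y) :
    c + inner ℝ p x ≤ affineEnvelope Y h x := by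
  refine le_csSup ⟨M, ?_⟩ ⟨p, c, hp, rfl⟩
  rintro _ ⟨p, c, hp, rfl⟩
  exact affine_le_of_le_on_sphere (fun z hz => (hp z (hY hz)).trans (hM z hz)) hx

theorem affineEnvelope_le (h0 : ∀ y ∈ Y, 0 ≤ h y) {t : ℝ}
    (ht : ∀ (p : EuclideanSpace ℝ (Fin n)) (c : ℝ), (∀ y ∈ Y, c + inner ℝ p y ≤ h y) →
      c + inner ℝ p x ≤ t) : affineEnvelope Y h x ≤ t := by
  refine csSup_le ⟨_, 0, 0, fun y hy => by simpa using h0 y hy, rfl⟩ ?_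
  rintro _ ⟨p, c, hp, rfl⟩
  exact ht p c hp

theorem affineEnvelope_nonneg [NeZero n] (hY : sphere 0 1 ⊆ Y) (h0 : ∀ y ∈ Y, 0 ≤ h y)
    (hM : ∀ z ∈ sphere 0 1, h z ≤ M) (hx : ‖x‖ ≤ 1) : 0 ≤ affineEnvelope Y h x := by
  simpa using affine_le_affineEnvelope hY hM hx (p := 0) (c := 0) fun y hy => by simpa using h0 y hy

theorem affineEnvelope_le_of_mem (h0 : ∀ y ∈ Y, 0 ≤ h y) (hx : x ∈ Y) : affineEnvelope Y h x ≤ h x :=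
  affineEnvelope_le h0 fun _ _ hp => hp x hx

theorem affineEnvelope_le_affine [NeZero n] (hY : sphere 0 1 ⊆ Y) (h0 : ∀ y ∈ Y, 0 ≤ h y) (hx : ‖x‖ ≤ 1)
    {b : EuclideanSpace ℝ (Fin n)} {d : ℝ} (hb : ∀ z ∈ sphere 0 1, h z ≤ d + inner ℝ b z) :
    affineEnvelope Y h x ≤ d + inner ℝ b x := by
  refine affineEnvelope_le h0 fun p c hp => ?_
  have := affine_le_of_le_on_sphere (p := p - b) (c := c - d) (M := 0) (x := x) (fun z hz => by
    have h1 := hp z (hY hz)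
    have h2 := hb z hz
    rw [inner_sub_left]; linarith) hx
  rw [inner_sub_left] at this
  linarith

theorem convexOn_affineEnvelope [NeZero n] (hY : sphere 0 1 ⊆ Y) (h0 : ∀ y ∈ Y, 0 ≤ h y)
    (hM : ∀ z ∈ sphere 0 1, h z ≤ M) : ConvexOn ℝ (closedBall 0 1) (affineEnvelope Y h) := by
  refine ⟨convex_closedBall _ _, fun x hx y hy a b ha hb hab => affineEnvelope_le h0 fun p c hp => ?_⟩
  have h1 := affine_le_affineEnvelope hY hM (mem_closedBall_zero_iff.1 hx) hp
  have h2 := affine_le_affineEnvelope hY hM (mem_closedBall_zero_iff.1 hy) hp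
  rw [inner_add_right, inner_smul_right, inner_smul_right, smul_eq_mul, smul_eq_mul]
  have h3 := mul_le_mul_of_nonneg_left h1 ha
  have h4 := mul_le_mul_of_nonneg_left h2 hb
  have e : c = a * c + b * c := by rw [← add_mul, hab, one_mul]
  rw [e]
  linarith

end Envelope

/-- Convex functions on the closed unit ball which lie between `0` and the barriers given by the
boundary values `φ` and the strength `A`. -/
structure IsBarrierBounded (φ : EuclideanSpace ℝ (Fin n) → ℝ) (A : ℝ)
    (V : EuclideanSpace ℝ (Fin n) → ℝ) : Prop where
  convexOn : ConvexOn ℝ (closedBall 0 1) V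
  nonneg : ∀ x ∈ closedBall 0 1, 0 ≤ V x
  lower : ∀ (b : EuclideanSpace ℝ (Fin n)) (c : ℝ), (∀ z ∈ sphere 0 1, c + inner ℝ b z ≤ φ z) →
    ∀ x ∈ closedBall 0 1, c + inner ℝ b x + A * (‖x‖ ^ 2 - 1) ≤ V x
  upper : ∀ (b : EuclideanSpace ℝ (Fin n)) (c : ℝ), (∀ z ∈ sphere 0 1, φ z ≤ c + inner ℝ b z) →
    ∀ x ∈ closedBall 0 1, V x ≤ c + inner ℝ b x

/-- The discrete Dirichlet problem, with the solution extended to the closed ball. -/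
theorem exists_grid_solution [NeZero n] {φ : EuclideanSpace ℝ (Fin n) → ℝ}
    {M q A : ℝ} {N : ℕ} (hN : 0 < N) (hφ0 : ∀ z ∈ sphere 0 1, 0 ≤ φ z)
    (hM : ∀ z ∈ sphere 0 1, φ z ≤ M) (hq : 0 ≤ q) (hA : 0 ≤ A) (hAM : M ^ q ≤ (2 * A) ^ n) :
    ∃ V : EuclideanSpace ℝ (Fin n) → ℝ, IsBarrierBounded φ A V ∧
      ∀ x ∈ gridNodes n N,
        (0 < V x → ENNReal.ofReal ((1 / N) ^ n * V x ^ q) ≤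
          volume (subdifferential (gridNodes n N ∪ sphere 0 1) V x)) ∧
        volume (subdifferential (gridNodes n N ∪ sphere 0 1) V x) ≤
          ENNReal.ofReal ((1 / N) ^ n * V x ^ q) := by
  have hN0 : (0 : ℝ) < N := by exact_mod_cast hN
  have hM0 : 0 ≤ M := by
    obtain ⟨z, hz⟩ : (sphere (0 : EuclideanSpace ℝ (Fin n)) 1).Nonempty :=
      NormedSpace.sphere_nonempty.2 zero_le_one
    exact (hφ0 z hz).trans (hM z hz)
  have hXb := gridNodes_subset_ball (n := n) N hN
  obtain ⟨h, hS, hmax, hle⟩ := exists_greatest_discreteSubsolution (gridNodes_finite (n := n) N hN)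
    hXb hM0 hM (w := (1 / N) ^ n) (q := q) (by positivity) hq
  set Y := gridNodes n N ∪ sphere (0 : EuclideanSpace ℝ (Fin n)) 1 with hY
  have hYs : sphere (0 : EuclideanSpace ℝ (Fin n)) 1 ⊆ Y := subset_union_right
  have h0 : ∀ y ∈ Y, 0 ≤ h y := by
    rintro y (hy | hy)
    · exact (hS.2 y hy).1
    · rw [hS.1 y hy]; exact hφ0 y hy
  have hhM : ∀ z ∈ sphere (0 : EuclideanSpace ℝ (Fin n)) 1, h z ≤ M := fun z hz =>
    (hS.1 z hz).trans_le (hM z hz)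
  have hlow : ∀ (b : EuclideanSpace ℝ (Fin n)) (c : ℝ),
      (∀ z ∈ sphere 0 1, c + inner ℝ b z ≤ φ z) →
      ∀ x ∈ closedBall 0 1, c + inner ℝ b x + A * (‖x‖ ^ 2 - 1) ≤ affineEnvelope Y h x := by
    intro b c hb x hx
    rw [mem_closedBall_zero_iff] at hx
    -- The tangent plane at x of the paraboloid lies below the paraboloid, hence below h on Y, so it
    -- competes in the envelope at x.
    have := affine_le_affineEnvelope hYs hhM hx (p := b + (2 * A) • x)
      (c := c + inner ℝ b x + A * (‖x‖ ^ 2 - 1) - inner ℝ (b + (2 * A) • x) x) fun y hy => by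
        have h1 := affine_add_quadratic b x y c A
        rw [inner_sub_right] at h1
        have h2 : 0 ≤ A * ‖y - x‖ ^ 2 := by positivity
        have h3 : c + inner ℝ b y + A * (‖y‖ ^ 2 - 1) ≤ h y := by
          rcases hy with hy | hy
          · have h4 := hmax _ (max_barrier_mem_discreteSubsolutions hN hM hq hA hAM hb) y hy
            simp only [hy, if_true] at h4
            exact (le_max_left _ _).trans h4
          · rw [mem_sphere_zero_iff_norm.1 hy, hS.1 y hy]
            simpa using hb y hy
        linarith
    linarith
  have hnode : ∀ x ∈ gridNodes n N, affineEnvelope Y h x = h x := by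
    intro x hx
    have hxn : ‖x‖ ≤ 1 := by
      have := hXb hx
      rw [mem_ball_zero_iff] at this
      exact this.le
    refine le_antisymm (affineEnvelope_le_of_mem h0 (Or.inl hx)) ?_
    -- At a node of value 0 the zero function supports h; at a positive node the subdifferential has
    -- positive volume and so contains a supporting slope.
    rcases (hS.2 x hx).1.eq_or_lt with hx0 | hx0
    · rw [← hx0]; exact affineEnvelope_nonneg hYs h0 hhM hxn
    · have h1 := (hS.2 x hx).2 hx0
      have h2 : 0 < volume (subdifferential Y h x) :=
        lt_of_lt_of_le (ENNReal.ofReal_pos.2 (by positivity)) h1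
      obtain ⟨p, hp⟩ := nonempty_of_measure_ne_zero h2.ne'
      have := affine_le_affineEnvelope hYs hhM hxn (p := p) (c := h x - inner ℝ p x) fun y hy => by
        have := hp y hy
        rw [inner_sub_right] at this
        linarith
      linarith
  have hsph : ∀ z ∈ sphere (0 : EuclideanSpace ℝ (Fin n)) 1, affineEnvelope Y h z ≤ h z := fun z hz =>
    affineEnvelope_le_of_mem h0 (hYs hz)
  have hsub : ∀ x ∈ gridNodes n N, subdifferential Y (affineEnvelope Y h) x = subdifferential Y h x := by
    intro x hx
    ext p
    constructor
    · intro hp y hy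
      have h1 := hp y hy
      rw [hnode x hx] at h1
      exact h1.trans (affineEnvelope_le_of_mem h0 hy)
    · intro hp y hy
      rw [hnode x hx]
      have hyn : ‖y‖ ≤ 1 := by
        rcases hy with hy | hy
        · have := hXb hy
          rw [mem_ball_zero_iff] at this
          exact this.le
        · exact (mem_sphere_zero_iff_norm.1 hy).le
      have := affine_le_affineEnvelope hYs hhM hyn (p := p) (c := h x - inner ℝ p x) fun y hy => by
        have := hp y hy
        rw [inner_sub_right] at this
        linarith
      rw [inner_sub_right]
      linarith
  refine ⟨affineEnvelope Y h, ⟨convexOn_affineEnvelope hYs h0 hhM, fun x hx =>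
    affineEnvelope_nonneg hYs h0 hhM (mem_closedBall_zero_iff.1 hx), hlow, fun b c hb x hx =>
    affineEnvelope_le_affine hYs h0 (mem_closedBall_zero_iff.1 hx) fun z hz =>
      (hS.1 z hz).trans_le (hb z hz)⟩, fun x hx => ?_⟩
  rw [hsub x hx, hnode x hx]
  exact ⟨(hS.2 x hx).2, (hle x hx).2⟩

/-! ### Boundary barriers, equicontinuity and compactness -/

/-- On the unit sphere 1 - ⟨z₀, z⟩ = ‖z - z₀‖²/2, so an affine function vanishing at z₀ controls the
oscillation of φ away from z₀. This turns mere continuity of φ into affine upper and lower barriers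
at each boundary point. -/
theorem exists_boundary_modulus {φ : EuclideanSpace ℝ (Fin n) → ℝ} (hφ : ContinuousOn φ (sphere 0 1))
    {ε : ℝ} (hε : 0 < ε) : ∃ Λ : ℝ, 0 ≤ Λ ∧ ∀ z₀ ∈ sphere 0 1, ∀ z ∈ sphere 0 1,
      |φ z - φ z₀| ≤ ε + Λ * (1 - inner ℝ z₀ z) := by
  have hK : IsCompact (sphere (0 : EuclideanSpace ℝ (Fin n)) 1) := isCompact_sphere _ _
  obtain ⟨δ, hδ, hδφ⟩ := Metric.uniformContinuousOn_iff.1 (hK.uniformContinuousOn_of_continuous hφ) ε hε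
  obtain ⟨M, hM⟩ := hK.exists_bound_of_continuousOn hφ
  refine ⟨4 * |M| / δ ^ 2, by positivity, fun z₀ hz₀ z hz => ?_⟩
  have hd : 1 - inner ℝ z₀ z = dist z z₀ ^ 2 / 2 := by
    rw [dist_eq_norm, norm_sub_sq_real, mem_sphere_zero_iff_norm.1 hz₀, mem_sphere_zero_iff_norm.1 hz,
      real_inner_comm]
    ring
  rw [hd]
  by_cases hlt : dist z z₀ < δ
  · have h1 := hδφ z hz z₀ hz₀ hlt
    rw [Real.dist_eq] at h1
    have : 0 ≤ 4 * |M| / δ ^ 2 * (dist z z₀ ^ 2 / 2) := by positivity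
    linarith
  · push Not at hlt
    have h1 := hM z hz
    have h2 := hM z₀ hz₀
    rw [Real.norm_eq_abs] at h1 h2
    have h3 := abs_sub (φ z) (φ z₀)
    have h4 := le_abs_self M
    have h5 : 2 * |M| ≤ 4 * |M| / δ ^ 2 * (dist z z₀ ^ 2 / 2) := by
      have : 4 * |M| / δ ^ 2 * (δ ^ 2 / 2) = 2 * |M| := by field_simp; ring
      rw [← this]
      gcongr
    linarith

namespace IsBarrierBounded

variable {φ V : EuclideanSpace ℝ (Fin n) → ℝ} {A : ℝ}

theorem le_of_le (hV : IsBarrierBounded φ A V) {M : ℝ} (hM : ∀ z ∈ sphere 0 1, φ z ≤ M)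
    {x : EuclideanSpace ℝ (Fin n)} (hx : x ∈ closedBall 0 1) : V x ≤ M := by
  simpa using hV.upper 0 M (fun z hz => by simpa using hM z hz) x hx

theorem abs_sub_le (hV : IsBarrierBounded φ A V) {ε Λ : ℝ} {z₀ x : EuclideanSpace ℝ (Fin n)}
    (hA : 0 ≤ A) (h : ∀ z ∈ sphere 0 1, |φ z - φ z₀| ≤ ε + Λ * (1 - inner ℝ z₀ z))
    (hx : x ∈ closedBall 0 1) :
    |V x - φ z₀| ≤ ε + Λ * (1 - inner ℝ z₀ x) + A * (1 - ‖x‖ ^ 2) := by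
  have h1 := hV.upper (-Λ • z₀) (φ z₀ + ε + Λ) (fun z hz => by
    have := (abs_le.1 (h z hz)).2
    rw [inner_smul_left]
    simp only [map_neg, conj_trivial]
    linarith) x hx
  have h2 := hV.lower (Λ • z₀) (φ z₀ - ε - Λ) (fun z hz => by
    have := (abs_le.1 (h z hz)).1
    rw [inner_smul_left]
    simp only [conj_trivial]
    linarith) x hx
  rw [inner_smul_left] at h1 h2
  simp only [map_neg, conj_trivial] at h1 h2
  have hx1 : ‖x‖ ^ 2 ≤ 1 := pow_le_one₀ (norm_nonneg _) (mem_closedBall_zero_iff.1 hx)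
  have h3 : 0 ≤ A * (1 - ‖x‖ ^ 2) := mul_nonneg hA (by linarith)
  exact abs_le.2 ⟨by linarith, by linarith⟩

theorem eq_on_sphere (hV : IsBarrierBounded φ A V) (hA : 0 ≤ A) (hφ : ContinuousOn φ (sphere 0 1))
    {z : EuclideanSpace ℝ (Fin n)} (hz : z ∈ sphere 0 1) : V z = φ z := by
  rw [← sub_eq_zero, ← abs_nonpos_iff]
  refine le_of_forall_pos_le_add fun ε hε => ?_
  obtain ⟨Λ, -, hΛ⟩ := exists_boundary_modulus hφ hε
  have := hV.abs_sub_le hA (hΛ z hz) (sphere_subset_closedBall hz)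
  rw [real_inner_self_eq_norm_sq, mem_sphere_zero_iff_norm.1 hz] at this
  simpa using this

end IsBarrierBounded

/-- Barrier-bounded functions are equicontinuous on the closed ball. -/
theorem exists_equicontinuity_modulus {φ : EuclideanSpace ℝ (Fin n) → ℝ}
    (hφ : ContinuousOn φ (sphere 0 1)) {A M : ℝ} (hA : 0 ≤ A) (hM : ∀ z ∈ sphere 0 1, φ z ≤ M)
    {x₀ : EuclideanSpace ℝ (Fin n)} (hx₀ : x₀ ∈ closedBall 0 1) {ε : ℝ} (hε : 0 < ε) :
    ∃ δ > 0, ∀ V, IsBarrierBounded φ A V → ∀ x ∈ closedBall 0 1, dist x x₀ < δ → |V x - V x₀| < ε := by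
  by_cases hs : x₀ ∈ sphere (0 : EuclideanSpace ℝ (Fin n)) 1
  · obtain ⟨Λ, hΛ0, hΛ⟩ := exists_boundary_modulus hφ (half_pos hε)
    have hcont : Continuous fun x : EuclideanSpace ℝ (Fin n) =>
        ε / 2 + Λ * (1 - inner ℝ x₀ x) + A * (1 - ‖x‖ ^ 2) := by fun_prop
    have hval : ε / 2 + Λ * (1 - inner ℝ x₀ x₀) + A * (1 - ‖x₀‖ ^ 2) < ε := by
      rw [real_inner_self_eq_norm_sq, mem_sphere_zero_iff_norm.1 hs]
      simp; linarith
    obtain ⟨δ, hδ, hball⟩ := Metric.mem_nhds_iff.1 (hcont.continuousAt.eventually (gt_mem_nhds hval))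
    refine ⟨δ, hδ, fun V hV x hx hd => ?_⟩
    rw [hV.eq_on_sphere hA hφ hs]
    exact (hV.abs_sub_le hA (hΛ x₀ hs) hx).trans_lt (hball hd)
  · have hlt : ‖x₀‖ < 1 := by
      rw [mem_closedBall_zero_iff] at hx₀
      rw [mem_sphere_zero_iff_norm] at hs
      exact lt_of_le_of_ne hx₀ hs
    set r := 1 - ‖x₀‖ with hr
    have hr0 : 0 < r := by linarith
    have hsub : ball x₀ r ⊆ closedBall 0 1 := by
      intro y hy
      rw [mem_ball, dist_eq_norm] at hy
      rw [mem_closedBall_zero_iff]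
      have := norm_le_norm_add_norm_sub' y x₀
      linarith
    set C : ℝ := 2 * |M| / (r / 2) with hC
    have hC0 : 0 ≤ C := by positivity
    -- Inside the ball a convex function with values in [0, |M|] is C-Lipschitz on the half-size
    -- ball; C + 1 only avoids a zero denominator.
    refine ⟨min (r / 2) (ε / (C + 1)), by positivity, fun V hV x hx hd => ?_⟩
    have hlip := (hV.convexOn.subset hsub (convex_ball _ _)).lipschitzOnWith_of_abs_le
      (half_pos hr0) (M := |M|) fun a ha => by
        have ha' := hsub (mem_ball.2 ha)
        rw [abs_of_nonneg (hV.nonneg a ha')]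
        exact (hV.le_of_le hM ha').trans (le_abs_self M)
    have hd1 : dist x x₀ < r / 2 := hd.trans_le (min_le_left _ _)
    have hd2 : dist x x₀ < ε / (C + 1) := hd.trans_le (min_le_right _ _)
    have h1 := hlip.dist_le_mul x (by rw [mem_ball]; linarith) x₀ (by rw [mem_ball, dist_self]; linarith)
    rw [Real.dist_eq, Real.coe_toNNReal _ hC0] at h1
    rw [lt_div_iff₀ (by positivity)] at hd2
    have : 0 ≤ dist x x₀ := dist_nonneg
    nlinarith

/-- A sequence of barrier-bounded functions has a uniformly convergent subsequence. -/
theorem exists_subseq_tendstoUniformlyOn {φ : EuclideanSpace ℝ (Fin n) → ℝ}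
    (hφ : ContinuousOn φ (sphere 0 1)) {A M : ℝ} (hA : 0 ≤ A) (hM : ∀ z ∈ sphere 0 1, φ z ≤ M)
    (V : ℕ → EuclideanSpace ℝ (Fin n) → ℝ) (hV : ∀ k, IsBarrierBounded φ A (V k)) :
    ∃ (v : EuclideanSpace ℝ (Fin n) → ℝ) (σ : ℕ → ℕ), StrictMono σ ∧
      ContinuousOn v (closedBall 0 1) ∧ IsBarrierBounded φ A v ∧
      TendstoUniformlyOn (fun k => V (σ k)) v atTop (closedBall 0 1) := by
  classical
  have : CompactSpace (closedBall (0 : EuclideanSpace ℝ (Fin n)) 1) :=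
    isCompact_iff_compactSpace.1 (isCompact_closedBall _ _)
  have hmod := fun (x₀ : EuclideanSpace ℝ (Fin n)) (hx₀ : x₀ ∈ closedBall 0 1) (ε : ℝ) (hε : 0 < ε) =>
    exists_equicontinuity_modulus hφ hA hM hx₀ hε
  have hc : ∀ k, Continuous fun x : closedBall (0 : EuclideanSpace ℝ (Fin n)) 1 => V k x := by
    intro k
    refine Metric.continuous_iff.2 fun x₀ ε hε => ?_
    obtain ⟨δ, hδ, hh⟩ := hmod x₀ x₀.2 ε hε
    exact ⟨δ, hδ, fun x hx => hh (V k) (hV k) x x.2 hx⟩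
  set F : ℕ → BoundedContinuousFunction (closedBall (0 : EuclideanSpace ℝ (Fin n)) 1) ℝ := fun k =>
    BoundedContinuousFunction.mkOfCompact ⟨_, hc k⟩ with hF
  have hcomp : IsCompact (closure (range F)) := by
    refine BoundedContinuousFunction.arzela_ascoli (Icc 0 M) isCompact_Icc (range F) ?_ ?_
    · rintro _ x ⟨k, rfl⟩
      exact ⟨(hV k).nonneg x x.2, (hV k).le_of_le hM x.2⟩
    · refine fun x₀ => Metric.equicontinuousAt_iff.2 fun ε hε => ?_
      obtain ⟨δ, hδ, hh⟩ := hmod x₀ x₀.2 ε hε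
      refine ⟨δ, hδ, fun x hx => ?_⟩
      rintro ⟨_, k, rfl⟩
      rw [dist_comm]
      exact hh (V k) (hV k) x x.2 hx
  obtain ⟨f, -, σ, hσ, hlim⟩ := hcomp.tendsto_subseq fun k => subset_closure (mem_range_self (f := F) k)
  have hunif : TendstoUniformly (fun k x => F (σ k) x) f atTop :=
    BoundedContinuousFunction.tendsto_iff_tendstoUniformly.1 hlim
  set v : EuclideanSpace ℝ (Fin n) → ℝ := fun x => if hx : x ∈ closedBall 0 1 then f ⟨x, hx⟩ else 0
    with hv
  have hvf : ∀ x (hx : x ∈ closedBall 0 1), v x = f ⟨x, hx⟩ := fun x hx => by simp only [hv, hx, dif_pos]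
  have hU : TendstoUniformlyOn (fun k => V (σ k)) v atTop (closedBall 0 1) := by
    rw [Metric.tendstoUniformlyOn_iff]
    intro ε hε
    filter_upwards [Metric.tendstoUniformly_iff.1 hunif ε hε] with k hk x hx
    rw [hvf x hx]
    exact hk ⟨x, hx⟩
  have hpt : ∀ x ∈ closedBall (0 : EuclideanSpace ℝ (Fin n)) 1,
      Tendsto (fun k => V (σ k) x) atTop (𝓝 (v x)) := fun x hx => hU.tendsto_at hx
  refine ⟨v, σ, hσ, ?_, ⟨⟨convex_closedBall _ _, fun x hx y hy a b ha hb hab => ?_⟩, fun x hx =>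
    ge_of_tendsto' (hpt x hx) fun k => (hV _).nonneg x hx, fun b c hb x hx =>
    ge_of_tendsto' (hpt x hx) fun k => (hV _).lower b c hb x hx, fun b c hb x hx =>
    le_of_tendsto' (hpt x hx) fun k => (hV _).upper b c hb x hx⟩, hU⟩
  · rw [continuousOn_iff_continuous_domRestrict]
    convert f.continuous using 1
    ext x
    exact hvf x x.2
  · exact le_of_tendsto_of_tendsto' (hpt _ (convex_closedBall _ _ hx hy ha hb hab))
      (((hpt x hx).const_smul a).add ((hpt y hy).const_smul b)) fun k =>
        (hV _).convexOn.2 hx hy ha hb hab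

/-! ### Passage to the limit in the Monge-Ampère measure -/

/-- Fatou's lemma for sets; continuity along increasing unions needs no measurability. -/
theorem measure_setOf_eventually_mem_le {α : Type*} [MeasurableSpace α] (μ : Measure α)
    (Q : ℕ → Set α) : μ {p | ∀ᶠ k in atTop, p ∈ Q k} ≤ liminf (fun k => μ (Q k)) atTop := by
  have h1 : {p | ∀ᶠ k in atTop, p ∈ Q k} = ⋃ m : ℕ, ⋂ k ≥ m, Q k := by
    ext p; simp [eventually_atTop]
  have h2 : Monotone fun m : ℕ => ⋂ k ≥ m, Q k := fun i j hij =>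
    subset_iInter₂ fun k hk => iInter₂_subset k (hij.trans hk)
  rw [h1, h2.measure_iUnion, liminf_eq_iSup_iInf_of_nat]
  exact iSup_mono fun m => le_iInf₂ fun k hk => measure_mono (iInter₂_subset k hk)

/-- Reverse Fatou for sets; the common superset of finite measure is what makes continuity along
decreasing intersections available. -/
theorem limsup_measure_le_measure_setOf_frequently_mem {α : Type*} [MeasurableSpace α]
    (μ : Measure α) (Q : ℕ → Set α) (hQ : ∀ k, MeasurableSet (Q k)) {B : Set α} (hB : μ B ≠ ∞)
    (hQB : ∀ k, Q k ⊆ B) :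
    limsup (fun k => μ (Q k)) atTop ≤ μ {p | ∃ᶠ k in atTop, p ∈ Q k} := by
  have h1 : {p | ∃ᶠ k in atTop, p ∈ Q k} = ⋂ m : ℕ, ⋃ k ≥ m, Q k := by
    ext p; simp [frequently_atTop]
  have h2 : Antitone fun m : ℕ => ⋃ k ≥ m, Q k := fun i j hij =>
    iUnion₂_subset fun k hk => subset_iUnion₂_of_subset k (le_trans hij hk) subset_rfl
  rw [h1, h2.measure_iInter (fun m => (MeasurableSet.biUnion (to_countable _) fun k _ =>
    hQ k).nullMeasurableSet) ⟨0, ne_top_of_le_ne_top hB (measure_mono (iUnion₂_subset fun k _ =>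
    hQB k))⟩, limsup_eq_iInf_iSup_of_nat]
  exact iInf_mono fun m => iSup₂_le fun k hk => measure_mono (subset_iUnion₂_of_subset k hk subset_rfl)

theorem sum_indicator_gridCell {N : ℕ} (hN : 0 < N) (T : Finset (EuclideanSpace ℝ (Fin n)))
    (hT : ∀ x ∈ T, ∀ i, ∃ a : ℤ, x i = a / N) (c : EuclideanSpace ℝ (Fin n) → ℝ≥0∞)
    (y : EuclideanSpace ℝ (Fin n)) [Decidable (gridFloor N y ∈ T)] :
    ∑ x ∈ T, (gridCell N x).indicator (fun _ => c x) y =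
      if gridFloor N y ∈ T then c (gridFloor N y) else 0 := by
  have hzero : ∀ x ∈ T, x ≠ gridFloor N y → (gridCell N x).indicator (fun _ => c x) y = 0 := by
    intro x hx hne
    refine indicator_of_notMem (fun hy => hne ?_) _
    exact (gridFloor_eq_of_mem_gridCell hN (hT x hx) hy).symm
  split_ifs with h
  · rw [Finset.sum_eq_single_of_mem _ h hzero,
      indicator_of_mem (mem_gridCell_gridFloor hN y)]
  · exact Finset.sum_eq_zero fun x hx => hzero x hx (by rintro rfl; exact h hx)

theorem measurable_sum_indicator_gridCell (N : ℕ) (T : Finset (EuclideanSpace ℝ (Fin n)))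
    (c : EuclideanSpace ℝ (Fin n) → ℝ≥0∞) :
    Measurable fun y => ∑ x ∈ T, (gridCell N x).indicator (fun _ => c x) y :=
  Finset.measurable_fun_sum _ fun x _ => measurable_const.indicator (measurableSet_gridCell N x)

/-- The convex conjugate of a function on the closed unit ball. -/
noncomputable def ballConjugate (v : EuclideanSpace ℝ (Fin n) → ℝ) (p : EuclideanSpace ℝ (Fin n)) :
    ℝ :=
  sSup ((fun x => inner ℝ p x - v x) '' closedBall 0 1)

theorem le_ballConjugate {v : EuclideanSpace ℝ (Fin n) → ℝ} (hv : ContinuousOn v (closedBall 0 1))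
    (p : EuclideanSpace ℝ (Fin n)) {x : EuclideanSpace ℝ (Fin n)} (hx : x ∈ closedBall 0 1) :
    inner ℝ p x - v x ≤ ballConjugate v p := by
  refine le_csSup ((isCompact_closedBall _ _).bddAbove_image ?_) ⟨x, hx, rfl⟩
  exact ContinuousOn.sub (by fun_prop) hv

theorem lipschitzWith_ballConjugate {v : EuclideanSpace ℝ (Fin n) → ℝ}
    (hv : ContinuousOn v (closedBall 0 1)) : LipschitzWith 1 (ballConjugate v) := by
  refine LipschitzWith.of_le_add fun p r => ?_
  refine csSup_le ⟨_, 0, by simp, rfl⟩ ?_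
  rintro _ ⟨x, hx, rfl⟩
  have h1 := le_ballConjugate hv r hx
  have h2 := real_inner_le_norm (p - r) x
  have h3 : ‖p - r‖ * ‖x‖ ≤ ‖p - r‖ * 1 := by
    gcongr
    exact mem_closedBall_zero_iff.1 hx
  rw [inner_sub_left] at h2
  rw [dist_eq_norm]
  simp only
  linarith

/-- Almost every slope supports a continuous function on the closed ball at one point at most. -/
theorem ae_unique_contact {v : EuclideanSpace ℝ (Fin n) → ℝ} (hv : ContinuousOn v (closedBall 0 1)) :
    ∀ᵐ p : EuclideanSpace ℝ (Fin n), ∀ x ∈ closedBall 0 1, ∀ y ∈ closedBall 0 1,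
      p ∈ subdifferential (closedBall 0 1) v x → p ∈ subdifferential (closedBall 0 1) v y → x = y := by
  -- By Rademacher the conjugate is differentiable at almost every p, and a contact point of the
  -- slope p must then equal its gradient.
  filter_upwards [(lipschitzWith_ballConjugate hv).ae_differentiableAt] with p hp
  have key : ∀ x ∈ closedBall 0 1, p ∈ subdifferential (closedBall 0 1) v x →
      fderiv ℝ (ballConjugate v) p = innerSL ℝ x := by
    intro x hx hpx
    have hval : ballConjugate v p = inner ℝ p x - v x := by
      refine le_antisymm (csSup_le ⟨_, 0, by simp, rfl⟩ ?_) (le_ballConjugate hv p hx)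
      rintro _ ⟨z, hz, rfl⟩
      have := hpx z hz
      rw [inner_sub_right] at this
      simp only
      linarith
    have hmin : IsLocalMin (fun r => ballConjugate v r - innerSL ℝ x r) p := by
      refine Eventually.of_forall fun r => ?_
      have := le_ballConjugate hv r hx
      simp only [innerSL_apply_apply]
      rw [real_inner_comm, real_inner_comm r x, hval]
      linarith
    have h0 := hmin.fderiv_eq_zero
    rw [fderiv_fun_sub hp (innerSL ℝ x).differentiableAt, ContinuousLinearMap.fderiv] at h0
    exact sub_eq_zero.1 h0
  intro x hx y hy hpx hpy
  have h := (key x hx hpx).symm.trans (key y hy hpy)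
  refine ext_inner_right ℝ fun z => ?_
  simpa using congrArg (fun f => f z) h

theorem subdifferential_ball_subset_closedBall {v : EuclideanSpace ℝ (Fin n) → ℝ}
    (hv : ContinuousOn v (closedBall 0 1)) (x : EuclideanSpace ℝ (Fin n)) :
    subdifferential (ball 0 1) v x ⊆ subdifferential (closedBall 0 1) v x := by
  intro p hp z hz
  have hcl : closure (ball (0 : EuclideanSpace ℝ (Fin n)) 1) = closedBall 0 1 :=
    closure_ball _ one_ne_zero
  have h1 : ContinuousOn (fun z => v x + inner ℝ p (z - x)) (closure (ball 0 1)) := by fun_prop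
  rw [← hcl] at hz hv
  exact ContinuousWithinAt.closure_le hz ((h1 z hz).mono subset_closure)
    ((hv z hz).mono subset_closure) fun y hy => hp y hy

/-- A slope common to x and y satisfies ⟨p, y - x⟩ = h y - h x, hence lies in a hyperplane. -/
theorem aedisjoint_subdifferential {Y : Set (EuclideanSpace ℝ (Fin n))}
    (h : EuclideanSpace ℝ (Fin n) → ℝ) {x y : EuclideanSpace ℝ (Fin n)} (hx : x ∈ Y) (hy : y ∈ Y)
    (hxy : x ≠ y) : AEDisjoint volume (subdifferential Y h x) (subdifferential Y h y) := by
  have hne : y - x ≠ 0 := sub_ne_zero.2 hxy.symm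
  obtain ⟨p₀, hp₀⟩ : ∃ p₀ : EuclideanSpace ℝ (Fin n), inner ℝ p₀ (y - x) = h y - h x := by
    refine ⟨((h y - h x) / ‖y - x‖ ^ 2) • (y - x), ?_⟩
    rw [inner_smul_left, real_inner_self_eq_norm_sq]
    have : ‖y - x‖ ≠ 0 := norm_ne_zero_iff.2 hne
    simp only [conj_trivial]
    field_simp
  have hsub : subdifferential Y h x ∩ subdifferential Y h y ⊆
      (AffineSubspace.mk' p₀ (innerSL ℝ (y - x)).toLinearMap.ker : Set (EuclideanSpace ℝ (Fin n))) := by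
    rintro p ⟨hpx, hpy⟩
    have h1 := hpx y hy
    have h2 := hpy x hx
    rw [inner_sub_right] at h1 h2
    rw [SetLike.mem_coe, AffineSubspace.mem_mk', LinearMap.mem_ker]
    simp only [vsub_eq_sub, ContinuousLinearMap.coe_coe, innerSL_apply_apply]
    rw [real_inner_comm, inner_sub_left, hp₀, inner_sub_right]
    linarith
  refine measure_mono_null hsub (Measure.addHaar_affineSubspace _ _ fun htop => hne ?_)
  have h1 : (AffineSubspace.mk' p₀ (innerSL ℝ (y - x)).toLinearMap.ker).direction = ⊤ := by
    rw [htop, AffineSubspace.direction_top]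
  rw [AffineSubspace.direction_mk'] at h1
  have h2 : y - x ∈ (innerSL ℝ (y - x)).toLinearMap.ker := by rw [h1]; trivial
  exact inner_self_eq_zero (𝕜 := ℝ).1 h2

theorem isClosed_subdifferential (Y : Set (EuclideanSpace ℝ (Fin n)))
    (h : EuclideanSpace ℝ (Fin n) → ℝ) (x : EuclideanSpace ℝ (Fin n)) :
    IsClosed (subdifferential Y h x) := by
  rw [subdifferential_eq_slopeSet]
  exact isClosed_slopeSet _ _ _ _

theorem tendsto_apply_of_tendstoUniformlyOn {ι : Type*} {l : Filter ι} {S : Set (EuclideanSpace ℝ (Fin n))}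
    {V : ι → EuclideanSpace ℝ (Fin n) → ℝ} {v : EuclideanSpace ℝ (Fin n) → ℝ}
    (hV : TendstoUniformlyOn V v l S) (hv : ContinuousOn v S) {x : EuclideanSpace ℝ (Fin n)}
    (hx : x ∈ S) {y : ι → EuclideanSpace ℝ (Fin n)} (hyS : ∀ᶠ k in l, y k ∈ S)
    (hy : Tendsto y l (𝓝 x)) : Tendsto (fun k => V k (y k)) l (𝓝 (v x)) := by
  have h1 : Tendsto (fun k => v (y k)) l (𝓝 (v x)) :=
    (hv x hx).tendsto.comp (tendsto_nhdsWithin_iff.2 ⟨hy, hyS⟩)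
  rw [Metric.tendsto_nhds]
  intro ε hε
  filter_upwards [Metric.tendstoUniformlyOn_iff.1 hV (ε / 2) (half_pos hε),
    Metric.tendsto_nhds.1 h1 (ε / 2) (half_pos hε), hyS] with k h2 h3 h4
  have h5 := h2 (y k) h4
  rw [dist_comm] at h5
  calc dist (V k (y k)) (v x) ≤ dist (V k (y k)) (v (y k)) + dist (v (y k)) (v x) := dist_triangle _ _ _
    _ < ε := by linarith

/-- `v` is the uniform limit of the solutions `V k` of the discrete problems on the grids of width
`1 / N k`. -/
structure IsGridLimit (q : ℝ) (N : ℕ → ℕ) (V : ℕ → EuclideanSpace ℝ (Fin n) → ℝ)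
    (v : EuclideanSpace ℝ (Fin n) → ℝ) : Prop where
  pos : ∀ k, 0 < N k
  tendsto : Tendsto N atTop atTop
  continuousOn : ∀ k, ContinuousOn (V k) (closedBall 0 1)
  continuousOn_limit : ContinuousOn v (closedBall 0 1)
  unif : TendstoUniformlyOn V v atTop (closedBall 0 1)
  nonneg : ∀ k, ∀ x ∈ closedBall 0 1, 0 ≤ V k x
  bounded : ∃ M, ∀ k, ∀ x ∈ closedBall 0 1, V k x ≤ M
  le_volume : ∀ k, ∀ x ∈ gridNodes n (N k), 0 < V k x →
    ENNReal.ofReal ((1 / N k) ^ n * V k x ^ q) ≤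
      volume (subdifferential (gridNodes n (N k) ∪ sphere 0 1) (V k) x)
  volume_le : ∀ k, ∀ x ∈ gridNodes n (N k),
    volume (subdifferential (gridNodes n (N k) ∪ sphere 0 1) (V k) x) ≤
      ENNReal.ofReal ((1 / N k) ^ n * V k x ^ q)

namespace IsGridLimit

variable {q : ℝ} {N : ℕ → ℕ} {V : ℕ → EuclideanSpace ℝ (Fin n) → ℝ}
  {v : EuclideanSpace ℝ (Fin n) → ℝ}

theorem tendsto_width (h : IsGridLimit q N V v) (c : ℝ) :
    Tendsto (fun k => c / (N k : ℝ)) atTop (𝓝 0) :=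
  tendsto_const_nhds.div_atTop (tendsto_natCast_atTop_atTop.comp h.tendsto)

theorem tendsto_gridFloor (h : IsGridLimit q N V v) (z : EuclideanSpace ℝ (Fin n)) :
    Tendsto (fun k => gridFloor (N k) z) atTop (𝓝 z) := by
  rw [tendsto_iff_dist_tendsto_zero]
  refine squeeze_zero (fun _ => dist_nonneg) (fun k => ?_) (h.tendsto_width n)
  rw [dist_comm, dist_eq_norm]
  exact norm_sub_le_of_mem_gridCell (mem_gridCell_gridFloor (h.pos k) z)

theorem eventually_norm_le (h : IsGridLimit q N V v) {s : ℝ} (hs : s < 1) :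
    ∀ᶠ k in atTop, s ≤ 1 - 2 * ((n : ℝ) / N k) := by
  have h1 := (h.tendsto_width n).const_mul 2
  have h2 := h1.const_sub 1
  rw [mul_zero, sub_zero] at h2
  exact (h2.eventually (lt_mem_nhds hs)).mono fun k hk => hk.le

theorem eventually_gridFloor_mem (h : IsGridLimit q N V v) {z : EuclideanSpace ℝ (Fin n)}
    (hz : ‖z‖ < 1) : ∀ᶠ k in atTop, gridFloor (N k) z ∈ gridNodes n (N k) := by
  filter_upwards [h.eventually_norm_le hz] with k hk
  exact gridFloor_mem_gridNodes (h.pos k) hk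

theorem gridNodes_subset_closedBall [NeZero n] (h : IsGridLimit q N V v) (k : ℕ) :
    gridNodes n (N k) ⊆ closedBall 0 1 :=
  (gridNodes_subset_ball (N k) (h.pos k)).trans ball_subset_closedBall

theorem tendsto_apply_gridFloor [NeZero n] (h : IsGridLimit q N V v) {z : EuclideanSpace ℝ (Fin n)}
    (hz : ‖z‖ < 1) : Tendsto (fun k => V k (gridFloor (N k) z)) atTop (𝓝 (v z)) :=
  tendsto_apply_of_tendstoUniformlyOn h.unif h.continuousOn_limit
    (mem_closedBall_zero_iff.2 hz.le)
    ((h.eventually_gridFloor_mem hz).mono fun k hk => h.gridNodes_subset_closedBall k hk)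
    (h.tendsto_gridFloor z)

theorem nonneg_limit (h : IsGridLimit q N V v) {x : EuclideanSpace ℝ (Fin n)}
    (hx : x ∈ closedBall 0 1) : 0 ≤ v x :=
  ge_of_tendsto' (h.unif.tendsto_at hx) fun k => h.nonneg k x hx

/-- Slopes at nodes near a compact set accumulate at slopes of the limit. -/
theorem mem_subdifferential_of_frequently [NeZero n] (h : IsGridLimit q N V v)
    {C : Set (EuclideanSpace ℝ (Fin n))} (hC : IsCompact C) (hCb : C ⊆ ball 0 1)
    {p : EuclideanSpace ℝ (Fin n)}
    (hp : ∃ᶠ k in atTop, ∃ x ∈ gridNodes n (N k), (∃ c ∈ C, ‖c - x‖ ≤ n / N k) ∧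
      p ∈ subdifferential (gridNodes n (N k) ∪ sphere 0 1) (V k) x) :
    p ∈ ⋃ c ∈ C, subdifferential (ball 0 1) v c := by
  obtain ⟨ψ, hψ, hψp⟩ := extraction_of_frequently_atTop hp
  choose x hx hxC hpx using hψp
  choose c hc hcx using hxC
  obtain ⟨a, ha, θ, hθ, hlim⟩ := hC.tendsto_subseq hc
  have hsub : Tendsto (fun j => ψ (θ j)) atTop atTop := hψ.tendsto_atTop.comp hθ.tendsto_atTop
  have hxlim : Tendsto (fun j => x (θ j)) atTop (𝓝 a) := by
    have h1 : Tendsto (fun j => c (θ j) - x (θ j)) atTop (𝓝 0) := by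
      rw [tendsto_zero_iff_norm_tendsto_zero]
      exact squeeze_zero (fun _ => norm_nonneg _) (fun j => hcx (θ j))
        ((h.tendsto_width n).comp hsub)
    simpa using hlim.sub h1
  have hunif : TendstoUniformlyOn (fun j => V (ψ (θ j))) v atTop (closedBall 0 1) :=
    fun u hu => hsub.eventually (h.unif u hu)
  have hV : Tendsto (fun j => V (ψ (θ j)) (x (θ j))) atTop (𝓝 (v a)) :=
    tendsto_apply_of_tendstoUniformlyOn hunif h.continuousOn_limit
      (ball_subset_closedBall (hCb ha))
      (Eventually.of_forall fun j => h.gridNodes_subset_closedBall _ (hx (θ j))) hxlim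
  -- The discrete slope inequality is only available at nodes, so z is approximated by the lower
  -- corners of its cells.
  refine mem_iUnion₂.2 ⟨a, ha, fun z hz => ?_⟩
  rw [mem_ball_zero_iff] at hz
  have h1 := (h.tendsto_apply_gridFloor hz).comp hsub
  have h2 := (h.tendsto_gridFloor z).comp hsub
  have h3 : Tendsto (fun j => V (ψ (θ j)) (x (θ j)) +
      inner ℝ p (gridFloor (N (ψ (θ j))) z - x (θ j))) atTop (𝓝 (v a + inner ℝ p (z - a))) :=
    hV.add ((tendsto_const_nhds (x := p)).inner (h2.sub hxlim))
  refine le_of_tendsto_of_tendsto h3 h1 ?_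
  filter_upwards [hsub.eventually (h.eventually_gridFloor_mem hz)] with j hj
  exact hpx (θ j) _ (Or.inl hj)

/-- The density is approximated from below by step functions on the cells meeting C. Discrete
subdifferentials at different nodes overlap in null sets, so the integral of the step function is at
most the volume of their union, and slopes recurring in these unions are slopes of v on C. -/
theorem lintegral_le_volume_of_isCompact [NeZero n] (h : IsGridLimit q N V v) (hq : 0 ≤ q)
    {C : Set (EuclideanSpace ℝ (Fin n))} (hC : IsCompact C) (hCb : C ⊆ ball 0 1) :
    ∫⁻ x in C, {y | 0 < v y}.indicator (fun y => ENNReal.ofReal (v y ^ q)) x ≤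
      mongeAmpere (ball 0 1) v C := by
  classical
  rcases C.eq_empty_or_nonempty with rfl | hCne
  · simp
  obtain ⟨M, hM⟩ := h.bounded
  obtain ⟨s, hs1, hs⟩ : ∃ s < 1, ∀ x ∈ C, ‖x‖ ≤ s := by
    obtain ⟨x, hx, hmax⟩ := hC.exists_isMaxOn hCne continuous_norm.continuousOn
    exact ⟨‖x‖, by simpa using hCb hx, hmax⟩
  set X : ℕ → Finset (EuclideanSpace ℝ (Fin n)) := fun k =>
    (gridNodes_finite (n := n) (N k) (h.pos k)).toFinset.filter
      fun x => ∃ c ∈ C, c ∈ gridCell (N k) x with hX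
  have hXmem : ∀ k x, x ∈ X k ↔ x ∈ gridNodes n (N k) ∧ ∃ c ∈ C, c ∈ gridCell (N k) x := by
    intro k x; simp [hX]
  set P : ℕ → EuclideanSpace ℝ (Fin n) → Set (EuclideanSpace ℝ (Fin n)) := fun k x =>
    subdifferential (gridNodes n (N k) ∪ sphere 0 1) (V k) x with hP
  set c : ℕ → EuclideanSpace ℝ (Fin n) → ℝ≥0∞ := fun k x =>
    if 0 < V k x then ENNReal.ofReal (V k x ^ q) else 0 with hc
  set g : ℕ → EuclideanSpace ℝ (Fin n) → ℝ≥0∞ := fun k y =>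
    ∑ x ∈ X k, (gridCell (N k) x).indicator (fun _ => c k x) y with hg
  set Q : ℕ → Set (EuclideanSpace ℝ (Fin n)) := fun k => ⋃ x ∈ X k, P k x with hQ
  have hQm : ∀ k, MeasurableSet (Q k) := fun k =>
    Finset.measurableSet_biUnion _ fun x _ => (isClosed_subdifferential _ _ _).measurableSet
  have hcell : ∀ k x, x ∈ X k → c k x * ENNReal.ofReal ((1 / N k : ℝ) ^ n) ≤ volume (P k x) := by
    intro k x hx
    simp only [hc]
    split_ifs with hpos
    · rw [mul_comm, ← ENNReal.ofReal_mul (by positivity)]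
      exact h.le_volume k x ((hXmem k x).1 hx).1 hpos
    · simp
  have hgQ : ∀ k, ∫⁻ y in C, g k y ≤ volume (Q k) := by
    intro k
    calc ∫⁻ y in C, g k y
        = ∑ x ∈ X k, ∫⁻ y in C, (gridCell (N k) x).indicator (fun _ => c k x) y :=
          lintegral_finsetSum _ fun x _ =>
            measurable_const.indicator (measurableSet_gridCell (N k) x)
      _ ≤ ∑ x ∈ X k, volume (P k x) := by
          refine Finset.sum_le_sum fun x hx => ?_
          calc ∫⁻ y in C, (gridCell (N k) x).indicator (fun _ => c k x) y
              ≤ ∫⁻ y, (gridCell (N k) x).indicator (fun _ => c k x) y := setLIntegral_le_lintegral _ _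
            _ = c k x * ENNReal.ofReal ((1 / N k : ℝ) ^ n) := by
                rw [lintegral_indicator_const (measurableSet_gridCell _ _), volume_gridCell]
            _ ≤ _ := hcell k x hx
      _ = volume (Q k) := by
          refine (measure_biUnion_finset₀ (fun x hx y hy hxy => ?_) fun x _ =>
            (isClosed_subdifferential _ _ _).nullMeasurableSet).symm
          exact aedisjoint_subdifferential _ (Or.inl ((hXmem k x).1 hx).1)
            (Or.inl ((hXmem k y).1 hy).1) hxy
  have hgpt : ∀ y ∈ C, {y | 0 < v y}.indicator (fun y => ENNReal.ofReal (v y ^ q)) y ≤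
      liminf (fun k => g k y) atTop := by
    intro y hy
    by_cases hpos : 0 < v y
    · rw [indicator_of_mem (by exact hpos)]
      have hyn : ‖y‖ < 1 := (hs y hy).trans_lt hs1
      have h1 := h.tendsto_apply_gridFloor hyn
      have h2 : Tendsto (fun k => ENNReal.ofReal (V k (gridFloor (N k) y) ^ q)) atTop
          (𝓝 (ENNReal.ofReal (v y ^ q))) :=
        (ENNReal.continuous_ofReal.tendsto _).comp (h1.rpow_const (Or.inr hq))
      rw [← h2.liminf_eq]
      refine liminf_le_liminf ?_
      filter_upwards [h.eventually_gridFloor_mem hyn, h1.eventually (lt_mem_nhds hpos)] with k hk hk2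
      have hmem : gridFloor (N k) y ∈ X k :=
        (hXmem _ _).2 ⟨hk, y, hy, mem_gridCell_gridFloor (h.pos k) y⟩
      simp only [hg]
      rw [sum_indicator_gridCell (h.pos k) _ (fun x hx => ((hXmem k x).1 hx).1.1), if_pos hmem]
      simp [hc, hk2]
    · rw [indicator_of_notMem (by exact hpos)]
      exact zero_le
  have hbound : ∀ᶠ k in atTop, Q k ⊆ closedBall 0 (|M| / ((1 - s) / 2)) := by
    filter_upwards [(h.tendsto_width n).eventually
      (gt_mem_nhds (show (0 : ℝ) < (1 - s) / 2 by linarith))] with k hk2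
    intro p hp
    obtain ⟨x, hx, hpx⟩ := mem_iUnion₂.1 hp
    obtain ⟨hxg, c, hcC, hcx⟩ := (hXmem k x).1 hx
    have h1 := norm_sub_le_of_mem_gridCell hcx
    have h2 := norm_le_norm_add_norm_sub' x c
    rw [norm_sub_rev] at h2
    have h3 := hs c hcC
    have h4 := value_add_norm_mul_le (s := V k x) (M := |M|) (p := p) (x := x) fun z hz =>
      (hpx z (Or.inr hz)).trans ((hM k z (sphere_subset_closedBall hz)).trans (le_abs_self M))
    have h5 := h.nonneg k x (h.gridNodes_subset_closedBall k hxg)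
    rw [mem_closedBall_zero_iff, le_div_iff₀ (by linarith)]
    have h6 : ‖p‖ * ((1 - s) / 2) ≤ ‖p‖ * (1 - ‖x‖) := by
      gcongr
      linarith
    linarith
  obtain ⟨k₀, hk₀⟩ := eventually_atTop.1 hbound
  -- The slopes are uniformly bounded only once the cells are small compared with the distance from
  -- C to the sphere; the shift by `k₀` discards the earlier indices.
  have hlimsup := limsup_measure_le_measure_setOf_frequently_mem volume (fun k => Q (k + k₀))
    (fun k => hQm _) (B := closedBall 0 (|M| / ((1 - s) / 2))) measure_closedBall_lt_top.ne
    fun k => hk₀ _ (Nat.le_add_left _ _)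
  rw [limsup_nat_add (fun k => volume (Q k)) k₀] at hlimsup
  calc ∫⁻ x in C, {y | 0 < v y}.indicator (fun y => ENNReal.ofReal (v y ^ q)) x
      ≤ ∫⁻ y in C, liminf (fun k => g k y) atTop :=
        setLIntegral_mono' hC.measurableSet hgpt
    _ ≤ liminf (fun k => ∫⁻ y in C, g k y) atTop :=
        lintegral_liminf_le fun k => measurable_sum_indicator_gridCell _ _ _
    _ ≤ liminf (fun k => volume (Q k)) atTop := liminf_le_liminf (Eventually.of_forall hgQ)
    _ ≤ limsup (fun k => volume (Q k)) atTop := liminf_le_limsup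
    _ ≤ volume {p | ∃ᶠ k in atTop, p ∈ Q (k + k₀)} := hlimsup
    _ ≤ mongeAmpere (ball 0 1) v C := by
        refine measure_mono fun p hp => ?_
        refine h.mem_subdifferential_of_frequently hC hCb ?_
        have hp' : ∃ᶠ k in atTop, p ∈ Q k := by
          rw [frequently_atTop]
          intro a
          obtain ⟨b, hb, hpb⟩ := frequently_atTop.1 hp a
          exact ⟨b + k₀, hb.trans (Nat.le_add_right _ _), hpb⟩
        refine hp'.mono fun k hk => ?_
        obtain ⟨x, hx, hpx⟩ := mem_iUnion₂.1 hk
        obtain ⟨hxg, c, hcC, hcx⟩ := (hXmem k x).1 hx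
        exact ⟨x, hxg, ⟨c, hcC, norm_sub_le_of_mem_gridCell hcx⟩, hpx⟩

/-- A slope with a unique contact point is eventually a slope at a node near that point. -/
theorem eventually_mem_subdifferential [NeZero n] (h : IsGridLimit q N V v)
    {U : Set (EuclideanSpace ℝ (Fin n))} (hU : IsOpen U) (hUb : U ⊆ ball 0 1)
    {p x : EuclideanSpace ℝ (Fin n)} (hx : x ∈ U) (hp : p ∈ subdifferential (closedBall 0 1) v x)
    (huniq : ∀ y ∈ closedBall 0 1, p ∈ subdifferential (closedBall 0 1) v y → x = y) :
    ∀ᶠ k in atTop, ∃ y ∈ gridNodes n (N k), gridCell (N k) y ⊆ U ∧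
      p ∈ subdifferential (gridNodes n (N k) ∪ sphere 0 1) (V k) y := by
  obtain ⟨r, hr, hrU⟩ := Metric.isOpen_iff.1 hU x hx
  have hxb := hUb hx
  rw [mem_ball_zero_iff] at hxb
  set f : EuclideanSpace ℝ (Fin n) → ℝ := fun z => v z - v x - inner ℝ p (z - x) with hf
  have hfc : ContinuousOn f (closedBall 0 1) :=
    (h.continuousOn_limit.sub continuousOn_const).sub (by fun_prop)
  have hf0 : ∀ z ∈ closedBall 0 1, 0 ≤ f z := fun z hz => by
    have := hp z hz
    simp only [hf]; linarith
  obtain ⟨c, hc, hfar⟩ : ∃ c > 0, ∀ z ∈ closedBall 0 1, r / 2 ≤ dist z x → c ≤ f z := by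
    have hK : IsCompact (closedBall (0 : EuclideanSpace ℝ (Fin n)) 1 ∩ {z | r / 2 ≤ dist z x}) :=
      (isCompact_closedBall _ _).inter_right (isClosed_le continuous_const (by fun_prop))
    rcases (closedBall (0 : EuclideanSpace ℝ (Fin n)) 1 ∩ {z | r / 2 ≤ dist z x}).eq_empty_or_nonempty
      with he | hne
    · refine ⟨1, one_pos, fun z hz hd => ?_⟩
      have : z ∈ (∅ : Set (EuclideanSpace ℝ (Fin n))) := he ▸ ⟨hz, hd⟩
      exact absurd this (notMem_empty z)
    · obtain ⟨y, hy, hmin⟩ := hK.exists_isMinOn hne (hfc.mono inter_subset_left)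
      refine ⟨f y, lt_of_le_of_ne (hf0 y hy.1) fun h0 => ?_, fun z hz hd => hmin ⟨hz, hd⟩⟩
      have hpy : p ∈ subdifferential (closedBall 0 1) v y := by
        intro z hz
        have h1 := hp z hz
        have h2 : v y = v x + inner ℝ p (y - x) := by
          simp only [hf] at h0; linarith
        rw [h2]
        rw [inner_sub_right] at h1 ⊢
        rw [inner_sub_right]
        linarith
      have := huniq y hy.1 hpy
      have hd := hy.2
      rw [this] at hd
      simp at hd
      linarith
  have hfloor : Tendsto (fun k => f (gridFloor (N k) x)) atTop (𝓝 (f x)) :=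
    (hfc x (mem_closedBall_zero_iff.2 hxb.le)).tendsto.comp (tendsto_nhdsWithin_iff.2
      ⟨h.tendsto_gridFloor x, (h.eventually_gridFloor_mem hxb).mono fun k hk =>
        h.gridNodes_subset_closedBall k hk⟩)
  have hfx : f x = 0 := by simp [hf]
  rw [hfx] at hfloor
  -- Two approximation errors and the value of f at the nearby node, each below c/4, cannot reach
  -- the level c that f attains at distance r/2 or more from x; so the discrete minimum lies near x.
  filter_upwards [Metric.tendstoUniformlyOn_iff.1 h.unif (c / 4) (by positivity),
    hfloor.eventually (gt_mem_nhds (show 0 < c / 4 by positivity)),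
    h.eventually_gridFloor_mem hxb,
    (h.tendsto_width n).eventually (gt_mem_nhds (half_pos hr))] with k hk1 hk2 hk3 hk4
  set Y := gridNodes n (N k) ∪ sphere (0 : EuclideanSpace ℝ (Fin n)) 1 with hY
  have hYb : Y ⊆ closedBall 0 1 :=
    union_subset (h.gridNodes_subset_closedBall k) sphere_subset_closedBall
  have hYc : IsCompact Y :=
    (gridNodes_finite (N k) (h.pos k)).isCompact.union (isCompact_sphere _ _)
  obtain ⟨y, hy, hmin⟩ := hYc.exists_isMinOn ⟨_, Or.inl hk3⟩
    (f := fun z => V k z - inner ℝ p z) (((h.continuousOn k).mono hYb).sub (by fun_prop))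
  have hpy : p ∈ subdifferential Y (V k) y := by
    intro z hz
    have := isMinOn_iff.1 hmin z hz
    rw [inner_sub_right]
    linarith
  have hdist : dist y x < r / 2 := by
    by_contra! hge
    have h1 := hfar y (hYb hy) hge
    have h2 := isMinOn_iff.1 hmin _ (Or.inl hk3)
    have h3 := (abs_lt.1 (Real.dist_eq _ _ ▸ hk1 y (hYb hy)))
    have h4 := (abs_lt.1 (Real.dist_eq _ _ ▸ hk1 _ (h.gridNodes_subset_closedBall k hk3)))
    simp only [hf] at h1 hk2
    rw [inner_sub_right] at h1 hk2
    linarith [h3.1, h3.2, h4.1, h4.2]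
  have hyX : y ∈ gridNodes n (N k) := by
    rcases hy with hy | hy
    · exact hy
    · have h1 := hUb (hrU (show y ∈ ball x r by rw [mem_ball]; linarith))
      rw [mem_ball_zero_iff] at h1
      rw [mem_sphere_zero_iff_norm] at hy
      linarith
  refine ⟨y, hyX, fun z hz => hrU ?_, hpy⟩
  have h1 := norm_sub_le_of_mem_gridCell hz
  rw [← dist_eq_norm] at h1
  rw [mem_ball]
  linarith [dist_triangle z y x]

/-- Almost every slope of v on U has a single contact point and is therefore eventually a discrete
slope at a node whose cell lies in U. The density v^q appears without the indicator; for q = 0 the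
two differ on the zero set. -/
theorem volume_le_lintegral_of_isOpen [NeZero n] (h : IsGridLimit q N V v) (hq : 0 ≤ q)
    {U : Set (EuclideanSpace ℝ (Fin n))} (hU : IsOpen U) (hUb : U ⊆ ball 0 1) :
    mongeAmpere (ball 0 1) v U ≤ ∫⁻ x in U, ENNReal.ofReal (v x ^ q) := by
  classical
  obtain ⟨M, hM⟩ := h.bounded
  set X : ℕ → Finset (EuclideanSpace ℝ (Fin n)) := fun k =>
    (gridNodes_finite (n := n) (N k) (h.pos k)).toFinset.filter
      fun x => gridCell (N k) x ⊆ U with hX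
  have hXmem : ∀ k x, x ∈ X k ↔ x ∈ gridNodes n (N k) ∧ gridCell (N k) x ⊆ U := by
    intro k x; simp [hX]
  set P : ℕ → EuclideanSpace ℝ (Fin n) → Set (EuclideanSpace ℝ (Fin n)) := fun k x =>
    subdifferential (gridNodes n (N k) ∪ sphere 0 1) (V k) x with hP
  set c : ℕ → EuclideanSpace ℝ (Fin n) → ℝ≥0∞ := fun k x => ENNReal.ofReal (V k x ^ q) with hc
  set g : ℕ → EuclideanSpace ℝ (Fin n) → ℝ≥0∞ := fun k y =>
    ∑ x ∈ X k, (gridCell (N k) x).indicator (fun _ => c k x) y with hg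
  set Q : ℕ → Set (EuclideanSpace ℝ (Fin n)) := fun k => ⋃ x ∈ X k, P k x with hQ
  have hQg : ∀ k, volume (Q k) ≤ ∫⁻ y in U, g k y := by
    intro k
    calc volume (Q k) ≤ ∑ x ∈ X k, volume (P k x) := measure_biUnion_finset_le _ _
      _ ≤ ∑ x ∈ X k, ∫⁻ y in U, (gridCell (N k) x).indicator (fun _ => c k x) y := by
          refine Finset.sum_le_sum fun x hx => ?_
          rw [lintegral_indicator_const (measurableSet_gridCell _ _),
            Measure.restrict_apply (measurableSet_gridCell _ _),
            inter_eq_left.2 ((hXmem k x).1 hx).2, volume_gridCell, mul_comm,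
            ← ENNReal.ofReal_mul (by positivity)]
          exact h.volume_le k x ((hXmem k x).1 hx).1
      _ = ∫⁻ y in U, g k y := (lintegral_finsetSum _ fun x _ =>
            measurable_const.indicator (measurableSet_gridCell (N k) x)).symm
  have hgval : ∀ k y, g k y = if gridFloor (N k) y ∈ X k then c k (gridFloor (N k) y) else 0 :=
    fun k y => sum_indicator_gridCell (h.pos k) _ (fun x hx => ((hXmem k x).1 hx).1.1) _ _
  have hgM : ∀ k y, g k y ≤ ENNReal.ofReal (M ^ q) := by
    intro k y
    rw [hgval]
    split_ifs with hy
    · have hyb := h.gridNodes_subset_closedBall k ((hXmem k _).1 hy).1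
      exact ENNReal.ofReal_le_ofReal (Real.rpow_le_rpow (h.nonneg k _ hyb) (hM k _ hyb) hq)
    · exact zero_le
  have hgpt : ∀ y ∈ U, limsup (fun k => g k y) atTop ≤ ENNReal.ofReal (v y ^ q) := by
    intro y hy
    have hyn : ‖y‖ < 1 := by simpa using hUb hy
    have h2 : Tendsto (fun k => ENNReal.ofReal (V k (gridFloor (N k) y) ^ q)) atTop
        (𝓝 (ENNReal.ofReal (v y ^ q))) :=
      (ENNReal.continuous_ofReal.tendsto _).comp
        ((h.tendsto_apply_gridFloor hyn).rpow_const (Or.inr hq))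
    rw [← h2.limsup_eq]
    refine limsup_le_limsup (Eventually.of_forall fun k => ?_)
    simp only [hgval]
    split_ifs
    · exact le_rfl
    · exact zero_le
  have hUfin : volume U ≠ ∞ := ne_top_of_le_ne_top measure_ball_lt_top.ne (measure_mono hUb)
  calc mongeAmpere (ball 0 1) v U ≤ volume {p | ∀ᶠ k in atTop, p ∈ Q k} := by
        refine measure_mono_ae ?_
        filter_upwards [ae_unique_contact h.continuousOn_limit] with p hp hpU
        obtain ⟨x, hx, hpx⟩ := mem_iUnion₂.1 hpU
        have hpx' := subdifferential_ball_subset_closedBall h.continuousOn_limit x hpx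
        refine (h.eventually_mem_subdifferential hU hUb hx hpx' fun y hy hpy =>
          hp x (ball_subset_closedBall (hUb hx)) y hy hpx' hpy).mono fun k hk => ?_
        obtain ⟨y, hy, hyU, hpy⟩ := hk
        exact mem_iUnion₂.2 ⟨y, (hXmem k y).2 ⟨hy, hyU⟩, hpy⟩
    _ ≤ liminf (fun k => volume (Q k)) atTop := measure_setOf_eventually_mem_le _ _
    _ ≤ limsup (fun k => volume (Q k)) atTop := liminf_le_limsup
    _ ≤ limsup (fun k => ∫⁻ y in U, g k y) atTop := limsup_le_limsup (Eventually.of_forall hQg)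
    _ ≤ ∫⁻ y in U, limsup (fun k => g k y) atTop := by
        refine limsup_lintegral_le (fun _ => ENNReal.ofReal (M ^ q))
          (fun k => measurable_sum_indicator_gridCell _ _ _)
          (fun k => Eventually.of_forall (hgM k)) ?_
        rw [setLIntegral_const]
        exact ENNReal.mul_ne_top ENNReal.ofReal_ne_top hUfin
    _ ≤ ∫⁻ x in U, ENNReal.ofReal (v x ^ q) := setLIntegral_mono' hU.measurableSet hgpt

end IsGridLimit

namespace IsGridLimit

variable {q : ℝ} {N : ℕ → ℕ} {V : ℕ → EuclideanSpace ℝ (Fin n) → ℝ}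
  {v : EuclideanSpace ℝ (Fin n) → ℝ}

theorem exists_lintegral_bound (h : IsGridLimit q N V v) (hq : 0 ≤ q) :
    ∃ C : ℝ, ∀ x ∈ closedBall 0 1, ENNReal.ofReal (v x ^ q) ≤ ENNReal.ofReal C := by
  obtain ⟨M, hM⟩ := (isCompact_closedBall (0 : EuclideanSpace ℝ (Fin n)) 1).exists_bound_of_continuousOn
    h.continuousOn_limit
  refine ⟨M ^ q, fun x hx => ENNReal.ofReal_le_ofReal ?_⟩
  exact Real.rpow_le_rpow (h.nonneg_limit hx) ((le_abs_self _).trans (hM x hx)) hq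

theorem lintegral_ball_lt_top (h : IsGridLimit q N V v) (hq : 0 ≤ q) :
    ∫⁻ x in ball (0 : EuclideanSpace ℝ (Fin n)) 1, ENNReal.ofReal (v x ^ q) < ∞ := by
  obtain ⟨C, hC⟩ := h.exists_lintegral_bound hq
  calc ∫⁻ x in ball (0 : EuclideanSpace ℝ (Fin n)) 1, ENNReal.ofReal (v x ^ q)
      ≤ ∫⁻ _ in ball (0 : EuclideanSpace ℝ (Fin n)) 1, ENNReal.ofReal C :=
        setLIntegral_mono' measurableSet_ball fun x hx => hC x (ball_subset_closedBall hx)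
    _ < ∞ := by
        rw [setLIntegral_const]
        exact ENNReal.mul_lt_top ENNReal.ofReal_lt_top measure_ball_lt_top

/-- Inner regularity is applied to the measure with the given density; of `mongeAmpere` only
monotonicity is used. The bound in the other direction uses outer regularity in the same way. -/
theorem lintegral_le_mongeAmpere [NeZero n] (h : IsGridLimit q N V v) (hq : 0 ≤ q)
    {A : Set (EuclideanSpace ℝ (Fin n))} (hA : MeasurableSet A) (hAb : A ⊆ ball 0 1) :
    ∫⁻ x in A, {y | 0 < v y}.indicator (fun y => ENNReal.ofReal (v y ^ q)) x ≤
      mongeAmpere (ball 0 1) v A := by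
  set g : EuclideanSpace ℝ (Fin n) → ℝ≥0∞ :=
    {y | 0 < v y}.indicator (fun y => ENNReal.ofReal (v y ^ q)) with hg
  have hfin : ∫⁻ x in A, g x ≠ ∞ := by
    refine ne_top_of_le_ne_top (h.lintegral_ball_lt_top hq).ne ?_
    exact (lintegral_mono_set hAb).trans (lintegral_mono fun x => indicator_le_self _ _ _)
  have := isFiniteMeasure_withDensity hfin
  have h1 : ((volume.restrict A).withDensity g) A = ∫⁻ x in A, g x := by
    rw [withDensity_apply _ hA, Measure.restrict_restrict hA, inter_self]
  rw [← h1, hA.measure_eq_iSup_isCompact]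
  refine iSup₂_le fun K hKA => iSup_le fun hK => ?_
  rw [withDensity_apply _ hK.measurableSet, Measure.restrict_restrict hK.measurableSet,
    inter_eq_left.2 hKA]
  exact (h.lintegral_le_volume_of_isCompact hq hK (hKA.trans hAb)).trans
    (measure_mono (biUnion_subset_biUnion_left hKA))

theorem mongeAmpere_le_lintegral [NeZero n] (h : IsGridLimit q N V v) (hq : 0 ≤ q)
    {A : Set (EuclideanSpace ℝ (Fin n))} (hA : MeasurableSet A) (hAb : A ⊆ ball 0 1) :
    mongeAmpere (ball 0 1) v A ≤ ∫⁻ x in A, ENNReal.ofReal (v x ^ q) := by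
  set g : EuclideanSpace ℝ (Fin n) → ℝ≥0∞ := fun y => ENNReal.ofReal (v y ^ q) with hg
  have := isFiniteMeasure_withDensity (h.lintegral_ball_lt_top hq).ne
  have h1 : ((volume.restrict (ball 0 1)).withDensity g) A = ∫⁻ x in A, g x := by
    rw [withDensity_apply _ hA, Measure.restrict_restrict hA, inter_eq_left.2 hAb]
  rw [← h1, A.measure_eq_iInf_isOpen]
  refine le_iInf₂ fun U hAU => le_iInf fun hU => ?_
  rw [withDensity_apply _ hU.measurableSet, Measure.restrict_restrict hU.measurableSet]
  exact (measure_mono (biUnion_subset_biUnion_left (subset_inter hAU hAb))).trans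
    (h.volume_le_lintegral_of_isOpen hq (hU.inter isOpen_ball) inter_subset_right)

end IsGridLimit

/-! ### Solution of the Dirichlet problem -/

theorem subdifferential_eq_zero_of_mem_interior {Ω : Set (EuclideanSpace ℝ (Fin n))}
    {v : EuclideanSpace ℝ (Fin n) → ℝ} {x : EuclideanSpace ℝ (Fin n)}
    (hx : x ∈ interior (coincidenceSet Ω v)) : subdifferential Ω v x ⊆ {0} := by
  intro p hp
  have hlim : Tendsto (fun t : ℝ => x + t • p) (𝓝[>] 0) (𝓝 x) := by
    have : Continuous fun t : ℝ => x + t • p := by fun_prop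
    have h2 := this.tendsto 0
    rw [zero_smul, add_zero] at h2
    exact h2.mono_left nhdsWithin_le_nhds
  obtain ⟨t, ht, ht0⟩ := ((hlim.eventually (mem_interior_iff_mem_nhds.1 hx)).and
    self_mem_nhdsWithin).exists
  have h1 := hp _ ht.1
  have h2 : v x = 0 := (interior_subset hx).2
  have h3 : v (x + t • p) = 0 := ht.2
  rw [h2, h3, add_sub_cancel_left, inner_smul_right, real_inner_self_eq_norm_sq] at h1
  have h4 : ‖p‖ ^ 2 ≤ 0 := by
    have : (0 : ℝ) < t := ht0
    nlinarith
  have : ‖p‖ = 0 := by nlinarith [norm_nonneg p]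
  simpa using this

/-- Solvability of the Dirichlet problem for `det D²v = v ^ q χ_{v > 0}` in the unit ball. -/
theorem exists_dirichlet_solution [NeZero n] {φ : EuclideanSpace ℝ (Fin n) → ℝ}
    (hφ : ContinuousOn φ (sphere 0 1)) (hφ0 : ∀ z ∈ sphere 0 1, 0 ≤ φ z) {q : ℝ} (hq : 0 ≤ q) :
    ∃ v : EuclideanSpace ℝ (Fin n) → ℝ, IsSolution q (ball 0 1) v ∧
      ContinuousOn v (closedBall 0 1) ∧ ConvexOn ℝ (closedBall 0 1) v ∧
      (∀ x ∈ closedBall 0 1, 0 ≤ v x) ∧ ∀ z ∈ sphere 0 1, v z = φ z := by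
  obtain ⟨M, hM'⟩ := (isCompact_sphere (0 : EuclideanSpace ℝ (Fin n)) 1).exists_bound_of_continuousOn hφ
  have hM : ∀ z ∈ sphere (0 : EuclideanSpace ℝ (Fin n)) 1, φ z ≤ M := fun z hz =>
    (le_abs_self _).trans (hM' z hz)
  obtain ⟨A, hA, hAM⟩ : ∃ A : ℝ, 0 ≤ A ∧ M ^ q ≤ (2 * A) ^ n := by
    -- The maximum with 1 makes 2A ≥ 1, so that its n-th power is no smaller than 2A.
    refine ⟨max (M ^ q) 1, by positivity, ?_⟩
    have h1 : (1 : ℝ) ≤ 2 * max (M ^ q) 1 := by linarith [le_max_right (M ^ q) 1]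
    calc M ^ q ≤ 2 * max (M ^ q) 1 := by linarith [le_max_right (M ^ q) 1, le_max_left (M ^ q) 1]
      _ ≤ (2 * max (M ^ q) 1) ^ n := le_self_pow₀ h1 (NeZero.ne n)
  choose V hV hVn using fun k : ℕ =>
    exists_grid_solution (N := k + 1) k.succ_pos hφ0 hM hq hA hAM
  obtain ⟨v, σ, hσ, hvc, hvb, hunif⟩ := exists_subseq_tendstoUniformlyOn hφ hA hM V hV
  have hlim : IsGridLimit q (fun k => σ k + 1) (fun k => V (σ k)) v :=
    { pos := fun k => Nat.succ_pos _
      tendsto := (tendsto_add_atTop_nat 1).comp hσ.tendsto_atTop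
      continuousOn := fun k x hx => by
        rw [Metric.continuousWithinAt_iff]
        intro ε hε
        obtain ⟨δ, hδ, hh⟩ := exists_equicontinuity_modulus hφ hA hM hx hε
        exact ⟨δ, hδ, fun y hy hd => hh _ (hV _) y hy hd⟩
      continuousOn_limit := hvc
      unif := hunif
      nonneg := fun k => (hV _).nonneg
      bounded := ⟨M, fun k x hx => (hV _).le_of_le hM hx⟩
      le_volume := fun k x hx => (hVn (σ k) x hx).1
      volume_le := fun k x hx => (hVn (σ k) x hx).2 }
  have hvcb : ContinuousOn v (ball 0 1) := hvc.mono ball_subset_closedBall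
  have hconv : ConvexOn ℝ (ball 0 1) v := hvb.convexOn.subset ball_subset_closedBall (convex_ball _ _)
  refine ⟨v, ⟨by rwa [closure_ball _ one_ne_zero], hconv, fun x hx =>
    hvb.nonneg x (ball_subset_closedBall hx), fun A hAm hAb => le_antisymm ?_
    (hlim.lintegral_le_mongeAmpere hq hAm hAb)⟩, hvc, hvb.convexOn, hvb.nonneg, fun z hz =>
    hvb.eq_on_sphere hA hφ hz⟩
  set K := coincidenceSet (ball 0 1) v with hK
  have hKconv : Convex ℝ K := by
    have := hconv.convex_le 0
    convert this using 1
    ext x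
    simp only [hK, coincidenceSet, mem_ofPred_eq]
    exact and_congr_right fun hx => ⟨fun h => h.le, fun h =>
      le_antisymm h (hvb.nonneg x (ball_subset_closedBall hx))⟩
  set P := ball (0 : EuclideanSpace ℝ (Fin n)) 1 ∩ v ⁻¹' Ioi 0 with hP
  have hPm : MeasurableSet P := (hvcb.isOpen_inter_preimage isOpen_ball isOpen_Ioi).measurableSet
  -- The upper bound with density v^q is enough on the positivity set. The frontier of the convex
  -- set K is null, and on the interior of K the only slope is 0; this restores the indicator when q
  -- = 0.
  have hcover : A ⊆ (A ∩ P) ∪ ((A ∩ frontier K) ∪ interior K) := by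
    intro x hx
    by_cases hpos : 0 < v x
    · exact Or.inl ⟨hx, hAb hx, hpos⟩
    · right
      have hxK : x ∈ K := ⟨hAb hx, le_antisymm (not_lt.1 hpos)
        (hvb.nonneg x (ball_subset_closedBall (hAb hx)))⟩
      by_cases hxi : x ∈ interior K
      · exact Or.inr hxi
      · exact Or.inl ⟨hx, subset_closure hxK, hxi⟩
  have h1 : mongeAmpere (ball 0 1) v (A ∩ P) ≤
      ∫⁻ x in A, {y | 0 < v y}.indicator (fun y => ENNReal.ofReal (v y ^ q)) x := by
    refine (hlim.mongeAmpere_le_lintegral hq (hAm.inter hPm) (inter_subset_left.trans hAb)).trans ?_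
    refine le_trans (le_of_eq ?_) (lintegral_mono_set (inter_subset_left (t := P)))
    refine setLIntegral_congr_fun (hAm.inter hPm) fun x hx => ?_
    rw [indicator_of_mem (show x ∈ {y | 0 < v y} from hx.2.2)]
  have h2 : mongeAmpere (ball 0 1) v (A ∩ frontier K) = 0 := by
    refine le_antisymm ((hlim.mongeAmpere_le_lintegral hq
      (hAm.inter isClosed_frontier.measurableSet) (inter_subset_left.trans hAb)).trans ?_) zero_le
    rw [setLIntegral_measure_zero]
    exact measure_mono_null inter_subset_right (hKconv.addHaar_frontier volume)
  have h3 : mongeAmpere (ball 0 1) v (interior K) = 0 :=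
    measure_mono_null (iUnion₂_subset fun x hx => subdifferential_eq_zero_of_mem_interior hx)
      (measure_singleton 0)
  calc mongeAmpere (ball 0 1) v A
      ≤ mongeAmpere (ball 0 1) v ((A ∩ P) ∪ ((A ∩ frontier K) ∪ interior K)) :=
        measure_mono (biUnion_subset_biUnion_left hcover)
    _ ≤ mongeAmpere (ball 0 1) v (A ∩ P) + (mongeAmpere (ball 0 1) v (A ∩ frontier K) +
        mongeAmpere (ball 0 1) v (interior K)) := by
        unfold mongeAmpere
        rw [biUnion_union, biUnion_union]
        exact (measure_union_le _ _).trans (add_le_add le_rfl (measure_union_le _ _))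
    _ ≤ _ := by rw [h2, h3, add_zero, add_zero]; exact h1

/-! ### Comparison principle -/

theorem quadratic_tangent_le {T : EuclideanSpace ℝ (Fin n) →ₗ[ℝ] EuclideanSpace ℝ (Fin n)}
    (hT : T.IsSymmetric) (hT0 : ∀ z, 0 ≤ inner ℝ (T z) z) (L a b : EuclideanSpace ℝ (Fin n)) :
    inner ℝ L a + 1 / 2 * inner ℝ (T a) a + inner ℝ (L + T a) (b - a) ≤
      inner ℝ L b + 1 / 2 * inner ℝ (T b) b := by
  have h1 := hT0 (b - a)
  have h2 : inner ℝ (T b) a = inner ℝ (T a) b := by rw [hT b a, real_inner_comm]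
  rw [map_sub, inner_sub_left, inner_sub_right, inner_sub_right] at h1
  rw [inner_add_left, inner_sub_right, inner_sub_right]
  linarith

/-- Comparison with functions which have a local quadratic minorant with large determinant wherever
they are positive. -/
theorem le_solution_of_local_quadratic [NeZero n] {q : ℝ} (hq : 0 ≤ q)
    {u v : EuclideanSpace ℝ (Fin n) → ℝ} (hv : IsSolution q (ball 0 1) v)
    (hvc : ContinuousOn v (closedBall 0 1)) (huc : ContinuousOn u (closedBall 0 1))
    (huv : ∀ z ∈ sphere 0 1, u z ≤ v z)
    (hloc : ∀ x₀ ∈ ball 0 1, 0 < u x₀ → ∃ (L : EuclideanSpace ℝ (Fin n))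
      (T : EuclideanSpace ℝ (Fin n) →ₗ[ℝ] EuclideanSpace ℝ (Fin n)) (l : ℝ), 0 < l ∧
      T.IsSymmetric ∧ (∀ z, 0 ≤ inner ℝ (T z) z) ∧ u x₀ ^ q < LinearMap.det T ∧
      ∀ᶠ z in 𝓝 0, u x₀ + inner ℝ L z + 1 / 2 * inner ℝ (T z) z + l * ‖z‖ ^ 2 ≤ u (x₀ + z)) :
    ∀ x ∈ closedBall 0 1, u x ≤ v x := by
  by_contra! hcon
  obtain ⟨x₁, hx₁, hlt₁⟩ := hcon
  obtain ⟨x₀, hx₀, hmax⟩ := (isCompact_closedBall (0 : EuclideanSpace ℝ (Fin n)) 1).exists_isMaxOn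
    ⟨x₁, hx₁⟩ (huc.sub hvc)
  have hmax' : ∀ x ∈ closedBall (0 : EuclideanSpace ℝ (Fin n)) 1, u x - v x ≤ u x₀ - v x₀ := hmax
  have hm : v x₀ < u x₀ := by linarith [hmax' x₁ hx₁]
  have hx₀b : x₀ ∈ ball (0 : EuclideanSpace ℝ (Fin n)) 1 := by
    rw [mem_closedBall_zero_iff] at hx₀
    rw [mem_ball_zero_iff]
    refine lt_of_le_of_ne hx₀ fun h => ?_
    linarith [huv x₀ (mem_sphere_zero_iff_norm.2 h)]
  have hv0 := hv.nonneg x₀ hx₀b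
  obtain ⟨L, T, l, hl, hT, hT0, hdet, hquad⟩ := hloc x₀ hx₀b (hv0.trans_lt hm)
  have hvat : ContinuousAt v x₀ :=
    hvc.continuousAt (mem_of_superset (isOpen_ball.mem_nhds hx₀b) ball_subset_closedBall)
  have htrans : Tendsto (fun z => x₀ + z) (𝓝 0) (𝓝 x₀) := by
    have : Continuous fun z : EuclideanSpace ℝ (Fin n) => x₀ + z := by fun_prop
    simpa using this.tendsto 0
  obtain ⟨r, hr, hball⟩ := Metric.nhds_basis_closedBall.mem_iff.1 (hquad.and
    (htrans.eventually ((hvat.eventually (gt_mem_nhds hm)).and (isOpen_ball.mem_nhds hx₀b))))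
  have hnear : ∀ x ∈ closedBall x₀ r, x ∈ ball (0 : EuclideanSpace ℝ (Fin n)) 1 ∧ v x < u x₀ ∧
      v x₀ + (inner ℝ L (x - x₀) + 1 / 2 * inner ℝ (T (x - x₀)) (x - x₀)) + l * ‖x - x₀‖ ^ 2
        ≤ v x := by
    intro x hx
    have h1 := hball (show x - x₀ ∈ closedBall 0 r by
      rwa [mem_closedBall_zero_iff, ← dist_eq_norm])
    simp only [mem_ofPred_eq, add_sub_cancel] at h1
    refine ⟨h1.2.2, h1.2.1, ?_⟩
    have h2 := hmax' x (ball_subset_closedBall h1.2.2)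
    linarith [h1.1]
  set Qd : EuclideanSpace ℝ (Fin n) → ℝ := fun x =>
    v x₀ + (inner ℝ L (x - x₀) + 1 / 2 * inner ℝ (T (x - x₀)) (x - x₀)) with hQd
  -- Since v ≥ Qd + l‖x - x₀‖² on the closed ball, v - Qd < δ confines points to the open ball of
  -- radius r.
  set δ : ℝ := l * r ^ 2 with hδ
  have hδ0 : 0 < δ := by positivity
  have hQc : Continuous Qd := by
    have hTc : Continuous T := T.continuous_of_finiteDimensional
    simp only [hQd]
    fun_prop
  set D : Set (EuclideanSpace ℝ (Fin n)) := ball x₀ r ∩ (fun x => v x - Qd x) ⁻¹' Iio δ with hD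
  have hDb : D ⊆ ball 0 1 := fun x hx => (hnear x (ball_subset_closedBall hx.1)).1
  have hball1 : ball x₀ r ⊆ closedBall 0 1 := fun x hx =>
    ball_subset_closedBall (hnear x (ball_subset_closedBall hx)).1
  have hDo : IsOpen D := ((hvc.mono hball1).sub hQc.continuousOn).isOpen_inter_preimage isOpen_ball
    isOpen_Iio
  have hx₀D : x₀ ∈ D := ⟨mem_ball_self hr, by simpa [hQd] using hδ0⟩
  have hDpos : 0 < volume D := hDo.measure_pos _ ⟨x₀, hx₀D⟩
  have hDfin : volume D < ∞ := (measure_mono inter_subset_left).trans_lt measure_ball_lt_top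
  -- The gradient of `Qd` at a point x of D is a slope of v at a point of D: sliding the tangent
  -- plane of `Qd` up to v, the contact point y satisfies v y - Qd y ≤ v x - Qd x < δ, so it is
  -- interior, and a local minimum of a convex function is global.
  have himage : (fun y => (L - T x₀) + y) '' (T '' D) ⊆ ⋃ y ∈ D, subdifferential (ball 0 1) v y := by
    rintro _ ⟨_, ⟨x, hx, rfl⟩, rfl⟩
    have hp : L - T x₀ + T x = L + T (x - x₀) := by rw [map_sub]; abel
    simp only [hp]
    set p := L + T (x - x₀) with hpdef
    obtain ⟨y, hy, hmin⟩ := (isCompact_closedBall x₀ r).exists_isMinOn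
      ⟨x₀, mem_closedBall_self hr.le⟩ (f := fun y => v y - inner ℝ p y)
      ((hvc.mono fun x hx => ball_subset_closedBall (hnear x hx).1).sub (by fun_prop))
    have h1 := isMinOn_iff.1 hmin x (ball_subset_closedBall hx.1)
    have h2 : v x - Qd x < δ := hx.2
    have h3 := quadratic_tangent_le hT hT0 L (x - x₀) (y - x₀)
    rw [sub_sub_sub_cancel_right, ← hpdef, inner_sub_right p y x] at h3
    have h4 : v y - Qd y < δ := by
      simp only [hQd] at h2 ⊢
      linarith
    have hyb : y ∈ ball x₀ r := by
      have h5 := (hnear y hy).2.2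
      have h6 : l * ‖y - x₀‖ ^ 2 < l * r ^ 2 := by
        simp only [hQd] at h4
        linarith
      have h7 : ‖y - x₀‖ ^ 2 < r ^ 2 := lt_of_mul_lt_mul_left h6 hl.le
      rw [mem_ball, dist_eq_norm]
      exact lt_of_pow_lt_pow_left₀ 2 hr.le h7
    have hyD : y ∈ D := ⟨hyb, h4⟩
    refine mem_iUnion₂.2 ⟨y, hyD, ?_⟩
    have hlocal : IsLocalMinOn (fun y => v y - inner ℝ p y) (ball 0 1) y := by
      refine IsLocalMin.on ?_ _
      exact hmin.isLocalMin (mem_of_superset (isOpen_ball.mem_nhds hyb) ball_subset_closedBall)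
    have hconv : ConvexOn ℝ (ball 0 1) fun y => v y - inner ℝ p y := by
      refine hv.convexOn.sub ?_
      exact (innerSL ℝ p).toLinearMap.concaveOn (convex_ball _ _)
    have hglob := IsMinOn.of_isLocalMinOn_of_convexOn (hDb hyD) hlocal hconv
    intro z hz
    have := isMinOn_iff.1 hglob z hz
    rw [inner_sub_right]
    linarith
  -- The image of D under the affine map has volume det T · |D|, while the equation bounds |∂v(D)|
  -- by u(x₀)^q |D|, as v < u(x₀) on D.
  have h1 : ENNReal.ofReal (LinearMap.det T) * volume D ≤ mongeAmpere (ball 0 1) v D := by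
    have h2 := measure_mono (μ := volume) himage
    rw [image_add_left, measure_preimage_add, Measure.addHaar_image_linearMap] at h2
    rw [abs_of_nonneg ((Real.rpow_nonneg (hv0.trans hm.le) q).trans hdet.le)] at h2
    exact h2
  have h2 : mongeAmpere (ball 0 1) v D ≤ ENNReal.ofReal (u x₀ ^ q) * volume D := by
    rw [hv.det_eq D hDo.measurableSet hDb, ← setLIntegral_const]
    refine setLIntegral_mono' hDo.measurableSet fun x hx => (indicator_le_self _ _ _).trans ?_
    refine ENNReal.ofReal_le_ofReal (Real.rpow_le_rpow (hv.nonneg x (hDb hx)) ?_ hq)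
    exact (hnear x (ball_subset_closedBall hx.1)).2.1.le
  have h3 : ENNReal.ofReal (u x₀ ^ q) * volume D < ENNReal.ofReal (LinearMap.det T) * volume D := by
    rw [ENNReal.mul_lt_mul_iff_left hDpos.ne' hDfin.ne]
    refine (ENNReal.ofReal_lt_ofReal_iff ?_).2 hdet
    exact (Real.rpow_nonneg (hv0.trans hm.le) q).trans_lt hdet
  exact absurd (h1.trans h2) (not_le.2 h3)

/-! ### Second-order expansion of the profile -/

/-- The difference of the two sides has a critical point at 0 with second derivative a(a - 1) - 2κ >
0. -/
theorem eventually_le_one_add_rpow {a κ : ℝ} (hκ : κ < a * (a - 1) / 2) :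
    ∀ᶠ s in 𝓝 (0 : ℝ), 1 + a * s + κ * s ^ 2 ≤ (1 + s) ^ a := by
  set f : ℝ → ℝ := fun s => (1 + s) ^ a - (a * s + κ * s ^ 2) with hf
  have hd : ∀ s : ℝ, -1 < s → ∀ b : ℝ, HasDerivAt (fun s : ℝ => (1 + s) ^ b) (b * (1 + s) ^ (b - 1)) s := by
    intro s hs b
    have := ((hasDerivAt_id s).const_add 1).rpow_const (p := b) (Or.inl (by simp; linarith))
    simpa using this
  have h1 : ∀ s : ℝ, -1 < s → HasDerivAt f (a * (1 + s) ^ (a - 1) - (a + 2 * κ * s)) s := by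
    intro s hs
    refine ((hd s hs a).sub (((hasDerivAt_id s).const_mul a).add
      (((hasDerivAt_id s).pow 2).const_mul κ))).congr_deriv ?_
    simp
    ring
  have h2 : deriv f =ᶠ[𝓝 0] fun s => a * (1 + s) ^ (a - 1) - (a + 2 * κ * s) := by
    filter_upwards [lt_mem_nhds (show (-1 : ℝ) < 0 by norm_num)] with s hs
    exact (h1 s hs).deriv
  have h3 : HasDerivAt (deriv f) (a * (a - 1) - 2 * κ) 0 := by
    refine HasDerivAt.congr_of_eventuallyEq ?_ h2
    refine (((hd 0 (by norm_num) (a - 1)).const_mul a).sub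
      (((hasDerivAt_id (0 : ℝ)).const_mul (2 * κ)).const_add a)).congr_deriv ?_
    simp
  have hmin : IsLocalMin f 0 := by
    refine isLocalMin_of_deriv_deriv_pos ?_ ?_ (h1 0 (by norm_num)).continuousAt
    · rw [h3.deriv]; linarith
    · rw [(h1 0 (by norm_num)).deriv]; simp
  filter_upwards [hmin] with s hs
  simp only [hf] at hs
  simp at hs
  linarith

/-- The sum of the squares of the coordinates in `S`. -/
def partialSq (S : Finset (Fin n)) (x : EuclideanSpace ℝ (Fin n)) : ℝ := ∑ i ∈ S, x i ^ 2

theorem partialSq_nonneg (S : Finset (Fin n)) (x : EuclideanSpace ℝ (Fin n)) : 0 ≤ partialSq S x :=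
  Finset.sum_nonneg fun _ _ => sq_nonneg _

theorem partialSq_add_partialSq_compl (S : Finset (Fin n)) (x : EuclideanSpace ℝ (Fin n)) :
    partialSq S x + partialSq Sᶜ x = ‖x‖ ^ 2 := by
  rw [EuclideanSpace.real_norm_sq_eq, partialSq, partialSq, Finset.sum_add_sum_compl]

theorem continuous_partialSq (S : Finset (Fin n)) : Continuous (partialSq S) := by
  unfold partialSq
  fun_prop

theorem partialSq_add (S : Finset (Fin n)) (x z : EuclideanSpace ℝ (Fin n)) :
    partialSq S (x + z) = partialSq S x + 2 * ∑ i ∈ S, x i * z i + partialSq S z := by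
  simp only [partialSq, PiLp.add_apply, Finset.mul_sum]
  rw [← Finset.sum_add_distrib, ← Finset.sum_add_distrib]
  exact Finset.sum_congr rfl fun i _ => by ring

theorem sq_sum_mul_le (S : Finset (Fin n)) (x z : EuclideanSpace ℝ (Fin n)) :
    (∑ i ∈ S, x i * z i) ^ 2 ≤ partialSq S x * partialSq S z :=
  Finset.sum_mul_sq_le_sq_mul_sq S _ _

theorem sq_le_partialSq {S : Finset (Fin n)} {i : Fin n} (hi : i ∈ S) (x : EuclideanSpace ℝ (Fin n)) :
    x i ^ 2 ≤ partialSq S x :=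
  Finset.single_le_sum (f := fun i => x i ^ 2) (fun _ _ => sq_nonneg _) hi

/-- Local quadratic minorant of a power of the distance to a subspace. -/
theorem eventually_le_partialSq_rpow (S : Finset (Fin n)) {x : EuclideanSpace ℝ (Fin n)}
    (hx : 0 < partialSq S x) {γ κ : ℝ} (hγ : 1 / 2 < γ) (hγ1 : γ < 1)
    (hκ : κ = γ * (2 * γ - 1) / 2) :
    ∀ᶠ z in 𝓝 (0 : EuclideanSpace ℝ (Fin n)),
      partialSq S x ^ γ * (1 + 2 * γ * ((∑ i ∈ S, x i * z i) / partialSq S x) +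
        κ * (partialSq S z / partialSq S x)) ≤ partialSq S (x + z) ^ γ := by
  set b := partialSq S x with hb
  have hκ0 : 0 < κ := by rw [hκ]; nlinarith
  -- The Taylor coefficient γ(1 - γ)/2 with a margin. The linear part contributes γω and the square
  -- at most 4κ'ω to leading order, as y² ≤ ω; with this margin γ - 4κ' = 3κ/2, leaving κ/2 for the
  -- higher-order terms.
  set κ' := γ * (1 - γ) / 2 + κ / 8 with hκ'
  have hκ'0 : 0 < κ' := by rw [hκ']; nlinarith
  set y : EuclideanSpace ℝ (Fin n) → ℝ := fun z => (∑ i ∈ S, x i * z i) / b with hy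
  set ω : EuclideanSpace ℝ (Fin n) → ℝ := fun z => partialSq S z / b with hω
  have hyc : Continuous y := by simp only [hy]; fun_prop
  have hωc : Continuous ω := (continuous_partialSq S).div_const _
  have hy0 : y 0 = 0 := by simp [hy]
  have hω0 : ω 0 = 0 := by simp [hω, partialSq]
  have hσ : Tendsto (fun z => 2 * y z + ω z) (𝓝 0) (𝓝 0) := by
    have : Continuous fun z => 2 * y z + ω z := by fun_prop
    simpa [hy0, hω0] using this.tendsto 0
  have hsmall : ∀ᶠ z in 𝓝 0, κ' * (4 * y z + ω z) < κ / 2 := by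
    have : Continuous fun z => κ' * (4 * y z + ω z) := by fun_prop
    refine this.continuousAt.eventually (gt_mem_nhds ?_)
    simp [hy0, hω0, hκ0]
  have hpow := hσ.eventually (eventually_le_one_add_rpow (a := γ) (κ := -κ') (by
    rw [hκ']; nlinarith))
  filter_upwards [hpow, hsmall] with z h1 h2
  have hyω : y z ^ 2 ≤ ω z := by
    simp only [hy, hω]
    rw [div_pow, div_le_div_iff₀ (by positivity) hx]
    have := sq_sum_mul_le S x z
    calc (∑ i ∈ S, x i * z i) ^ 2 * b ≤ (b * partialSq S z) * b := by gcongr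
      _ = partialSq S z * b ^ 2 := by ring
  have hωn : 0 ≤ ω z := (sq_nonneg _).trans hyω
  have hfac : partialSq S (x + z) = b * (1 + (2 * y z + ω z)) := by
    rw [partialSq_add]
    simp only [hy, hω]
    field_simp
    ring
  have hnn : 0 ≤ 1 + (2 * y z + ω z) := by
    have h3 := partialSq_nonneg S (x + z)
    rw [hfac] at h3
    exact nonneg_of_mul_nonneg_right h3 hx
  rw [hfac, Real.mul_rpow hx.le hnn]
  refine mul_le_mul_of_nonneg_left (le_trans ?_ h1) (by positivity)
  have h4 : κ' * (4 * y z + ω z) * ω z ≤ κ / 2 * ω z := by gcongr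
  have h5 : κ' * y z ^ 2 ≤ κ' * ω z := by gcongr
  have h6 : γ - 4 * κ' = 3 * κ / 2 := by rw [hκ', hκ]; ring
  have h7 : (γ - 4 * κ') * ω z = 3 * κ / 2 * ω z := by rw [h6]
  change 1 + 2 * γ * y z + κ * ω z ≤ 1 + γ * (2 * y z + ω z) + -κ' * (2 * y z + ω z) ^ 2
  nlinarith

/-- The function whose sublevel set touches the subspace on which the coordinates outside `S`
vanish. -/
noncomputable def profile (S : Finset (Fin n)) (j : Fin n) (ε γ : ℝ) (x : EuclideanSpace ℝ (Fin n)) :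
    ℝ :=
  (1 + ε * partialSq S x) * partialSq Sᶜ x ^ γ - 5 * x j

/-- The gradient of `profile`. -/
noncomputable def profileGrad (S : Finset (Fin n)) (j : Fin n) (ε γ : ℝ)
    (x : EuclideanSpace ℝ (Fin n)) : EuclideanSpace ℝ (Fin n) :=
  WithLp.toLp 2 fun i => if i ∈ S then 2 * ε * partialSq Sᶜ x ^ γ * x i else
    2 * γ * (1 + ε * partialSq S x) * partialSq Sᶜ x ^ γ * (x i / partialSq Sᶜ x) -
      if i = j then 5 else 0

theorem inner_profileGrad {S : Finset (Fin n)} {j : Fin n} (hj : j ∉ S) (ε γ : ℝ)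
    (x z : EuclideanSpace ℝ (Fin n)) :
    inner ℝ (profileGrad S j ε γ x) z =
      partialSq Sᶜ x ^ γ * (2 * ε * ∑ i ∈ S, x i * z i +
        2 * γ * (1 + ε * partialSq S x) * ((∑ i ∈ Sᶜ, x i * z i) / partialSq Sᶜ x)) - 5 * z j := by
  have h1 : inner ℝ (profileGrad S j ε γ x) z = ∑ i, profileGrad S j ε γ x i * z i := by
    rw [PiLp.inner_apply]
    exact Finset.sum_congr rfl fun i _ => by simp [mul_comm]
  rw [h1, ← Finset.sum_add_sum_compl S]
  have h2 : ∑ i ∈ S, profileGrad S j ε γ x i * z i =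
      partialSq Sᶜ x ^ γ * (2 * ε * ∑ i ∈ S, x i * z i) := by
    rw [Finset.mul_sum, Finset.mul_sum]
    refine Finset.sum_congr rfl fun i hi => ?_
    simp only [profileGrad, hi, if_true]
    ring
  have h3 : ∑ i ∈ Sᶜ, profileGrad S j ε γ x i * z i =
      partialSq Sᶜ x ^ γ * (2 * γ * (1 + ε * partialSq S x) *
        ((∑ i ∈ Sᶜ, x i * z i) / partialSq Sᶜ x)) - 5 * z j := by
    have h4 : ∑ i ∈ Sᶜ, (if i = j then (5 : ℝ) else 0) * z i = 5 * z j := by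
      rw [Finset.sum_eq_single_of_mem j (Finset.mem_compl.2 hj) fun i _ hne => by simp [hne]]
      simp
    rw [← h4, Finset.sum_div, Finset.mul_sum, Finset.mul_sum, ← Finset.sum_sub_distrib]
    refine Finset.sum_congr rfl fun i hi => ?_
    simp only [profileGrad, Finset.mem_compl.1 hi, if_false]
    ring
  rw [h2, h3]
  ring

/-- Multiplying the expansions of the two factors of the profile leaves mixed terms of size ε =
κ/20. They cost at most ε(10ω + 3α/4), hence half of the available κω and three quarters of the
available εα; the remainder is κω/2 + κα/80. -/
theorem profile_minorant_aux {κ γ f B y α ω : ℝ} (hκ0 : 0 ≤ κ) (hκ1 : κ ≤ 1) (hγ0 : 0 ≤ γ)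
    (hγ1 : γ ≤ 1) (hf1 : 1 ≤ f) (hα0 : 0 ≤ α) (hω0 : 0 ≤ ω) (hBα : B ^ 2 ≤ α) (hyω : y ^ 2 ≤ ω)
    (hy : |y| ≤ 1 / 8) (hB : |B| ≤ 1) :
    f + 2 * (κ / 20) * B + 2 * γ * f * y + κ / 80 * (α + ω) ≤
      (f + 2 * (κ / 20) * B + κ / 20 * α) * (1 + 2 * γ * y + κ * ω) := by
  rw [abs_le] at hy hB
  have hκω : 0 ≤ κ * ω := by positivity
  have hκα : 0 ≤ κ * α := by positivity
  have c1 : -(1 / 2 * α + 8 * ω) ≤ 4 * γ * (B * y) := by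
    have e1 : |4 * (B * y)| ≤ 1 / 2 * α + 8 * ω :=
      abs_le.2 ⟨by linarith [sq_nonneg (B + 4 * y)], by linarith [sq_nonneg (B - 4 * y)]⟩
    have e2 : |4 * γ * (B * y)| ≤ |4 * (B * y)| := by
      rw [show 4 * γ * (B * y) = γ * (4 * (B * y)) by ring, abs_mul, abs_of_nonneg hγ0]
      exact mul_le_of_le_one_left (abs_nonneg _) hγ1
    linarith [neg_abs_le (4 * γ * (B * y))]
  have c2 : -(2 * ω) ≤ 2 * B * (κ * ω) := by
    have h1 : κ * ω ≤ ω := mul_le_of_le_one_left hω0 hκ1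
    have h2 : -1 * (κ * ω) ≤ B * (κ * ω) := mul_le_mul_of_nonneg_right hB.1 hκω
    linarith
  have c3 : -(1 / 4 * α) ≤ α * (2 * γ * y) := by
    have h1 : γ * (-(1 / 8)) ≤ γ * y := mul_le_mul_of_nonneg_left hy.1 hγ0
    have h2 : α * (-(1 / 4)) ≤ α * (2 * γ * y) := mul_le_mul_of_nonneg_left (by linarith) hα0
    linarith
  have c4 : 0 ≤ α * (κ * ω) := by positivity
  have c5 : κ * ω ≤ f * (κ * ω) := le_mul_of_one_le_left hκω hf1
  have c6 : κ / 20 * (-(1 / 2 * α + 8 * ω) - 2 * ω - 1 / 4 * α) ≤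
      κ / 20 * (4 * γ * (B * y) + 2 * B * (κ * ω) + α * (2 * γ * y) + α * (κ * ω)) :=
    mul_le_mul_of_nonneg_left (by linarith) (by positivity)
  linarith

theorem eventually_le_profile {S : Finset (Fin n)} {j : Fin n} (hj : j ∉ S)
    {x : EuclideanSpace ℝ (Fin n)} (hx1 : ‖x‖ ≤ 1) (hx : 0 < partialSq Sᶜ x) {γ κ : ℝ}
    (hγ : 1 / 2 < γ) (hγ1 : γ < 1) (hκ : κ = γ * (2 * γ - 1) / 2) :
    ∀ᶠ z in 𝓝 (0 : EuclideanSpace ℝ (Fin n)),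
      profile S j (κ / 20) γ x + inner ℝ (profileGrad S j (κ / 20) γ x) z +
        κ / 80 * partialSq Sᶜ x ^ γ * (partialSq S z + partialSq Sᶜ z / partialSq Sᶜ x) ≤
      profile S j (κ / 20) γ (x + z) := by
  have hκ0 : 0 < κ := by rw [hκ]; nlinarith
  have hκ1 : κ ≤ 1 := by rw [hκ]; nlinarith
  have hγ0 : 0 ≤ γ := by linarith
  set ε := κ / 20 with hε
  have hε0 : 0 < ε := by positivity
  set b := partialSq Sᶜ x with hb
  set R := b ^ γ with hR
  have hR0 : 0 < R := by positivity
  set f₀ := 1 + ε * partialSq S x with hf₀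
  have ha0 := partialSq_nonneg S x
  have ha1 : partialSq S x ≤ 1 := by
    have h1 := partialSq_add_partialSq_compl S x
    have h2 : ‖x‖ ^ 2 ≤ 1 := pow_le_one₀ (norm_nonneg _) hx1
    linarith
  have hf1 : 1 ≤ f₀ := by
    have : 0 ≤ ε * partialSq S x := by positivity
    linarith
  set y : EuclideanSpace ℝ (Fin n) → ℝ := fun z => (∑ i ∈ Sᶜ, x i * z i) / b with hy
  set B : EuclideanSpace ℝ (Fin n) → ℝ := fun z => ∑ i ∈ S, x i * z i with hB
  have hyc : Continuous y := by simp only [hy]; fun_prop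
  have hBc : Continuous B := by simp only [hB]; fun_prop
  have hy0 : ∀ᶠ z in 𝓝 0, |y z| < 1 / 8 := by
    refine hyc.abs.continuousAt.eventually (gt_mem_nhds ?_)
    simp [hy]
  have hB0 : ∀ᶠ z in 𝓝 0, |B z| < 1 := by
    refine hBc.abs.continuousAt.eventually (gt_mem_nhds ?_)
    simp [hB]
  filter_upwards [eventually_le_partialSq_rpow Sᶜ hx hγ hγ1 hκ, hy0, hB0] with z h1 h2 h3
  rw [inner_profileGrad hj, ← hb, ← hR, ← hf₀]
  change R * (1 + 2 * γ * y z + κ * (partialSq Sᶜ z / b)) ≤ _ at h1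
  change _ + (R * (2 * ε * B z + 2 * γ * f₀ * y z) - 5 * z j) + _ ≤ _
  set α := partialSq S z with hα
  set ω := partialSq Sᶜ z / b with hω
  have hα0 : 0 ≤ α := partialSq_nonneg S z
  have hω0 : 0 ≤ ω := div_nonneg (partialSq_nonneg _ _) hx.le
  have hBα : B z ^ 2 ≤ α := by
    have := sq_sum_mul_le S x z
    calc B z ^ 2 ≤ partialSq S x * α := this
      _ ≤ 1 * α := by gcongr
      _ = α := one_mul _
  have hyω : y z ^ 2 ≤ ω := by
    simp only [hy, hω]
    rw [div_pow, div_le_div_iff₀ (by positivity) hx]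
    have := sq_sum_mul_le Sᶜ x z
    calc (∑ i ∈ Sᶜ, x i * z i) ^ 2 * b ≤ (b * partialSq Sᶜ z) * b := by gcongr
      _ = partialSq Sᶜ z * b ^ 2 := by ring
  have hf : 1 + ε * partialSq S (x + z) = f₀ + 2 * ε * B z + ε * α := by
    rw [partialSq_add]; ring
  have hfn : 0 ≤ f₀ + 2 * ε * B z + ε * α := by
    rw [← hf]
    have := partialSq_nonneg S (x + z)
    positivity
  have h4 : (f₀ + 2 * ε * B z + ε * α) * (R * (1 + 2 * γ * y z + κ * ω)) ≤
      (f₀ + 2 * ε * B z + ε * α) * partialSq Sᶜ (x + z) ^ γ :=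
    mul_le_mul_of_nonneg_left h1 hfn
  have key := profile_minorant_aux hκ0.le hκ1 hγ0 hγ1.le hf1 hα0 hω0 hBα hyω h2.le h3.le
  rw [← hε] at key
  have h5 := mul_le_mul_of_nonneg_left key hR0.le
  simp only [profile, ← hb, ← hR, ← hf₀, hf, PiLp.add_apply]
  linarith

/-! ### Determinant bound for the barrier -/

/-- A positive diagonal quadratic form plus the square of a linear form, with a lower bound for its
determinant. -/
theorem exists_diagonal_add_rankOne {D : Fin n → ℝ} (hD : ∀ i, 0 < D i)
    (G : EuclideanSpace ℝ (Fin n)) {s : ℝ} (hs : 0 ≤ s) :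
    ∃ T : EuclideanSpace ℝ (Fin n) →ₗ[ℝ] EuclideanSpace ℝ (Fin n), T.IsSymmetric ∧
      (∀ z, inner ℝ (T z) z = ∑ i, D i * z i ^ 2 + s * inner ℝ G z ^ 2) ∧
      ∀ j, (∏ i ∈ Finset.univ.erase j, D i) * (s * G j ^ 2) ≤ LinearMap.det T := by
  set M : Matrix (Fin n) (Fin n) ℝ := Matrix.of fun i j => (if i = j then D i else 0) + s * G i * G j
    with hM
  -- This factorisation puts the matrix determinant lemma within reach: det = ∏ D_i · (1 + s ∑
  -- G_i²/D_i), of which the j-th summand alone is kept.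
  have hfac : M = Matrix.diagonal D * (1 + Matrix.replicateCol Unit (fun i => s * G i / D i) *
      Matrix.replicateRow Unit (fun i => G i)) := by
    ext i j
    have := (hD i).ne'
    rw [Matrix.diagonal_mul]
    simp only [hM, Matrix.of_apply, Matrix.add_apply, Matrix.one_apply, Matrix.mul_apply,
      Matrix.replicateCol_apply, Matrix.replicateRow_apply, Finset.univ_unique,
      Finset.sum_const, Finset.card_singleton, one_smul]
    split_ifs
    · field_simp
    · field_simp
      ring
  have hdet : M.det = (∏ i, D i) * (1 + ∑ i, s * G i ^ 2 / D i) := by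
    rw [hfac, Matrix.det_mul, Matrix.det_diagonal, Matrix.det_one_add_replicateCol_mul_replicateRow]
    congr 2
    exact Finset.sum_congr rfl fun i _ => by ring
  refine ⟨Matrix.toEuclideanLin M, ?_, fun z => ?_, fun j => ?_⟩
  · rw [Matrix.isSymmetric_toEuclideanLin_iff]
    ext i j
    by_cases hij : i = j
    · subst hij; simp [hM]
    · simp [hM, hij, Ne.symm hij]; ring
  · have hG : inner ℝ G z = ∑ i, G i * z i := by
      rw [PiLp.inner_apply]
      exact Finset.sum_congr rfl fun i _ => by simp [mul_comm]
    have hT : ∀ i, (Matrix.toEuclideanLin M z) i = D i * z i + s * G i * ∑ k, G k * z k := by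
      intro i
      rw [Matrix.ofLp_toLpLin, Matrix.toLin'_apply, Matrix.mulVec, dotProduct]
      simp only [hM, Matrix.of_apply, add_mul, Finset.sum_add_distrib, ite_mul, zero_mul,
        Finset.sum_ite_eq, Finset.mem_univ, if_true, Finset.mul_sum]
      congr 1
      exact Finset.sum_congr rfl fun k _ => by ring
    rw [hG, PiLp.inner_apply, sq (∑ i, G i * z i), ← mul_assoc, Finset.mul_sum,
      ← Finset.sum_add_distrib]
    refine Finset.sum_congr rfl fun i _ => ?_
    rw [hT]
    simp only [RCLike.inner_apply, conj_trivial]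
    ring
  · rw [show Matrix.toEuclideanLin M = Matrix.toLpLin 2 2 M from rfl, LinearMap.det_toLpLin, hdet,
      ← Finset.mul_prod_erase _ _ (Finset.mem_univ j)]
    have hprod : 0 ≤ ∏ i ∈ Finset.univ.erase j, D i := Finset.prod_nonneg fun i _ => (hD i).le
    have hsum : s * G j ^ 2 / D j ≤ ∑ i, s * G i ^ 2 / D i :=
      Finset.single_le_sum (f := fun i => s * G i ^ 2 / D i)
        (fun i _ => div_nonneg (mul_nonneg hs (sq_nonneg _)) (hD i).le) (Finset.mem_univ j)
    calc (∏ i ∈ Finset.univ.erase j, D i) * (s * G j ^ 2)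
        = D j * (∏ i ∈ Finset.univ.erase j, D i) * (s * G j ^ 2 / D j) := by
          have := (hD j).ne'
          field_simp
      _ ≤ D j * (∏ i ∈ Finset.univ.erase j, D i) * (1 + ∑ i, s * G i ^ 2 / D i) := by
          have := (hD j).le
          gcongr
          linarith

/-- The subsolution. -/
noncomputable def barrier (S : Finset (Fin n)) (j : Fin n) (ε γ p A : ℝ)
    (x : EuclideanSpace ℝ (Fin n)) : ℝ :=
  A * max (profile S j ε γ x) 0 ^ p

theorem partialSq_compl_pos_of_profile_pos {S : Finset (Fin n)} {j : Fin n} (hj : j ∉ S) {ε γ : ℝ}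
    (hγ : 0 < γ) {x : EuclideanSpace ℝ (Fin n)} (hx : 0 < profile S j ε γ x) :
    0 < partialSq Sᶜ x := by
  refine lt_of_le_of_ne (partialSq_nonneg _ _) fun h0 => ?_
  have h1 := sq_le_partialSq (Finset.mem_compl.2 hj) x
  rw [← h0] at h1
  have h2 : x j = 0 := by nlinarith
  rw [profile, ← h0, h2, Real.zero_rpow hγ.ne'] at hx
  simp at hx

/-- With b^γ ≤ b^(1/2) and |x_j| ≤ b^(1/2), the first part of the j-th component is at most 2γ · 2 ≤
4 in absolute value, so the coefficient 5 keeps that component at most -1. -/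
theorem one_le_sq_profileGrad {S : Finset (Fin n)} {j : Fin n} (hj : j ∉ S) {ε γ : ℝ} (hε0 : 0 ≤ ε)
    (hε1 : ε ≤ 1) (hγ : 1 / 2 ≤ γ) (hγ1 : γ ≤ 1) {x : EuclideanSpace ℝ (Fin n)} (hx1 : ‖x‖ ≤ 1)
    (hx : 0 < partialSq Sᶜ x) : 1 ≤ profileGrad S j ε γ x j ^ 2 := by
  set b := partialSq Sᶜ x with hb
  have hsum := partialSq_add_partialSq_compl S x
  have hn : ‖x‖ ^ 2 ≤ 1 := pow_le_one₀ (norm_nonneg _) hx1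
  have ha := partialSq_nonneg S x
  have hf : 1 + ε * partialSq S x ≤ 2 := by
    have : ε * partialSq S x ≤ 1 * 1 := by gcongr; linarith
    linarith
  have hf0 : 0 ≤ 1 + ε * partialSq S x := by positivity
  have hR : b ^ γ ≤ √b := by
    rw [Real.sqrt_eq_rpow]
    exact Real.rpow_le_rpow_of_exponent_ge hx (by linarith) hγ
  have hxj : |x j| ≤ √b := Real.abs_le_sqrt (sq_le_partialSq (Finset.mem_compl.2 hj) x)
  have hq : |b ^ γ * (x j / b)| ≤ 1 := by
    rw [abs_mul, abs_div, abs_of_pos hx, abs_of_nonneg (by positivity), ← mul_div_assoc, div_le_one hx]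
    calc b ^ γ * |x j| ≤ √b * √b := by gcongr
      _ = b := Real.mul_self_sqrt hx.le
  have hval : profileGrad S j ε γ x j =
      2 * γ * (1 + ε * partialSq S x) * (b ^ γ * (x j / b)) - 5 := by
    simp only [profileGrad, hj, if_false, if_true, ← hb]
    ring
  have hbound : |2 * γ * (1 + ε * partialSq S x) * (b ^ γ * (x j / b))| ≤ 4 := by
    rw [abs_mul, abs_of_nonneg (by positivity)]
    calc 2 * γ * (1 + ε * partialSq S x) * |b ^ γ * (x j / b)| ≤ 2 * 1 * 2 * 1 := by gcongr
      _ = 4 := by norm_num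
  rw [hval]
  have := (abs_le.1 hbound).2
  nlinarith

theorem profile_le {S : Finset (Fin n)} {j : Fin n} (hj : j ∉ S) {ε γ : ℝ}
    (hε1 : ε ≤ 1) (hγ : 1 / 2 ≤ γ) {x : EuclideanSpace ℝ (Fin n)} (hx1 : ‖x‖ ≤ 1)
    (hx : 0 < partialSq Sᶜ x) : profile S j ε γ x ≤ 7 * partialSq Sᶜ x ^ (1 / 2 : ℝ) := by
  set b := partialSq Sᶜ x with hb
  have hsum := partialSq_add_partialSq_compl S x
  have hn : ‖x‖ ^ 2 ≤ 1 := pow_le_one₀ (norm_nonneg _) hx1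
  have ha := partialSq_nonneg S x
  have hf : 1 + ε * partialSq S x ≤ 2 := by
    have : ε * partialSq S x ≤ 1 * 1 := by gcongr; linarith
    linarith
  have hR : b ^ γ ≤ b ^ (1 / 2 : ℝ) := Real.rpow_le_rpow_of_exponent_ge hx (by linarith) hγ
  have hxj : |x j| ≤ b ^ (1 / 2 : ℝ) := by
    rw [← Real.sqrt_eq_rpow]
    exact Real.abs_le_sqrt (sq_le_partialSq (Finset.mem_compl.2 hj) x)
  have h1 : (1 + ε * partialSq S x) * b ^ γ ≤ 2 * b ^ (1 / 2 : ℝ) := by gcongr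
  rw [profile, ← hb]
  linarith [neg_abs_le (x j)]

/-- Writing the increment of the profile as at least g + Q, with g linear and Q quadratic, the power
p gives the slope Λ = A p k^(p-1) times g + Q plus a multiple of (g + Q)²/k. The diagonal form comes
from Q, the rank-one form from g². -/
theorem exists_barrier_minorant {S : Finset (Fin n)} {j : Fin n} (hj : j ∉ S) {γ κ p A : ℝ}
    (hγ : 1 / 2 < γ) (hγ1 : γ < 1) (hκ : κ = γ * (2 * γ - 1) / 2) (hp : 1 < p) (hA : 0 < A)
    {x : EuclideanSpace ℝ (Fin n)} (hx1 : ‖x‖ ≤ 1) (hx : 0 < profile S j (κ / 20) γ x) :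
    ∃ (L : EuclideanSpace ℝ (Fin n)) (T : EuclideanSpace ℝ (Fin n) →ₗ[ℝ] EuclideanSpace ℝ (Fin n))
      (l : ℝ), 0 < l ∧ T.IsSymmetric ∧ (∀ z, 0 ≤ inner ℝ (T z) z) ∧
      (A * (p * profile S j (κ / 20) γ x ^ (p - 1))) ^ n *
        ((κ / 160 * partialSq Sᶜ x ^ γ) ^ (n - 1) * (partialSq Sᶜ x)⁻¹ ^ (Sᶜ.card - 1)) *
        ((p - 1) / (4 * profile S j (κ / 20) γ x)) ≤ LinearMap.det T ∧
      ∀ᶠ z in 𝓝 0, barrier S j (κ / 20) γ p A x + inner ℝ L z + 1 / 2 * inner ℝ (T z) z +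
        l * ‖z‖ ^ 2 ≤ barrier S j (κ / 20) γ p A (x + z) := by
  have hκ0 : 0 < κ := by rw [hκ]; nlinarith
  have hκ1 : κ ≤ 1 := by rw [hκ]; nlinarith
  have hb := partialSq_compl_pos_of_profile_pos hj (by linarith) hx
  have hloc := eventually_le_profile hj hx1 hb hγ hγ1 hκ
  have hgrad := one_le_sq_profileGrad hj (ε := κ / 20) (γ := γ) (by positivity) (by linarith) hγ.le
    hγ1.le hx1 hb
  set G := profileGrad S j (κ / 20) γ x with hG
  set k := profile S j (κ / 20) γ x with hk
  set b := partialSq Sᶜ x with hbdef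
  have hb1 : b ≤ 1 := by
    have h1 := partialSq_add_partialSq_compl S x
    have h2 : ‖x‖ ^ 2 ≤ 1 := pow_le_one₀ (norm_nonneg _) hx1
    have h3 := partialSq_nonneg S x
    linarith
  set R := b ^ γ with hR
  have hR0 : 0 < R := by positivity
  set Λ := A * (p * k ^ (p - 1)) with hΛ
  have hkp : 0 < k ^ (p - 1) := Real.rpow_pos_of_pos hx _
  have hΛ0 : 0 < Λ := by positivity
  have hp1 : 0 < p - 1 := by linarith
  -- Half of ΛQ pays for replacing (g + Q)² by g²/2. Of the other half, Λ Q/4 goes into T (which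
  -- enters with a factor 1/2) and Λ Q/4 into the strict term l‖z‖².
  set D : Fin n → ℝ := fun i => Λ * (κ / 160 * R) * (if i ∈ S then 1 else b⁻¹) with hD
  have hD0 : ∀ i, 0 < D i := fun i => by
    simp only [hD]
    split_ifs <;> positivity
  set s := Λ * ((p - 1) / (4 * k)) with hs
  have hs0 : 0 ≤ s := by positivity
  obtain ⟨T, hTs, hTq, hTd⟩ := exists_diagonal_add_rankOne hD0 G hs0
  set Q : EuclideanSpace ℝ (Fin n) → ℝ := fun z =>
    κ / 80 * R * (partialSq S z + partialSq Sᶜ z / b) with hQ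
  have hQ0 : ∀ z, 0 ≤ Q z := fun z => by
    have h1 := partialSq_nonneg S z
    have h2 := partialSq_nonneg Sᶜ z
    simp only [hQ]
    positivity
  have hDQ : ∀ z : EuclideanSpace ℝ (Fin n), ∑ i, D i * z i ^ 2 = Λ / 2 * Q z := by
    intro z
    rw [← Finset.sum_add_sum_compl S]
    have h1 : ∑ i ∈ S, D i * z i ^ 2 = Λ * (κ / 160 * R) * partialSq S z := by
      rw [partialSq, Finset.mul_sum]
      exact Finset.sum_congr rfl fun i hi => by simp [hD, hi]
    have h2 : ∑ i ∈ Sᶜ, D i * z i ^ 2 = Λ * (κ / 160 * R) * b⁻¹ * partialSq Sᶜ z := by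
      rw [partialSq, Finset.mul_sum]
      exact Finset.sum_congr rfl fun i hi => by simp [hD, Finset.mem_compl.1 hi]
    rw [h1, h2]
    simp only [hQ]
    field_simp
    ring
  refine ⟨Λ • G, T, Λ * (κ / 320 * R), by positivity, hTs, fun z => ?_, ?_, ?_⟩
  · rw [hTq, hDQ]
    have := hQ0 z
    positivity
  · refine le_trans (le_of_eq ?_) ((mul_le_mul_of_nonneg_left (le_mul_of_one_le_right hs0 hgrad)
      (Finset.prod_nonneg fun i _ => (hD0 i).le)).trans (hTd j))
    have hcard : (Finset.univ.erase j).card = n - 1 := by simp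
    have hfil : ((Finset.univ.erase j).filter fun i => i ∉ S) = Sᶜ.erase j := by
      ext i; simp [and_comm]
    have hpow : Λ ^ n = Λ ^ (n - 1) * Λ := by
      rw [← pow_succ, Nat.sub_add_cancel (Fin.pos j)]
    simp only [hD]
    rw [Finset.prod_mul_distrib, Finset.prod_const, hcard, Finset.prod_ite, hfil, Finset.prod_const,
      Finset.prod_const, Finset.card_erase_of_mem (Finset.mem_compl.2 hj), one_pow, one_mul,
      mul_pow Λ (κ / 160 * R), hpow, hs]
    ring
  · set g : EuclideanSpace ℝ (Fin n) → ℝ := fun z => inner ℝ G z with hg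
    have hQc : Continuous Q := by
      have h1 := continuous_partialSq S
      have h2 := continuous_partialSq Sᶜ
      simp only [hQ]
      fun_prop
    have hgc : Continuous g := by simp only [hg]; fun_prop
    have hQz : Q 0 = 0 := by simp [hQ, partialSq]
    have hgz : g 0 = 0 := by simp [hg]
    have hσ : Tendsto (fun z => (g z + Q z) / k) (𝓝 0) (𝓝 0) := by
      have : Continuous fun z => (g z + Q z) / k := (hgc.add hQc).div_const _
      simpa [hQz, hgz] using this.tendsto 0
    have hsmall : ∀ᶠ z in 𝓝 0, (p - 1) * Q z < 2 * k := by
      have : Continuous fun z => (p - 1) * Q z := by fun_prop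
      refine this.continuousAt.eventually (gt_mem_nhds ?_)
      simp [hQz, hx]
    filter_upwards [hloc, hσ.eventually (eventually_le_one_add_rpow (a := p) (κ := p * (p - 1) / 4)
      (by nlinarith)), hσ.eventually (lt_mem_nhds (show (-1 : ℝ) < 0 by norm_num)), hsmall]
      with z h1 h2 h3 h4
    change k + g z + Q z ≤ _ at h1
    have hbar : barrier S j (κ / 20) γ p A x = A * k ^ p := by
      rw [barrier, ← hk, max_eq_left hx.le]
    have hkk : k ^ p = k ^ (p - 1) * k := by
      rw [← Real.rpow_add_one hx.ne']; congr 1; ring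
    set σ := (g z + Q z) / k with hσd
    have hfac : k + g z + Q z = k * (1 + σ) := by
      rw [hσd]; field_simp; ring
    have h5 : A * (k ^ p * (1 + p * σ + p * (p - 1) / 4 * σ ^ 2)) ≤
        barrier S j (κ / 20) γ p A (x + z) := by
      rw [barrier]
      refine mul_le_mul_of_nonneg_left ?_ hA.le
      calc k ^ p * (1 + p * σ + p * (p - 1) / 4 * σ ^ 2) ≤ k ^ p * (1 + σ) ^ p := by gcongr
        _ = (k * (1 + σ)) ^ p := (Real.mul_rpow hx.le (by linarith)).symm
        _ ≤ _ := by
          refine Real.rpow_le_rpow (mul_nonneg hx.le (by linarith)) ?_ (by linarith)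
          rw [← hfac]
          exact h1.trans (le_max_left _ _)
    have h6 : A * (k ^ p * (1 + p * σ + p * (p - 1) / 4 * σ ^ 2)) =
        A * k ^ p + Λ * (g z + Q z + (p - 1) / (4 * k) * (g z + Q z) ^ 2) := by
      rw [hΛ, hkk, hσd]; field_simp; ring
    have h7 : g z + Q z / 2 + (p - 1) / (8 * k) * g z ^ 2 ≤
        g z + Q z + (p - 1) / (4 * k) * (g z + Q z) ^ 2 := by
      have e1 : (p - 1) / (4 * k) * (g z ^ 2 / 2 - Q z ^ 2) ≤
          (p - 1) / (4 * k) * (g z + Q z) ^ 2 := by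
        refine mul_le_mul_of_nonneg_left ?_ (by positivity)
        linarith [sq_nonneg (g z + 2 * Q z)]
      have e2 : (p - 1) / (4 * k) * Q z ^ 2 ≤ Q z / 2 := by
        rw [div_mul_eq_mul_div, div_le_iff₀ (by positivity)]
        have := mul_le_mul_of_nonneg_right h4.le (hQ0 z)
        linarith
      have e3 : (p - 1) / (4 * k) * (g z ^ 2 / 2 - Q z ^ 2) =
          (p - 1) / (8 * k) * g z ^ 2 - (p - 1) / (4 * k) * Q z ^ 2 := by
        field_simp; ring
      linarith
    have h8 := mul_le_mul_of_nonneg_left h7 hΛ0.le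
    have h9 : ‖z‖ ^ 2 ≤ partialSq S z + partialSq Sᶜ z / b := by
      rw [← partialSq_add_partialSq_compl S z]
      have : partialSq Sᶜ z ≤ partialSq Sᶜ z / b := le_div_self (partialSq_nonneg _ _) hb hb1
      linarith
    have h10 : Λ * (κ / 320 * R) * ‖z‖ ^ 2 ≤ Λ / 4 * Q z := by
      calc Λ * (κ / 320 * R) * ‖z‖ ^ 2
          ≤ Λ * (κ / 320 * R) * (partialSq S z + partialSq Sᶜ z / b) := by gcongr
        _ = Λ / 4 * Q z := by simp only [hQ]; ring
    have h11 : inner ℝ (Λ • G) z = Λ * g z := by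
      rw [inner_smul_left]; simp [hg]
    have h12 : s * g z ^ 2 = 2 * (Λ * ((p - 1) / (8 * k) * g z ^ 2)) := by
      rw [hs]; field_simp; ring
    rw [hbar, hTq, hDQ, h11]
    change A * k ^ p + Λ * g z + 1 / 2 * (Λ / 2 * Q z + s * g z ^ 2) + _ ≤ _
    rw [h12]
    linarith

/-- The powers of k on the two sides differ by k^(-e). As e ≥ 0, the bound k ≤ 7 b^(1/2) converts
this into b^(-e/2), and the total power of b is at least 1 because b ≤ 1 and its exponent is
nonpositive. What is left is an inequality between constants. -/
theorem barrier_exponent_bound {m : ℕ} (hn : 1 ≤ n) (hm : 1 ≤ m) {A p q c k b γ : ℝ} (hA : 0 < A) (hp : 1 < p)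
    (hc : 0 < c) (hk : 0 < k) (hb : 0 < b) (hb1 : b ≤ 1) (hkb : k ≤ 7 * b ^ (1 / 2 : ℝ)) {e : ℝ}
    (he : e = n + 1 - p * (n - q)) (he0 : 0 ≤ e)
    (hexp : γ * (n - 1) - (m - 1) - e / 2 ≤ 0)
    (hAq : A ^ q < A ^ n * (p ^ n * c ^ (n - 1) * ((p - 1) / 4) * 7 ^ (-e))) :
    (A * k ^ p) ^ q < (A * (p * k ^ (p - 1))) ^ n * ((c * b ^ γ) ^ (n - 1) * b⁻¹ ^ (m - 1)) *
      ((p - 1) / (4 * k)) := by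
  have hp0 : 0 < p - 1 := by linarith
  have h1 : (k ^ (p - 1)) ^ n = k ^ (p * q) * k ^ (-e) * k := by
    rw [← Real.rpow_natCast, ← Real.rpow_mul hk.le, ← Real.rpow_add hk, ← Real.rpow_add_one hk.ne']
    congr 1
    rw [he]; ring
  have h2 : (b ^ γ) ^ (n - 1) * b⁻¹ ^ (m - 1) = b ^ (γ * (n - 1) - (m - 1)) := by
    rw [inv_pow, ← Real.rpow_natCast, ← Real.rpow_mul hb.le, ← Real.rpow_natCast b (m - 1),
      ← Real.rpow_neg hb.le, ← Real.rpow_add hb, Nat.cast_sub hn, Nat.cast_sub hm]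
    congr 1
    push_cast
    ring
  have h3 : 7 ^ (-e) * b ^ (-(e / 2)) ≤ k ^ (-e) := by
    have e1 : (7 * b ^ (1 / 2 : ℝ)) ^ (-e) ≤ k ^ (-e) :=
      Real.rpow_le_rpow_of_nonpos hk hkb (by linarith)
    rw [Real.mul_rpow (by norm_num) (by positivity), ← Real.rpow_mul hb.le] at e1
    convert e1 using 3
    ring
  have h4 : 1 ≤ b ^ (γ * (n - 1) - (m - 1)) * b ^ (-(e / 2)) := by
    rw [← Real.rpow_add hb]
    exact Real.one_le_rpow_of_pos_of_le_one_of_nonpos hb hb1 (by linarith)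
  have h5 : (7 : ℝ) ^ (-e) ≤ k ^ (-e) * b ^ (γ * (n - 1) - (m - 1)) := by
    calc (7 : ℝ) ^ (-e) = 7 ^ (-e) * 1 := (mul_one _).symm
      _ ≤ 7 ^ (-e) * (b ^ (γ * (n - 1) - (m - 1)) * b ^ (-(e / 2))) := by gcongr
      _ = (7 ^ (-e) * b ^ (-(e / 2))) * b ^ (γ * (n - 1) - (m - 1)) := by ring
      _ ≤ _ := by gcongr
  have hkpq : 0 < k ^ (p * q) := Real.rpow_pos_of_pos hk _
  calc (A * k ^ p) ^ q = A ^ q * k ^ (p * q) := by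
        rw [Real.mul_rpow hA.le (by positivity), ← Real.rpow_mul hk.le]
    _ < A ^ n * (p ^ n * c ^ (n - 1) * ((p - 1) / 4) * 7 ^ (-e)) * k ^ (p * q) := by gcongr
    _ ≤ A ^ n * (p ^ n * c ^ (n - 1) * ((p - 1) / 4) *
          (k ^ (-e) * b ^ (γ * (n - 1) - (m - 1)))) * k ^ (p * q) := by gcongr
    _ = A ^ n * (p ^ n * (k ^ (p * q) * k ^ (-e) * k)) * (c ^ (n - 1) *
          b ^ (γ * (n - 1) - (m - 1))) * ((p - 1) / (4 * k)) := by
        field_simp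
    _ = _ := by
        rw [← h1, ← h2]
        ring

theorem continuous_profile (S : Finset (Fin n)) (j : Fin n) (ε : ℝ) {γ : ℝ} (hγ : 0 ≤ γ) :
    Continuous (profile S j ε γ) := by
  have h1 := continuous_partialSq S
  have h2 := (continuous_partialSq Sᶜ).rpow_const fun _ => Or.inr hγ
  unfold profile
  fun_prop

theorem continuous_barrier (S : Finset (Fin n)) (j : Fin n) (ε A : ℝ) {γ p : ℝ} (hγ : 0 ≤ γ)
    (hp : 0 ≤ p) : Continuous (barrier S j ε γ p A) := by
  have h1 := continuous_profile S j ε hγ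
  unfold barrier
  exact continuous_const.mul ((h1.max continuous_const).rpow_const fun _ => Or.inr hp)

theorem barrier_nonneg (S : Finset (Fin n)) (j : Fin n) (ε γ p : ℝ) {A : ℝ} (hA : 0 ≤ A)
    (x : EuclideanSpace ℝ (Fin n)) : 0 ≤ barrier S j ε γ p A x :=
  mul_nonneg hA (Real.rpow_nonneg (le_max_right _ _) _)

theorem barrier_eq_zero {S : Finset (Fin n)} {j : Fin n} {ε γ p A : ℝ} (hp : p ≠ 0)
    {x : EuclideanSpace ℝ (Fin n)} (hx : profile S j ε γ x ≤ 0) : barrier S j ε γ p A x = 0 := by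
  rw [barrier, max_eq_right hx, Real.zero_rpow hp, mul_zero]

theorem barrier_pos_iff {S : Finset (Fin n)} {j : Fin n} {ε γ p A : ℝ} (hp : p ≠ 0) (hA : 0 < A)
    {x : EuclideanSpace ℝ (Fin n)} : 0 < barrier S j ε γ p A x ↔ 0 < profile S j ε γ x := by
  refine ⟨fun h => ?_, fun h => ?_⟩
  · by_contra! hx
    rw [barrier_eq_zero hp hx] at h
    exact lt_irrefl _ h
  · rw [barrier, max_eq_left h.le]
    exact mul_pos hA (Real.rpow_pos_of_pos h _)

theorem profile_eq_zero {S : Finset (Fin n)} {j : Fin n} (hj : j ∉ S) {ε γ : ℝ} (hγ : γ ≠ 0)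
    {x : EuclideanSpace ℝ (Fin n)} (hx : ∀ i, i ∉ S → x i = 0) : profile S j ε γ x = 0 := by
  have h0 : partialSq Sᶜ x = 0 :=
    Finset.sum_eq_zero fun i hi => by rw [hx i (Finset.mem_compl.1 hi)]; simp
  rw [profile, h0, hx j hj, Real.zero_rpow hγ]
  simp

/-- There are parameters for which `barrier` is a strict subsolution in the unit ball. -/
theorem exists_barrier_strict_subsolution {q : ℝ} (hqn : q < n) (hq : 0 ≤ q) {S : Finset (Fin n)}
    {j : Fin n} (hj : j ∉ S) (hS : 2 * (S.card : ℝ) < n + q) :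
    ∃ ε γ p A : ℝ, 0 ≤ ε ∧ ε ≤ 1 ∧ 0 < γ ∧ 0 < p ∧ 0 < A ∧
      ∀ x ∈ ball 0 1, 0 < barrier S j ε γ p A x → ∃ (L : EuclideanSpace ℝ (Fin n))
        (T : EuclideanSpace ℝ (Fin n) →ₗ[ℝ] EuclideanSpace ℝ (Fin n)) (l : ℝ), 0 < l ∧
        T.IsSymmetric ∧ (∀ z, 0 ≤ inner ℝ (T z) z) ∧
        barrier S j ε γ p A x ^ q < LinearMap.det T ∧
        ∀ᶠ z in 𝓝 0, barrier S j ε γ p A x + inner ℝ L z + 1 / 2 * inner ℝ (T z) z +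
          l * ‖z‖ ^ 2 ≤ barrier S j ε γ p A (x + z) := by
  have hn1 : 1 ≤ n := Fin.pos j
  have hn1' : (1 : ℝ) ≤ n := by exact_mod_cast hn1
  set m := Sᶜ.card with hm
  have hm1 : 1 ≤ m := Finset.card_pos.2 ⟨j, Finset.mem_compl.2 hj⟩
  have hmS : (S.card : ℝ) + m = n := by
    have := Finset.card_add_card_compl S
    rw [Fintype.card_fin] at this
    exact_mod_cast this
  have hgap : 0 < q + 2 * m - n := by linarith
  -- The bound τ < 1 gives γ < 1, τn ≤ 1 gives e ≥ 0, and the last bound makes the exponent of b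
  -- nonpositive; room for it exists because q + 2m - n = n + q - 2|S| > 0.
  obtain ⟨τ, hτ0, hτ1, hτn, hτg⟩ : ∃ τ : ℝ, 0 < τ ∧ τ < 1 ∧ τ * n ≤ 1 ∧ τ * (2 * n) ≤ q + 2 * m - n := by
    refine ⟨min (1 / 2) (min (1 / n) ((q + 2 * m - n) / (2 * n))), by positivity, ?_, ?_, ?_⟩
    · exact (min_le_left _ _).trans_lt (by norm_num)
    · rw [← le_div_iff₀ (by positivity)]
      exact (min_le_right _ _).trans (min_le_left _ _)
    · rw [← le_div_iff₀ (by positivity)]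
      exact (min_le_right _ _).trans (min_le_right _ _)
  set p := 1 + τ with hp
  set γ := (1 + τ) / 2 with hγ
  set κ := γ * (2 * γ - 1) / 2 with hκ
  have hγ0 : 1 / 2 < γ := by rw [hγ]; linarith
  have hγ1 : γ < 1 := by rw [hγ]; linarith
  have hκ0 : 0 < κ := by rw [hκ]; nlinarith
  have hκ1 : κ ≤ 1 := by rw [hκ]; nlinarith
  have hp1 : 1 < p := by rw [hp]; linarith
  set e : ℝ := n + 1 - p * (n - q) with he
  have he0 : 0 ≤ e := by
    have : τ * (n - q) ≤ τ * n := by gcongr; linarith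
    rw [he, hp]
    linarith
  have hexp : γ * (n - 1) - (m - 1) - e / 2 ≤ 0 := by
    have : τ * (2 * n - 1 - q) ≤ τ * (2 * n) := by gcongr; linarith
    rw [he, hp, hγ]
    linarith
  set C : ℝ := p ^ n * (κ / 160) ^ (n - 1) * ((p - 1) / 4) * 7 ^ (-e) with hC
  have hC0 : 0 < C := by
    have : 0 < p - 1 := by linarith
    positivity
  -- Since q < n, A^(n-q) exceeds 1/C for large A.
  obtain ⟨A, hA0, hA⟩ : ∃ A : ℝ, 0 < A ∧ A ^ q < A ^ n * C := by
    have hlim := (tendsto_rpow_atTop (show 0 < (n : ℝ) - q by linarith)).eventually_gt_atTop (1 / C)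
    obtain ⟨A, hA, hA0⟩ := (hlim.and (eventually_gt_atTop 0)).exists
    refine ⟨A, hA0, ?_⟩
    have h1 : A ^ n = A ^ q * A ^ ((n : ℝ) - q) := by
      rw [← Real.rpow_add hA0, ← Real.rpow_natCast]; congr 1; ring
    rw [h1, mul_assoc]
    refine lt_mul_of_one_lt_right (Real.rpow_pos_of_pos hA0 _) ?_
    rwa [div_lt_iff₀ hC0] at hA
  refine ⟨κ / 20, γ, p, A, by positivity, by linarith, by linarith, by linarith, hA0, fun x hx hpos => ?_⟩
  have hx1 : ‖x‖ ≤ 1 := (mem_ball_zero_iff.1 hx).le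
  rw [barrier_pos_iff (by linarith) hA0] at hpos
  have hb := partialSq_compl_pos_of_profile_pos hj (by linarith) hpos
  have hb1 : partialSq Sᶜ x ≤ 1 := by
    have h1 := partialSq_add_partialSq_compl S x
    have h2 : ‖x‖ ^ 2 ≤ 1 := pow_le_one₀ (norm_nonneg _) hx1
    have h3 := partialSq_nonneg S x
    linarith
  obtain ⟨L, T, l, hl, hTs, hT0, hTd, hloc⟩ :=
    exists_barrier_minorant hj hγ0 hγ1 hκ hp1 hA0 hx1 hpos
  refine ⟨L, T, l, hl, hTs, hT0, lt_of_lt_of_le ?_ hTd, hloc⟩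
  rw [barrier, max_eq_left hpos.le]
  exact barrier_exponent_bound hn1 hm1 hA0 hp1 (by positivity) hpos hb hb1
    (profile_le hj (by linarith) hγ0.le hx1 hb) he he0 hexp hA

/-! ### Zero set of the solution and the disc in its free boundary -/

/-- A nonnegative convex function on the closed ball vanishes at a point if it vanishes at the ends
of a chord through that point. -/
theorem eq_zero_of_chord {v : EuclideanSpace ℝ (Fin n) → ℝ} (hv : ConvexOn ℝ (closedBall 0 1) v)
    (hv0 : ∀ x ∈ closedBall 0 1, 0 ≤ v x) (i : Fin n) {x : EuclideanSpace ℝ (Fin n)}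
    (hx : x ∈ ball 0 1)
    (h : ∀ s : ℝ, x + s • EuclideanSpace.single i (1 : ℝ) ∈ sphere 0 1 →
      v (x + s • EuclideanSpace.single i (1 : ℝ)) = 0) : v x = 0 := by
  have hxn : ‖x‖ ^ 2 < 1 := by
    rw [mem_ball_zero_iff] at hx
    exact pow_lt_one₀ (norm_nonneg _) hx two_ne_zero
  -- Half the length of the chord through x in direction e_i; its ends have i-th coordinate ±w.
  set w := √(x i ^ 2 + (1 - ‖x‖ ^ 2)) with hw
  have hw2 : w ^ 2 = x i ^ 2 + (1 - ‖x‖ ^ 2) := Real.sq_sqrt (by nlinarith [sq_nonneg (x i)])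
  have hlt : |x i| < w := Real.lt_sqrt_of_sq_lt (by rw [sq_abs]; linarith)
  rw [abs_lt] at hlt
  have hs : ∀ s : ℝ, (s + x i) ^ 2 = w ^ 2 → x + s • EuclideanSpace.single i (1 : ℝ) ∈ sphere 0 1 := by
    intro s hs
    have h1 : ‖x + s • EuclideanSpace.single i (1 : ℝ)‖ ^ 2 = 1 := by
      rw [norm_add_sq_real, inner_smul_right, norm_smul, EuclideanSpace.inner_single_right]
      simp
      linarith
    rw [mem_sphere_zero_iff_norm]
    nlinarith [norm_nonneg (x + s • EuclideanSpace.single i (1 : ℝ))]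
  have ha := hs (-x i - w) (by ring)
  have hb := hs (-x i + w) (by ring)
  have hw0 : 0 < w := by linarith
  have hcomb : ((w - x i) / (2 * w)) • (x + (-x i - w) • EuclideanSpace.single i (1 : ℝ)) +
      ((w + x i) / (2 * w)) • (x + (-x i + w) • EuclideanSpace.single i (1 : ℝ)) = x := by
    have h1 : (w - x i) / (2 * w) + (w + x i) / (2 * w) = 1 := by field_simp; ring
    have h2 : (w - x i) / (2 * w) * (-x i - w) + (w + x i) / (2 * w) * (-x i + w) = 0 := by
      field_simp; ring
    rw [smul_add, smul_add, smul_smul, smul_smul, add_add_add_comm, ← add_smul, ← add_smul, h1, h2]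
    simp
  have ha0 : 0 ≤ (w - x i) / (2 * w) := div_nonneg (by linarith) (by linarith)
  have hb0 : 0 ≤ (w + x i) / (2 * w) := div_nonneg (by linarith) (by linarith)
  have hle := hv.2 (sphere_subset_closedBall ha) (sphere_subset_closedBall hb) ha0 hb0
    (by field_simp; ring)
  rw [hcomb, h _ ha, h _ hb] at hle
  exact le_antisymm (by simpa using hle) (hv0 x (ball_subset_closedBall hx))

/-- The intersection of the unit ball with the coordinate subspace spanned by `S`. -/
def coordinateDisc (S : Finset (Fin n)) : Set (EuclideanSpace ℝ (Fin n)) :=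
  {x ∈ ball 0 1 | ∀ i, i ∉ S → x i = 0}

theorem convex_coordinateDisc (S : Finset (Fin n)) : Convex ℝ (coordinateDisc S) := by
  intro x hx y hy a b ha hb hab
  refine ⟨convex_ball _ _ hx.1 hy.1 ha hb hab, fun i hi => ?_⟩
  simp [hx.2 i hi, hy.2 i hi]

theorem zero_mem_coordinateDisc (S : Finset (Fin n)) : 0 ∈ coordinateDisc S := ⟨by simp, by simp⟩

theorem convexDim_coordinateDisc (S : Finset (Fin n)) : convexDim (coordinateDisc S) = S.card := by
  classical
  have hspan : vectorSpan ℝ (coordinateDisc S) =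
      Submodule.span ℝ (range fun i : S => EuclideanSpace.single (i : Fin n) (1 : ℝ)) := by
    refine le_antisymm (Submodule.span_le.2 ?_) (Submodule.span_le.2 ?_)
    · have hmem : ∀ x ∈ coordinateDisc S, x ∈
          Submodule.span ℝ (range fun i : S => EuclideanSpace.single (i : Fin n) (1 : ℝ)) := by
        intro x hx
        have hsum : x = ∑ i ∈ S, x i • EuclideanSpace.single i (1 : ℝ) := by
          ext k
          by_cases hk : k ∈ S
          · simp [Pi.single_apply, hk]
          · simp [Pi.single_apply, hk, hx.2 k hk]
        rw [hsum]
        exact Submodule.sum_mem _ fun i hi =>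
          Submodule.smul_mem _ _ (Submodule.subset_span ⟨⟨i, hi⟩, rfl⟩)
      rintro _ ⟨x, hx, y, hy, rfl⟩
      exact Submodule.sub_mem _ (hmem x hx) (hmem y hy)
    · rintro _ ⟨i, rfl⟩
      -- The unit vectors lie on the sphere, outside the open disc, hence the factor 1/2.
      have h1 : (1 / 2 : ℝ) • EuclideanSpace.single (i : Fin n) (1 : ℝ) ∈ coordinateDisc S := by
        refine ⟨?_, fun k hk => ?_⟩
        · rw [mem_ball_zero_iff, norm_smul]
          norm_num
        · have : k ≠ i := by rintro rfl; exact hk i.2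
          simp [this]
      have h2 := vsub_mem_vectorSpan ℝ h1 (zero_mem_coordinateDisc S)
      rw [vsub_eq_sub, sub_zero] at h2
      have h3 := Submodule.smul_mem _ (2 : ℝ) h2
      rwa [smul_smul, show (2 : ℝ) * (1 / 2) = 1 by norm_num, one_smul] at h3
  have hind : LinearIndependent ℝ fun i : S => EuclideanSpace.single (i : Fin n) (1 : ℝ) := by
    have h := (EuclideanSpace.basisFun (Fin n) ℝ).toBasis.linearIndependent.comp
      (Subtype.val : S → Fin n) Subtype.val_injective
    have he : (EuclideanSpace.basisFun (Fin n) ℝ).toBasis ∘ (Subtype.val : S → Fin n) =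
        fun i : S => EuclideanSpace.single (i : Fin n) (1 : ℝ) := by
      funext i
      simp
    rwa [he] at h
  rw [convexDim, hspan, finrank_span_eq_card hind, Fintype.card_coe]

/-- If `v` vanishes on the disc, and is positive at points arbitrarily close to it in the direction
`-e_j`, then the disc lies in the non-strictly convex part of the free boundary. -/
theorem coordinateDisc_subset_nonStrictlyConvexPart {v : EuclideanSpace ℝ (Fin n) → ℝ}
    {S : Finset (Fin n)} {i j : Fin n} (hi : i ∈ S)
    (hv : ∀ x ∈ coordinateDisc S, v x = 0)
    (hpos : ∀ x ∈ coordinateDisc S, ∀ s : ℝ, 0 < s → x + s • -EuclideanSpace.single j (1 : ℝ) ∈ ball 0 1 →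
      v (x + s • -EuclideanSpace.single j (1 : ℝ)) ≠ 0) :
    coordinateDisc S ⊆ nonStrictlyConvexPart (ball 0 1) v := by
  have hK : coordinateDisc S ⊆ coincidenceSet (ball 0 1) v := fun x hx => ⟨hx.1, hv x hx⟩
  have hlim : ∀ x w : EuclideanSpace ℝ (Fin n), Tendsto (fun s : ℝ => x + s • w) (𝓝[>] 0) (𝓝 x) := by
    intro x w
    have : Continuous fun s : ℝ => x + s • w := by fun_prop
    have h2 := this.tendsto 0
    rw [zero_smul, add_zero] at h2
    exact h2.mono_left nhdsWithin_le_nhds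
  intro x hx
  refine ⟨⟨hx.1, ?_⟩, ?_⟩
  · rw [frontier_eq_closure_inter_closure]
    refine ⟨subset_closure (hK hx), mem_closure_of_tendsto
      (hlim x (-EuclideanSpace.single j (1 : ℝ))) ?_⟩
    filter_upwards [self_mem_nhdsWithin] with s hs hmem
    exact hpos x hx s hs hmem.1 hmem.2
  -- An exposing functional is maximal on K at x, yet x ± s e_i are both in K; so it is constant on
  -- this segment, against uniqueness of the maximum point.
  · rintro ⟨-, -, f, hf⟩
    set w := EuclideanSpace.single i (1 : ℝ) with hw
    have hmem : ∀ s : ℝ, x + s • w ∈ ball 0 1 → x + s • w ∈ coincidenceSet (ball 0 1) v := by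
      refine fun s hs => hK ⟨hs, fun k hk => ?_⟩
      have : k ≠ i := by rintro rfl; exact hk hi
      simp [hw, hx.2 k hk, this]
    obtain ⟨s, ⟨h1, h2⟩, hs⟩ := ((((hlim x w).eventually (isOpen_ball.mem_nhds hx.1)).and
      ((hlim x (-w)).eventually (isOpen_ball.mem_nhds hx.1))).and self_mem_nhdsWithin).exists
    have hs0 : (0 : ℝ) < s := hs
    have h3 := hf _ (hmem s h1)
    have h4 := hf _ (hmem (-s) (by rw [neg_smul, ← smul_neg]; exact h2))
    rw [map_add, map_smul] at h3 h4
    simp only [smul_eq_mul] at h3 h4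
    have h5 : s * f w = 0 := by linarith [h3.1, h4.1]
    have h6 := h3.2 (by linarith)
    have h7 : s • w = 0 := by simpa using h6
    rw [smul_eq_zero] at h7
    rcases h7 with h7 | h7
    · exact hs0.ne' h7
    · have := congrArg norm h7
      simp [hw] at this

theorem exists_solution_with_disc {q : ℝ} (hq : 0 ≤ q) (hqn : q < n)
    {S : Finset (Fin n)} {i j : Fin n} (hi : i ∈ S) (hj : j ∉ S) (hS : 2 * (S.card : ℝ) < n + q) :
    ∃ v : EuclideanSpace ℝ (Fin n) → ℝ, IsSolution q (ball 0 1) v ∧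
      (∃ x ∈ ball (0 : EuclideanSpace ℝ (Fin n)) 1, v x ≠ 0) ∧
      0 < volume (coincidenceSet (ball 0 1) v) ∧
      coordinateDisc S ⊆ nonStrictlyConvexPart (ball 0 1) v := by
  have : NeZero n := ⟨(Fin.pos j).ne'⟩
  obtain ⟨ε, γ, p, A, hε0, hε1, hγ, hp, hA, hloc⟩ := exists_barrier_strict_subsolution hqn hq hj hS
  set u := barrier S j ε γ p A with hu
  have huc : Continuous u := continuous_barrier S j ε A hγ.le hp.le
  obtain ⟨v, hv, hvc, hvconv, hv0, hvu⟩ := exists_dirichlet_solution huc.continuousOn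
    (fun z _ => barrier_nonneg S j ε γ p hA.le z) hq
  have hle := le_solution_of_local_quadratic hq hv hvc huc.continuousOn
    (fun z hz => (hvu z hz).ge) hloc
  have hij : i ≠ j := by rintro rfl; exact hj hi
  have hdisc : ∀ x ∈ coordinateDisc S, v x = 0 := by
    intro x hx
    refine eq_zero_of_chord hvconv hv0 i hx.1 fun s hs => ?_
    rw [hvu _ hs]
    refine barrier_eq_zero hp.ne' (profile_eq_zero hj hγ.ne' fun k hk => ?_).le
    have : k ≠ i := by rintro rfl; exact hk hi
    simp [hx.2 k hk, this]
  -- Moving along e_i keeps x_j, and on the sphere the first term of the profile is at most 2 < 5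
  -- x_j. The cap is open and nonempty, which yields positive measure of the coincidence set.
  have hcap : ∀ x ∈ ball (0 : EuclideanSpace ℝ (Fin n)) 1, 1 / 2 < x j → v x = 0 := by
    intro x hx hxj
    refine eq_zero_of_chord hvconv hv0 i hx fun s hs => ?_
    rw [hvu _ hs]
    refine barrier_eq_zero hp.ne' ?_
    set z := x + s • EuclideanSpace.single i (1 : ℝ) with hz
    have hzj : z j = x j := by simp [hz, hij.symm]
    have hsum := partialSq_add_partialSq_compl S z
    rw [mem_sphere_zero_iff_norm.1 hs, one_pow] at hsum
    have ha := partialSq_nonneg S z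
    have hb := partialSq_nonneg Sᶜ z
    have h1 : ε * partialSq S z ≤ 1 * 1 := by gcongr; linarith
    have h2 : partialSq Sᶜ z ^ γ ≤ 1 := Real.rpow_le_one hb (by linarith) hγ.le
    have h3 : (1 + ε * partialSq S z) * partialSq Sᶜ z ^ γ ≤ 2 * 1 := by gcongr; linarith
    rw [profile, hzj]
    linarith
  have hpos : ∀ x ∈ coordinateDisc S, ∀ s : ℝ, 0 < s → x + s • -EuclideanSpace.single j (1 : ℝ) ∈ ball 0 1 →
      v (x + s • -EuclideanSpace.single j (1 : ℝ)) ≠ 0 := by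
    intro x hx s hs hb
    refine (lt_of_lt_of_le ?_ (hle _ (ball_subset_closedBall hb))).ne'
    rw [hu, barrier_pos_iff hp.ne' hA, profile]
    have h1 : 0 ≤ (1 + ε * partialSq S (x + s • -EuclideanSpace.single j (1 : ℝ))) *
        partialSq Sᶜ (x + s • -EuclideanSpace.single j (1 : ℝ)) ^ γ := by
      have h2 := partialSq_nonneg S (x + s • -EuclideanSpace.single j (1 : ℝ))
      have h3 := partialSq_nonneg Sᶜ (x + s • -EuclideanSpace.single j (1 : ℝ))
      positivity
    have h4 : (x + s • -EuclideanSpace.single j (1 : ℝ)) j = -s := by simp [hx.2 j hj]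
    rw [h4]
    linarith
  refine ⟨v, hv, ?_, ?_, coordinateDisc_subset_nonStrictlyConvexPart hi hdisc hpos⟩
  · have hb : (0 : EuclideanSpace ℝ (Fin n)) + (1 / 2 : ℝ) • -EuclideanSpace.single j (1 : ℝ) ∈
        ball 0 1 := by
      rw [mem_ball_zero_iff, zero_add, norm_smul]
      norm_num
    exact ⟨_, hb, hpos 0 (zero_mem_coordinateDisc S) (1 / 2) (by norm_num) hb⟩
  · have hopen : IsOpen (ball (0 : EuclideanSpace ℝ (Fin n)) 1 ∩ {x | 1 / 2 < x j}) :=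
      isOpen_ball.inter (isOpen_lt continuous_const (by fun_prop))
    have hne : (ball (0 : EuclideanSpace ℝ (Fin n)) 1 ∩ {x | 1 / 2 < x j}).Nonempty := by
      refine ⟨(3 / 4 : ℝ) • EuclideanSpace.single j (1 : ℝ), ?_, ?_⟩
      · rw [mem_ball_zero_iff, norm_smul]
        norm_num
      · simp
        norm_num
    exact (hopen.measure_pos _ hne).trans_le (measure_mono fun x hx => ⟨hx.1, hcap x hx.1 hx.2⟩)

end MAObstacle

/-! ### Choice of the dimension -/

theorem theorem1p3 (n : ℕ) (q : ℝ) (hq0 : 0 ≤ q) (hqn : q < n) (hnq : 2 < (n : ℝ) + q) :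
    ∃ v : EuclideanSpace ℝ (Fin n) → ℝ,
      MAObstacle.IsSolution q (Metric.ball 0 1) v ∧
      (∃ x ∈ Metric.ball (0 : EuclideanSpace ℝ (Fin n)) 1, v x ≠ 0) ∧
      0 < MeasureTheory.volume (MAObstacle.coincidenceSet (Metric.ball 0 1) v) ∧
      ∃ E : Set (EuclideanSpace ℝ (Fin n)),
        E.Nonempty ∧ Convex ℝ E ∧
        E ⊆ MAObstacle.nonStrictlyConvexPart (Metric.ball 0 1) v ∧
        (MAObstacle.convexDim E : ℤ) = ⌈((n : ℝ) + q) / 2⌉ - 1 ∧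
        IsGreatest {m : ℕ | (m : ℝ) < ((n : ℝ) + q) / 2} (MAObstacle.convexDim E) := by
  obtain ⟨d, hd⟩ : ∃ d : ℕ, (d : ℤ) = ⌈((n : ℝ) + q) / 2⌉ - 1 := by
    refine ⟨(⌈((n : ℝ) + q) / 2⌉ - 1).toNat, Int.toNat_of_nonneg ?_⟩
    have : 1 < ⌈((n : ℝ) + q) / 2⌉ := Int.lt_ceil.2 (by push_cast; linarith)
    linarith
  have hceil : ⌈((n : ℝ) + q) / 2⌉ = (d : ℤ) + 1 := by linarith
  obtain ⟨hlt, hle⟩ := Int.ceil_eq_iff.1 hceil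
  push_cast at hlt hle
  rw [add_sub_cancel_right] at hlt
  -- From q < n follows d < (n + q)/2 < n, which leaves a coordinate j outside S; below, n + q > 2
  -- gives d ≥ 1, hence a direction i in S. S consists of the first d coordinates.
  have hdn : d < n := by
    have : (d : ℝ) < n := by linarith
    exact_mod_cast this
  have hd0 : 0 < d := by
    have : (0 : ℝ) < d := by linarith
    exact_mod_cast this
  have hcard : (Finset.Iio (⟨d, hdn⟩ : Fin n)).card = d := Fin.card_Iio _
  have hdim := MAObstacle.convexDim_coordinateDisc (Finset.Iio (⟨d, hdn⟩ : Fin n))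
  rw [hcard] at hdim
  obtain ⟨v, hv, hne, hvol, hsub⟩ := MAObstacle.exists_solution_with_disc hq0 hqn
    (S := Finset.Iio (⟨d, hdn⟩ : Fin n)) (i := ⟨0, hd0.trans hdn⟩) (j := ⟨d, hdn⟩)
    (Finset.mem_Iio.2 hd0) (by simp) (by rw [hcard]; linarith)
  refine ⟨v, hv, hne, hvol, _, ⟨0, MAObstacle.zero_mem_coordinateDisc _⟩,
    MAObstacle.convex_coordinateDisc _, hsub, by rw [hdim, hd], ?_⟩
  rw [hdim]
  refine ⟨hlt, fun k hk => ?_⟩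
  have hk' : (k : ℝ) < d + 1 := lt_of_lt_of_le hk hle
  have : k < d + 1 := by exact_mod_cast hk'
  omega
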